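/- Let $d\in\{1,2,3\}$ and let $\Omega\subset\mathbb R^d$ be a bounded interval, polygonal or polyhedral domain (open, connected, $\Omega=\operatorname{int}\overline\Omega$). Let $a\in L^\infty(\Omega)^d$ be divergence-free in the sense of distributions, $\mu\in L^\infty(\Omega)$ with $\mu\ge\mu_0>0$ a.e., $f\in L^2(\Omega)$, and put $$a(w,v)=(a\cdot\nabla w,v)+(\mu\nabla w,\nabla v),\qquad w,v\in H^1_0(\Omega),$$ where $(\cdot,\cdot)$ is the inner product of $L^2(\Omega)$. Let $u\in H^1_0(\Omega)$ be the solution of $a(u,v)=(f,v)$ for all $v\in H^1_0(\Omega)$. Assume that 1. $u\in H^2(\Omega)$ (and let $u$ denote its representative that is continuous on $\overline\Omega$), and $\Delta u\neq0$ in $L^2(\Omega)$; 2. either $a$ is (a.e. equal to) a nonzero constant vector, or $a\cdot\nabla u\ne 0$ in $L^2(\Omega)$; 3. the adjoint problem is $H^2$-regularising: there is $C$ such that, whenever $g\in L^2(\Omega)$ and $\varphi\in H^1_0(\Omega)$ satisfies $a(v,\varphi)=(g,v)$ for all $v\in H^1_0(\Omega)$, one has $\varphi\in H^2(\Omega)$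 and $\|\varphi\|_{H^2(\Omega)}\le C\|g\|_{L^2(\Omega)}$. Let $\{\mathcal T_h\}$ be a family of conforming simplicial triangulations of $\overline\Omega$ that is regular in the sense of Ciarlet: there is $\sigma$ such that every simplex $K$ of every $\mathcal T_h$ contains a ball of diameter at least $\operatorname{diam}(K)/\sigma$. Here $h=\max_{K\in\mathcal T_h}\operatorname{diam}K$. Let $l\ge1$, let $V_h$ be the space of functions that are continuous on $\overline\Omega$ and polynomials of degree at most $l$ on each $K\in\mathcal T_h$, and let $X_h=V_h\cap H^1_0(\Omega)$. Let $\Pi_hu\in V_h$ be the Lagrange interpolate of $u$ of degree $l$. For $\tau>0$ let $u_h(\tau)\in X_h$ be the solution of the term-by-term stabilised method $$a(u_h,v_h)+\sum_{K\in\mathcal T_h}\tau\,(a\cdot\nabla u_h,a\cdot\nabla v_h)_{L^2(K)}=(f,v_h)\qquad\forall v_h\in X_h,$$ and let $J(\tau)=\frac12\|u_h(\tau)-\Pi_hu\|_{L^2(\Omega)}^2$. Then there is $\alpha_0>0$ such that for every $\alpha_{\max}>\alpha_0$ there is $h_0>0$ such that, for all $\alpha_{\min}\in[\alpha_0,\alpha_{\max})$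 and all triangulations of the family with $h<h_0$, the functional $J$ is strictly convex on $[\alpha_{\min}h^2,\alpha_{\max}h^2]$ and has exactly one minimiser in this interval. -/

import Mathlib

open MeasureTheory Set

noncomputable section

namespace AdvDiff

/-- Euclidean space `ℝ^d`. -/
abbrev Space (d : ℕ) := EuclideanSpace ℝ (Fin d)

/-! ### Sobolev spaces on an open set, through weak derivatives -/

/-- `φ ∈ C_c^∞(Ω)`. -/
def IsTestFunction {d : ℕ} (Ω : Set (Space d)) (φ : Space d → ℝ) : Prop :=
  ContDiff ℝ ((⊤ : ℕ∞) : WithTop ℕ∞) φ ∧ HasCompactSupport φ ∧ tsupport φ ⊆ Ω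

/-- The classical partial derivative `∂_i φ`. -/
def classicalPartial {d : ℕ} (i : Fin d) (φ : Space d → ℝ) (x : Space d) : ℝ :=
  fderiv ℝ φ x (EuclideanSpace.single i 1)

/-- `v ∈ L²(Ω)`. -/
def MemL2 {d : ℕ} (Ω : Set (Space d)) (v : Space d → ℝ) : Prop :=
  MemLp v 2 (volume.restrict Ω)

/-- `w` is a square-integrable weak partial derivative `∂_i v` in `Ω`. -/
def IsWeakPartial {d : ℕ} (Ω : Set (Space d)) (i : Fin d) (v w : Space d → ℝ) : Prop :=
  MemL2 Ω w ∧ ∀ φ, IsTestFunction Ω φ →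
    ∫ x in Ω, v x * classicalPartial i φ x = - ∫ x in Ω, w x * φ x

/-- `v ∈ H¹(Ω)`. -/
def MemH1 {d : ℕ} (Ω : Set (Space d)) (v : Space d → ℝ) : Prop :=
  MemL2 Ω v ∧ ∀ i, ∃ w, IsWeakPartial Ω i v w

open Classical in
/-- The weak partial derivative `∂_i v` of `v ∈ H¹(Ω)`, unique up to null sets of `Ω`. -/
def weakPartial {d : ℕ} (Ω : Set (Space d)) (i : Fin d) (v : Space d → ℝ) : Space d → ℝ :=
  if h : ∃ w, IsWeakPartial Ω i v w then h.choose else 0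

/-- The weak gradient `∇v` of `v ∈ H¹(Ω)`. -/
def weakGrad {d : ℕ} (Ω : Set (Space d)) (v : Space d → ℝ) (x : Space d) : Space d :=
  WithLp.toLp 2 fun i => weakPartial Ω i v x

/-- `v ∈ H¹₀(Ω)`, the closure of `C_c^∞(Ω)` in `H¹(Ω)`. -/
def MemH10 {d : ℕ} (Ω : Set (Space d)) (v : Space d → ℝ) : Prop :=
  MemH1 Ω v ∧ ∀ ε > 0, ∃ φ, IsTestFunction Ω φ ∧
    (∫ x in Ω, (v x - φ x) ^ 2) +
      ∑ i, ∫ x in Ω, (weakPartial Ω i v x - classicalPartial i φ x) ^ 2 < ε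

/-- `v ∈ H²(Ω)`. -/
def MemH2 {d : ℕ} (Ω : Set (Space d)) (v : Space d → ℝ) : Prop :=
  MemH1 Ω v ∧ ∀ i, MemH1 Ω (weakPartial Ω i v)

/-- The square of the `H²(Ω)` norm. -/
def normSqH2 {d : ℕ} (Ω : Set (Space d)) (v : Space d → ℝ) : ℝ :=
  (∫ x in Ω, v x ^ 2) + (∑ i, ∫ x in Ω, weakPartial Ω i v x ^ 2) +
    ∑ i, ∑ j, ∫ x in Ω, weakPartial Ω j (weakPartial Ω i v) x ^ 2

/-- The Laplacian `Δv` of `v ∈ H²(Ω)`. -/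
def weakLaplacian {d : ℕ} (Ω : Set (Space d)) (v : Space d → ℝ) (x : Space d) : ℝ :=
  ∑ i, weakPartial Ω i (weakPartial Ω i v) x

/-! ### The advection–diffusion problem -/

/-- `∇ · a = 0` in `Ω`, in the sense of distributions. -/
def IsDivFree {d : ℕ} (Ω : Set (Space d)) (a : Space d → Space d) : Prop :=
  ∀ φ, IsTestFunction Ω φ → ∫ x in Ω, ∑ i, a x i * classicalPartial i φ x = 0

/-- The advective derivative `a · ∇v`. -/
def advect {d : ℕ} (Ω : Set (Space d)) (a : Space d → Space d) (v : Space d → ℝ)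
    (x : Space d) : ℝ :=
  inner ℝ (a x) (weakGrad Ω v x)

/-- The bilinear form `a(u,v) = (a · ∇u, v) + (μ ∇u, ∇v)`. -/
def bilin {d : ℕ} (Ω : Set (Space d)) (a : Space d → Space d) (μ : Space d → ℝ)
    (u v : Space d → ℝ) : ℝ :=
  (∫ x in Ω, advect Ω a u x * v x) +
    ∫ x in Ω, μ x * inner ℝ (weakGrad Ω u x) (weakGrad Ω v x)

/-- `u ∈ H¹₀(Ω)` and `a(u,v) = (f,v)` for all `v ∈ H¹₀(Ω)`. -/
def IsWeakSolution {d : ℕ} (Ω : Set (Space d)) (a : Space d → Space d) (μ f u : Space d → ℝ) :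
    Prop :=
  MemH10 Ω u ∧ ∀ v, MemH10 Ω v → bilin Ω a μ u v = ∫ x in Ω, f x * v x

/-- `φ ∈ H¹₀(Ω)` and `a(v,φ) = (g,v)` for all `v ∈ H¹₀(Ω)`. -/
def IsAdjointSolution {d : ℕ} (Ω : Set (Space d)) (a : Space d → Space d)
    (μ g φ : Space d → ℝ) : Prop :=
  MemH10 Ω φ ∧ ∀ v, MemH10 Ω v → bilin Ω a μ v φ = ∫ x in Ω, g x * v x

/-- The adjoint problem is `H²`-regularising: for `g ∈ L²(Ω)` its solution `φ` lies in `H²(Ω)`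
and `‖φ‖_{H²} ≤ C ‖g‖_{L²}`. -/
def AdjointH2Regularising {d : ℕ} (Ω : Set (Space d)) (a : Space d → Space d)
    (μ : Space d → ℝ) : Prop :=
  ∃ C : ℝ, ∀ g φ, MemL2 Ω g → IsAdjointSolution Ω a μ g φ →
    MemH2 Ω φ ∧ normSqH2 Ω φ ≤ C ^ 2 * ∫ x in Ω, g x ^ 2

/-! ### Triangulations and Lagrange finite elements -/

/-- The closed simplex spanned by a finite set of vertices. -/
def simplex {d : ℕ} (K : Finset (Space d)) : Set (Space d) :=
  convexHull ℝ (K : Set (Space d))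

/-- A conforming triangulation of `closure Ω` by nondegenerate closed `d`-simplices, each given
by its set of vertices: two simplices meet exactly in the face spanned by their common vertices
(possibly empty). -/
structure Triangulation {d : ℕ} (Ω : Set (Space d)) where
  cells : Finset (Finset (Space d))
  card_cell : ∀ K ∈ cells, K.card = d + 1
  indep : ∀ K ∈ cells, AffineIndependent ℝ ((↑) : K → Space d)
  conforming : ∀ K ∈ cells, ∀ L ∈ cells,
    simplex K ∩ simplex L = convexHull ℝ ((K : Set (Space d)) ∩ (L : Set (Space d)))
  cover : ⋃ K ∈ cells, simplex K = closure Ω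

/-- The mesh size `h = max_K h_K`, where `h_K` is the diameter of `K`. -/
def Triangulation.meshSize {d : ℕ} {Ω : Set (Space d)} (T : Triangulation Ω) : ℝ :=
  ⨆ K : T.cells, Metric.diam (simplex (K : Finset (Space d)))

/-- Ciarlet's regularity with constant `σ`: each `K` contains a ball of some diameter `2 r`
with `h_K ≤ σ (2 r)`. -/
def Triangulation.IsShapeRegular {d : ℕ} {Ω : Set (Space d)} (T : Triangulation Ω) (σ : ℝ) :
    Prop :=
  ∀ K ∈ T.cells, ∃ (c : Space d) (r : ℝ), 0 < r ∧ Metric.closedBall c r ⊆ simplex K ∧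
    Metric.diam (simplex K) ≤ σ * (2 * r)

/-- The restriction of `v` to `S` is a polynomial of total degree at most `l`. -/
def IsPolyOn {d : ℕ} (l : ℕ) (S : Set (Space d)) (v : Space d → ℝ) : Prop :=
  ∃ p : MvPolynomial (Fin d) ℝ, p.totalDegree ≤ l ∧
    ∀ x ∈ S, v x = MvPolynomial.eval (fun i => x i) p

/-- `V_h^{(l)}`: continuous functions on `closure Ω` that are polynomials of degree at most `l`
on each cell. Such a function is represented by its extension by zero to the whole space. -/
def Triangulation.lagrangeSpace {d : ℕ} {Ω : Set (Space d)} (T : Triangulation Ω) (l : ℕ) :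
    Set (Space d → ℝ) :=
  {v | ContinuousOn v (closure Ω) ∧ (∀ K ∈ T.cells, IsPolyOn l (simplex K) v) ∧
    ∀ x, x ∉ closure Ω → v x = 0}

/-- `X_h = V_h^{(l)} ∩ H¹₀(Ω)`. -/
def Triangulation.discreteSpace {d : ℕ} {Ω : Set (Space d)} (T : Triangulation Ω) (l : ℕ) :
    Set (Space d → ℝ) :=
  {v | v ∈ T.lagrangeSpace l ∧ MemH10 Ω v}

/-- The Lagrange nodes of degree `l` of the simplex `K`: the points whose barycentric
coordinates are multiples of `1 / l`. -/
def lagrangeNodes {d : ℕ} (l : ℕ) (K : Finset (Space d)) : Set (Space d) :=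
  {x | ∃ m : Space d → ℕ, ∑ v ∈ K, m v = l ∧ x = ∑ v ∈ K, ((m v : ℝ) / (l : ℝ)) • v}

/-- `p ∈ V_h^{(l)}` takes the values of `u` at all Lagrange nodes. -/
def Triangulation.IsInterpolant {d : ℕ} {Ω : Set (Space d)} (T : Triangulation Ω) (l : ℕ)
    (u p : Space d → ℝ) : Prop :=
  p ∈ T.lagrangeSpace l ∧ ∀ K ∈ T.cells, ∀ x ∈ lagrangeNodes l K, p x = u x

open Classical in
/-- The Lagrange interpolate `Π_h u`. -/
def Triangulation.interpolate {d : ℕ} {Ω : Set (Space d)} (T : Triangulation Ω) (l : ℕ)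
    (u : Space d → ℝ) : Space d → ℝ :=
  if h : ∃ p, T.IsInterpolant l u p then h.choose else 0

/-! ### The term-by-term stabilised method -/

/-- The stabilisation form `s_h(α, β) = ∑_K τ_K (α, β)_K`. -/
def Triangulation.stab {d : ℕ} {Ω : Set (Space d)} (T : Triangulation Ω)
    (τ : Finset (Space d) → ℝ) (α β : Space d → ℝ) : ℝ :=
  ∑ K ∈ T.cells, τ K * ∫ x in simplex K, α x * β x

/-- `w ∈ X_h` and `a(w,v) + s_h(a · ∇w, a · ∇v) = (f,v)` for all `v ∈ X_h`. -/
def Triangulation.IsDiscreteSolution {d : ℕ} {Ω : Set (Space d)} (T : Triangulation Ω) (l : ℕ)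
    (a : Space d → Space d) (μ f : Space d → ℝ) (τ : Finset (Space d) → ℝ)
    (w : Space d → ℝ) : Prop :=
  w ∈ T.discreteSpace l ∧ ∀ v ∈ T.discreteSpace l,
    bilin Ω a μ w v + T.stab τ (advect Ω a w) (advect Ω a v) = ∫ x in Ω, f x * v x

open Classical in
/-- The discrete solution `u_h(τ)`, with `τ_K = τ` for all cells `K`. -/
def Triangulation.discreteSolution {d : ℕ} {Ω : Set (Space d)} (T : Triangulation Ω) (l : ℕ)
    (a : Space d → Space d) (μ f : Space d → ℝ) (τ : ℝ) : Space d → ℝ :=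
  if h : ∃ w, T.IsDiscreteSolution l a μ f (fun _ => τ) w then h.choose else 0

/-- The least-squares functional `J(τ) = ½ ‖u_h(τ) - Π_h u‖²` in the norm of `L²(Ω)`. -/
def Triangulation.lsFunctional {d : ℕ} {Ω : Set (Space d)} (T : Triangulation Ω) (l : ℕ)
    (a : Space d → Space d) (μ f u : Space d → ℝ) (τ : ℝ) : ℝ :=
  (1 / 2 : ℝ) * ∫ x in Ω, (T.discreteSolution l a μ f τ x - T.interpolate l u x) ^ 2

end AdvDiff

end

/-! Write `B` for the bilinear form of the problem, `S(v,w) = (a·∇v, a·∇w)`, and `w(τ)` for the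
discrete solution. Since `(f,v) = B(u,v)`, the method reads `B w + τ S w = B u` on the discrete
space. Differentiating twice in `τ` gives `B w' + τ S w' = -S w` and `B w'' + τ S w'' = -2 S w'`
there, and `J'' = ‖w'‖² + (w - Π_h u, w'')` in `L²`.

On `H¹₀` the form `B` is coercive (the advection part is skew because `a` is divergence-free, and
Poincaré's inequality controls the rest), while `S` is bounded and nonnegative. All Galerkin
estimates are therefore uniform in `τ ≥ 0` and in the mesh. As `h` and `τ` tend to `0`, the discrete
spaces exhaust `H¹₀`, so `w → u` and `w' → z` in `H¹₀`, where `B z = -S u`; moreover `w''` stays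
bounded and `Π_h u → u` uniformly. Hence the second term of `J''` vanishes in the limit while the
first tends to `‖z‖²` in `L²`.

This limit is positive. If `a·∇u ≠ 0`, then `S(u,u) > 0`, so `S u ≠ 0` and `z ≠ 0`, and an element
of `H¹₀` with zero `L²` component is zero. If `a` is a nonzero constant, `a·∇u = 0` would force `u =
0` by Poincaré's inequality in the direction of `a`, against `Δu ≠ 0`.

So `J` is strictly convex on a fixed interval `[0, δ]` for all fine meshes, and `[αmin h², αmax h²]`
lies inside it once `h` is small. The abstract argument is `exists_strictConvexOn_of_isGalerkin`.
Its analytic inputs are `exists_formB_coercive`, `exists_discretePairs_approx` (affine interpolation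
of test functions on shape-regular meshes) and `Triangulation.exists_abs_interpolate_sub_le`. -/

noncomputable section

namespace AdvDiff

/-! ### Galerkin methods with a vanishing perturbation -/

section Galerkin

variable {H Y : Type*} [NormedAddCommGroup H] [InnerProductSpace ℝ H]
  [NormedAddCommGroup Y] [InnerProductSpace ℝ Y]

/-- `w ∈ X` and `B(w,v) + τ S(w,v) = G(v)` for all `v ∈ X`. -/
def IsGalerkin (B S : H →L[ℝ] H →L[ℝ] ℝ) (X : Submodule ℝ H) (τ : ℝ) (G : H →L[ℝ] ℝ) (w : H) :
    Prop :=
  w ∈ X ∧ ∀ v ∈ X, B w v + τ * S w v = G v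

variable {B S : H →L[ℝ] H →L[ℝ] ℝ} {X : Submodule ℝ H} {c τ : ℝ}

/-- Testing with `w` itself, the term `τ S(w,w)` is nonnegative and drops out. The bound is thus
independent of `τ` and of the subspace, and every later estimate rests on this. -/
theorem IsGalerkin.norm_le (hc : 0 < c) (hB : ∀ v, c * ‖v‖ * ‖v‖ ≤ B v v)
    (hS : ∀ v, 0 ≤ S v v) (hτ : 0 ≤ τ) {G : H →L[ℝ] ℝ} {w : H} (hw : IsGalerkin B S X τ G w) :
    ‖w‖ ≤ c⁻¹ * ‖G‖ := by
  rcases (norm_nonneg w).eq_or_lt with h0 | h0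
  · rw [← h0]; positivity
  · have h1 := hB w
    have h2 := mul_nonneg hτ (hS w)
    have h3 := hw.2 w hw.1
    have h4 : G w ≤ ‖G‖ * ‖w‖ := (le_abs_self _).trans (G.le_opNorm w)
    have h5 : c * ‖w‖ ≤ ‖G‖ := by
      refine le_of_mul_le_mul_right ?_ h0
      linarith
    rw [inv_mul_eq_div, le_div_iff₀ hc]
    linarith

/-- Lax–Milgram on `X`: adding `τ S` preserves the coercivity of `B`. -/
theorem exists_isGalerkin [CompleteSpace X] (hc : 0 < c) (hB : ∀ v, c * ‖v‖ * ‖v‖ ≤ B v v)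
    (hS : ∀ v, 0 ≤ S v v) (hτ : 0 ≤ τ) (G : H →L[ℝ] ℝ) : ∃ w, IsGalerkin B S X τ G w := by
  set A : X →L[ℝ] X →L[ℝ] ℝ := (B + τ • S).bilinearComp X.subtypeL X.subtypeL with hA
  have hco : IsCoercive A := ⟨c, hc, fun v => by
    have h1 := hB v
    have h2 := mul_nonneg hτ (hS v)
    simp only [hA, ContinuousLinearMap.bilinearComp_apply, Submodule.subtypeL_apply,
      _root_.add_apply, _root_.smul_apply, smul_eq_mul]
    rw [Submodule.coe_norm]
    linarith⟩
  refine ⟨(hco.continuousLinearEquivOfBilin.symm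
    ((InnerProductSpace.toDual ℝ X).symm (G.comp X.subtypeL)) : X), Subtype.property _,
    fun v hv => ?_⟩
  have := hco.continuousLinearEquivOfBilin_apply (hco.continuousLinearEquivOfBilin.symm
    ((InnerProductSpace.toDual ℝ X).symm (G.comp X.subtypeL))) ⟨v, hv⟩
  rw [ContinuousLinearEquiv.apply_symm_apply, InnerProductSpace.toDual_symm_apply] at this
  simpa [hA] using this.symm

/-- Convergence of the perturbed Galerkin method on an approximating family of subspaces. -/
theorem IsGalerkin.exists_norm_sub_le (hc : 0 < c) (hB : ∀ v, c * ‖v‖ * ‖v‖ ≤ B v v)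
    (hS : ∀ v, 0 ≤ S v v) {ι : Type*} {X : ι → Submodule ℝ H} {h : ι → ℝ}
    (hX : ∀ v : H, ∀ ε > 0, ∃ δ > 0, ∀ i, h i < δ → ∃ w ∈ X i, ‖w - v‖ < ε)
    (z : H) {ε : ℝ} (hε : 0 < ε) :
    ∃ δ > 0, ∀ i, h i < δ → ∀ τ ∈ Icc 0 δ, ∀ G : H →L[ℝ] ℝ, ‖G - B z‖ ≤ δ → ∀ w,
      IsGalerkin B S (X i) τ G w → ‖w - z‖ ≤ ε := by
  -- If `X i` contains a point within `η` of `z`, and both `τ` and the error in the data are at most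
  -- `η`, then the total error is at most `K * η`.
  set K : ℝ := 1 + c⁻¹ * (‖B‖ + ‖S‖ * (‖z‖ + 1) + 1) with hK
  have hKpos : 0 < K := by positivity
  set η : ℝ := min 1 (ε / K)
  have hη : 0 < η := by positivity
  have hη1 : η ≤ 1 := min_le_left _ _
  have hηε : K * η ≤ ε := by
    have := min_le_right 1 (ε / K)
    rwa [le_div_iff₀' hKpos] at this
  obtain ⟨δ, hδ, hd⟩ := hX z η hη
  refine ⟨min δ η, lt_min hδ hη, fun i hi τ hτ G hG w hw => ?_⟩
  obtain ⟨y, hyX, hy⟩ := hd i (hi.trans_le (min_le_left _ _))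
  have hτη : τ ≤ η := hτ.2.trans (min_le_right _ _)
  have hGη : ‖G - B z‖ ≤ η := hG.trans (min_le_right _ _)
  -- The difference from the approximant `y` is again a Galerkin solution, whose data consist of the
  -- data error, the approximation error and the perturbation `τ S y`, all of order `η`.
  have hgal : IsGalerkin B S (X i) τ ((G - B z) - B (y - z) - τ • S y) (w - y) := by
    refine ⟨(X i).sub_mem hw.1 hyX, fun v hv => ?_⟩
    have h1 := hw.2 v hv
    simp only [map_sub, _root_.sub_apply, _root_.smul_apply, smul_eq_mul]
    linarith
  have h1 := hgal.norm_le hc hB hS hτ.1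
  have hynorm : ‖y‖ ≤ ‖z‖ + 1 := by
    have := norm_add_le (y - z) z
    rw [sub_add_cancel] at this
    linarith
  have h2 : ‖(G - B z) - B (y - z) - τ • S y‖ ≤ η * (‖B‖ + ‖S‖ * (‖z‖ + 1) + 1) := by
    calc _ ≤ ‖G - B z‖ + ‖B (y - z)‖ + ‖τ • S y‖ :=
          (norm_sub_le _ _).trans (by gcongr; exact norm_sub_le _ _)
      _ ≤ η + ‖B‖ * η + η * (‖S‖ * (‖z‖ + 1)) := by
          rw [norm_smul, Real.norm_of_nonneg hτ.1]
          gcongr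
          · exact (B.le_opNorm _).trans (by gcongr)
          · exact (S.le_opNorm _).trans (by gcongr)
      _ = _ := by ring
  calc ‖w - z‖ ≤ ‖w - y‖ + ‖y - z‖ := norm_sub_le_norm_sub_add_norm_sub _ _ _
    _ ≤ c⁻¹ * (η * (‖B‖ + ‖S‖ * (‖z‖ + 1) + 1)) + η := by gcongr; exact h1.trans (by gcongr)
    _ = K * η := by rw [hK]; ring
    _ ≤ ε := hηε

/-- Differentiation of the Galerkin solution with respect to the perturbation parameter. -/
theorem IsGalerkin.hasDerivWithinAt (hc : 0 < c) (hB : ∀ v, c * ‖v‖ * ‖v‖ ≤ B v v)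
    (hS : ∀ v, 0 ≤ S v v) {I : Set ℝ} (hI : ∀ t ∈ I, 0 ≤ t) {q : ℝ → H} {q' : H}
    {G : ℝ → H →L[ℝ] ℝ} {G' : H →L[ℝ] ℝ} (hq : ∀ t ∈ I, IsGalerkin B S X t (G t) (q t))
    (hτ : τ ∈ I) (hG : HasDerivWithinAt G G' I τ) (hq' : IsGalerkin B S X τ (G' - S (q τ)) q') :
    HasDerivWithinAt q q' I τ := by
  rw [hasDerivWithinAt_iff_isLittleO] at hG ⊢
  -- The first-order Taylor remainder of `q` solves the Galerkin problem at parameter `t`. Its data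
  -- are the Taylor remainder of `G` minus `(t - τ)² S q'`, both `o(t - τ)`, so stability carries
  -- this over to `q`.
  have key : ∀ t ∈ I, ‖q t - q τ - (t - τ) • q'‖ ≤
      c⁻¹ * ‖(G t - G τ - (t - τ) • G') - (t - τ) ^ 2 • S q'‖ := by
    intro t ht
    refine IsGalerkin.norm_le (B := B) (S := S) (X := X) (τ := t) hc hB hS (hI t ht) ⟨?_, ?_⟩
    · exact X.sub_mem (X.sub_mem (hq t ht).1 (hq τ hτ).1) (X.smul_mem _ hq'.1)
    · intro v hv
      have h1 := (hq t ht).2 v hv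
      have h2 := (hq τ hτ).2 v hv
      have h3 := hq'.2 v hv
      simp only [map_sub, map_smul, _root_.sub_apply, _root_.smul_apply,
        smul_eq_mul] at h3 ⊢
      linear_combination h1 - h2 - (t - τ) * h3
  have hsq : (fun t => (t - τ) ^ 2 • S q') =o[nhdsWithin τ I] fun t => t - τ := by
    have h1 : (fun t : ℝ => (t - τ) ^ 2) =o[nhds τ] fun t => t - τ := by
      simpa using Asymptotics.isLittleO_pow_sub_sub τ (m := 2) (by norm_num)
    have h2 : (fun t : ℝ => (t - τ) ^ 2 • S q') =O[nhdsWithin τ I] fun t => (t - τ) ^ 2 :=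
      Asymptotics.IsBigO.of_bound ‖S q'‖ (Filter.Eventually.of_forall fun t => by
        rw [norm_smul, mul_comm])
    exact h2.trans_isLittleO (h1.mono nhdsWithin_le_nhds)
  refine Asymptotics.IsBigO.trans_isLittleO ?_ (hG.sub hsq)
  exact Asymptotics.IsBigO.of_bound c⁻¹ (Filter.eventually_of_mem self_mem_nhdsWithin key)

/-- Strict convexity of `τ ↦ ½‖j w(τ) - p‖²` for the Galerkin solutions `w(τ)`, as soon as the
subspace resolves the problem, `τ` is small, and `p` is close to `j u`. -/
theorem exists_strictConvexOn_of_isGalerkin [CompleteSpace H] (hc : 0 < c)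
    (hB : ∀ v, c * ‖v‖ * ‖v‖ ≤ B v v) (hS : ∀ v, 0 ≤ S v v) (j : H →L[ℝ] Y)
    (hj : Function.Injective j) (u : H) (hu : S u ≠ 0) {ι : Type*} (X : ι → Submodule ℝ H)
    [∀ i, CompleteSpace (X i)] (h : ι → ℝ)
    (hX : ∀ v : H, ∀ ε > 0, ∃ δ > 0, ∀ i, h i < δ → ∃ w ∈ X i, ‖w - v‖ < ε) :
    ∃ δ > 0, ∀ i, h i < δ → ∀ p : Y, ‖j u - p‖ ≤ δ → ∀ w : ℝ → H,
      (∀ τ ∈ Icc 0 δ, IsGalerkin B S (X i) τ (B u) (w τ)) →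
      ContinuousOn (fun τ => (1 / 2 : ℝ) * ‖j (w τ) - p‖ ^ 2) (Icc 0 δ) ∧
      StrictConvexOn ℝ (Icc 0 δ) (fun τ => (1 / 2 : ℝ) * ‖j (w τ) - p‖ ^ 2) := by
  have : CompleteSpace (⊤ : Submodule ℝ H) := isClosed_univ.completeSpace_coe
  -- `z` is the limit of `w'` as the mesh is refined and `τ → 0`: the equation for `w'` on the whole
  -- space, at `τ = 0`, with `w` replaced by `u`.
  obtain ⟨z, -, hz⟩ := exists_isGalerkin (B := B) (S := S) (X := (⊤ : Submodule ℝ H)) (τ := 0)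
    hc hB hS le_rfl (-(S u))
  have hBz : B z = -(S u) := by
    ext v; simpa using hz v trivial
  have hz0 : z ≠ 0 := by
    rintro rfl
    apply hu
    rw [map_zero] at hBz
    exact neg_eq_zero.mp hBz.symm
  have hjz : 0 < ‖j z‖ := norm_pos_iff.mpr fun h0 => hz0 (hj (by rw [h0, map_zero]))
  set κ := ‖j z‖ with hκ
  -- closeness of `w'` to `z`
  have hε₁ : 0 < min 1 (κ / (2 * (‖j‖ + 1))) := by positivity
  set ε₁ := min 1 (κ / (2 * (‖j‖ + 1)))
  obtain ⟨δ₁, hδ₁, H₁⟩ := IsGalerkin.exists_norm_sub_le hc hB hS hX z hε₁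
  -- a bound for `j w''`
  set M : ℝ := (‖j‖ + 1) * (c⁻¹ * (2 * (‖S‖ * (‖z‖ + 1)))) with hM
  have hM0 : 0 ≤ M := by positivity
  -- The first entry of the minimum puts the data `-S w` of `w'` within `δ₁` of `B z`; the second
  -- gives `‖j (w - u)‖ ≤ κ² / (16 (M + 1))`.
  have hε₂ : 0 < min (δ₁ / (‖S‖ + 1)) (κ ^ 2 / (16 * ((‖j‖ + 1) * (M + 1)))) := by positivity
  set ε₂ := min (δ₁ / (‖S‖ + 1)) (κ ^ 2 / (16 * ((‖j‖ + 1) * (M + 1)))) with hε₂def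
  obtain ⟨δ₂, hδ₂, H₂⟩ := IsGalerkin.exists_norm_sub_le hc hB hS hX u hε₂
  have hδ₃ : 0 < κ ^ 2 / (16 * (M + 1)) := by positivity
  refine ⟨min (min δ₁ δ₂) (κ ^ 2 / (16 * (M + 1))), by positivity, fun i hi p hp w hw => ?_⟩
  set δ := min (min δ₁ δ₂) (κ ^ 2 / (16 * (M + 1))) with hδdef
  have hδδ₁ : δ ≤ δ₁ := (min_le_left _ _).trans (min_le_left _ _)
  have hδδ₂ : δ ≤ δ₂ := (min_le_left _ _).trans (min_le_right _ _)
  have hδδ₃ : δ ≤ κ ^ 2 / (16 * (M + 1)) := min_le_right _ _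
  have hI : ∀ t ∈ Icc 0 δ, (0 : ℝ) ≤ t := fun t ht => ht.1
  -- `w₁` and `w₂` solve the formally differentiated equations and are then shown to be the
  -- derivatives. In the data of `w₂`, one `-S w₁` comes from differentiating `-S w` and the other
  -- from the factor `τ`.
  choose! w₁ hw₁ using fun (τ : ℝ) (hτ : τ ∈ Icc 0 δ) =>
    exists_isGalerkin (B := B) (S := S) (X := X i) hc hB hS hτ.1 (-(S (w τ)))
  choose! w₂ hw₂ using fun (τ : ℝ) (hτ : τ ∈ Icc 0 δ) =>
    exists_isGalerkin (B := B) (S := S) (X := X i) hc hB hS hτ.1 (-(S (w₁ τ)) - S (w₁ τ))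
  have hd₁ : ∀ τ ∈ Icc 0 δ, HasDerivWithinAt w (w₁ τ) (Icc 0 δ) τ := fun τ hτ =>
    IsGalerkin.hasDerivWithinAt hc hB hS hI (G := fun _ => B u) hw hτ
      (hasDerivWithinAt_const _ _ _) (by simpa using hw₁ τ hτ)
  have hd₂ : ∀ τ ∈ Icc 0 δ, HasDerivWithinAt w₁ (w₂ τ) (Icc 0 δ) τ := fun τ hτ =>
    IsGalerkin.hasDerivWithinAt hc hB hS hI (G := fun t => -(S (w t))) hw₁ hτ
      (S.hasFDerivAt.comp_hasDerivWithinAt τ (hd₁ τ hτ)).neg (hw₂ τ hτ)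
  have hJ₁ : ∀ τ ∈ Icc 0 δ, HasDerivWithinAt (fun τ => (1 / 2 : ℝ) * ‖j (w τ) - p‖ ^ 2)
      (inner ℝ (j (w τ) - p) (j (w₁ τ))) (Icc 0 δ) τ := by
    intro τ hτ
    have := ((j.hasFDerivAt.comp_hasDerivWithinAt τ (hd₁ τ hτ)).sub_const p).norm_sq.const_mul
      (1 / 2 : ℝ)
    refine this.congr_deriv ?_
    simp only [Function.comp_apply]
    ring
  have hJ₂ : ∀ τ ∈ Icc 0 δ, HasDerivWithinAt (fun τ => inner ℝ (j (w τ) - p) (j (w₁ τ)))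
      (inner ℝ (j (w τ) - p) (j (w₂ τ)) + ‖j (w₁ τ)‖ ^ 2) (Icc 0 δ) τ := by
    intro τ hτ
    have := ((j.hasFDerivAt.comp_hasDerivWithinAt τ (hd₁ τ hτ)).sub_const p).inner ℝ
      (j.hasFDerivAt.comp_hasDerivWithinAt τ (hd₂ τ hτ))
    refine this.congr_deriv ?_
    simp only [Function.comp_apply, real_inner_self_eq_norm_sq]
  -- `‖j w₁‖² ≥ κ² / 4`, while the inner product is at least `-κ² / 8`, since `‖j w - p‖ * (M + 1) ≤
  -- κ² / 8` and `‖j w₂‖ ≤ M`.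
  have hpos : ∀ τ ∈ Icc 0 δ, 0 < inner ℝ (j (w τ) - p) (j (w₂ τ)) + ‖j (w₁ τ)‖ ^ 2 := by
    intro τ hτ
    have hwu : ‖w τ - u‖ ≤ ε₂ := H₂ i (hi.trans_le hδδ₂) τ ⟨hτ.1, hτ.2.trans hδδ₂⟩ (B u)
      (by rw [sub_self, norm_zero]; exact hδ₂.le) _ (hw τ hτ)
    have hw₁z : ‖w₁ τ - z‖ ≤ ε₁ := by
      refine H₁ i (hi.trans_le hδδ₁) τ ⟨hτ.1, hτ.2.trans hδδ₁⟩ _ ?_ _ (hw₁ τ hτ)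
      have : -(S (w τ)) - B z = -(S (w τ - u)) := by rw [hBz, map_sub]; abel
      rw [this, norm_neg]
      calc ‖S (w τ - u)‖ ≤ ‖S‖ * ε₂ := (S.le_opNorm _).trans (by gcongr)
        _ ≤ (‖S‖ + 1) * (δ₁ / (‖S‖ + 1)) := by
            gcongr
            · linarith
            · exact min_le_left _ _
        _ = δ₁ := by field_simp
    have hw₁n : ‖w₁ τ‖ ≤ ‖z‖ + 1 := by
      have h1 := norm_add_le (w₁ τ - z) z
      rw [sub_add_cancel] at h1
      have h2 : ε₁ ≤ 1 := min_le_left _ _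
      linarith
    have hw₂n : ‖j (w₂ τ)‖ ≤ M := by
      have h1 := (hw₂ τ hτ).norm_le hc hB hS hτ.1
      have h2 : ‖-(S (w₁ τ)) - S (w₁ τ)‖ ≤ 2 * (‖S‖ * (‖z‖ + 1)) := by
        have h3 : ‖S (w₁ τ)‖ ≤ ‖S‖ * (‖z‖ + 1) := (S.le_opNorm _).trans (by gcongr)
        have h4 := norm_sub_le (-(S (w₁ τ))) (S (w₁ τ))
        rw [norm_neg] at h4
        linarith
      calc ‖j (w₂ τ)‖ ≤ ‖j‖ * ‖w₂ τ‖ := j.le_opNorm _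
        _ ≤ M := by
          rw [hM]
          gcongr
          · linarith
          · exact h1.trans (by gcongr)
    have hjw₁ : κ / 2 ≤ ‖j (w₁ τ)‖ := by
      have h1 : ‖j (w₁ τ - z)‖ ≤ κ / 2 := by
        calc ‖j (w₁ τ - z)‖ ≤ ‖j‖ * ε₁ := (j.le_opNorm _).trans (by gcongr)
          _ ≤ (‖j‖ + 1) * (κ / (2 * (‖j‖ + 1))) := by
              gcongr
              · linarith
              · exact min_le_right _ _
          _ = κ / 2 := by field_simp
      have h2 := norm_sub_norm_le (j z) (j (w₁ τ))
      rw [map_sub, norm_sub_rev] at h1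
      linarith
    have hjwp : ‖j (w τ) - p‖ * (M + 1) ≤ κ ^ 2 / 8 := by
      have h1 : ‖j (w τ) - p‖ ≤ κ ^ 2 / (16 * (M + 1)) + κ ^ 2 / (16 * (M + 1)) := by
        calc ‖j (w τ) - p‖ ≤ ‖j (w τ) - j u‖ + ‖j u - p‖ :=
              norm_sub_le_norm_sub_add_norm_sub _ _ _
          _ ≤ _ := by
            refine add_le_add ?_ (hp.trans hδδ₃)
            rw [← map_sub]
            calc ‖j (w τ - u)‖ ≤ ‖j‖ * ε₂ := (j.le_opNorm _).trans (by gcongr)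
              _ ≤ (‖j‖ + 1) * (κ ^ 2 / (16 * ((‖j‖ + 1) * (M + 1)))) := by
                gcongr
                · linarith
                · exact min_le_right _ _
              _ = _ := by field_simp
      calc _ ≤ (κ ^ 2 / (16 * (M + 1)) + κ ^ 2 / (16 * (M + 1))) * (M + 1) := by gcongr
        _ = κ ^ 2 / 8 := by field_simp; ring
    have h1 : -(‖j (w τ) - p‖ * M) ≤ inner ℝ (j (w τ) - p) (j (w₂ τ)) := by
      have := abs_real_inner_le_norm (j (w τ) - p) (j (w₂ τ))
      have h2 : ‖j (w τ) - p‖ * ‖j (w₂ τ)‖ ≤ ‖j (w τ) - p‖ * M := by gcongr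
      linarith [neg_abs_le (inner ℝ (j (w τ) - p) (j (w₂ τ)))]
    have h2 : κ ^ 2 / 4 ≤ ‖j (w₁ τ)‖ ^ 2 := by
      calc κ ^ 2 / 4 = (κ / 2) ^ 2 := by ring
        _ ≤ _ := by gcongr
    have h3 : 0 < κ ^ 2 := by positivity
    nlinarith [norm_nonneg (j (w τ) - p)]
  have hcont : ContinuousOn (fun τ => (1 / 2 : ℝ) * ‖j (w τ) - p‖ ^ 2) (Icc 0 δ) :=
    fun τ hτ => (hJ₁ τ hτ).continuousWithinAt
  refine ⟨hcont, strictConvexOn_of_deriv2_pos (convex_Icc _ _) hcont fun τ hτ => ?_⟩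
  have hnhds : Icc 0 δ ∈ nhds τ := mem_interior_iff_mem_nhds.mp hτ
  have hev : deriv (fun τ => (1 / 2 : ℝ) * ‖j (w τ) - p‖ ^ 2) =ᶠ[nhds τ]
      fun τ => inner ℝ (j (w τ) - p) (j (w₁ τ)) := by
    filter_upwards [isOpen_interior.mem_nhds hτ] with t ht
    exact ((hJ₁ t (interior_subset ht)).hasDerivAt (mem_interior_iff_mem_nhds.mp ht)).deriv
  rw [Function.iterate_succ, Function.iterate_one, Function.comp_apply, hev.deriv_eq,
    ((hJ₂ τ (interior_subset hτ)).hasDerivAt hnhds).deriv]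
  exact hpos τ (interior_subset hτ)

end Galerkin

/-! ### Lipschitz functions on a finite closed cover -/

/-- A function that is Lipschitz on each member of a finite closed cover of a normed space is
Lipschitz. -/
theorem lipschitzWith_of_finite_closed_cover {E κ : Type*} [NormedAddCommGroup E]
    [NormedSpace ℝ E] [Finite κ] {C : κ → Set E} (hC : ∀ k, IsClosed (C k))
    (hcov : ⋃ k, C k = univ) {L : NNReal} {f : E → ℝ} (hf : ∀ k, LipschitzOnWith L f (C k)) :
    LipschitzWith L f := by
  have hcont : Continuous f :=
    (locallyFinite_of_finite C).continuous hcov hC fun k => (hf k).continuousOn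
  refine LipschitzWith.of_dist_le_mul fun y x => ?_
  set γ : ℝ → E := fun t => x + t • (y - x) with hγ
  have hγc : Continuous γ := by fun_prop
  have hγd : ∀ s t, dist (γ s) (γ t) = |s - t| * ‖y - x‖ := by
    intro s t
    rw [dist_eq_norm, hγ]
    simp only [add_sub_add_left_eq_sub, ← sub_smul, norm_smul, Real.norm_eq_abs]
  set g : ℝ → ℝ := fun t => f (γ t) - f x with hg
  have hgc : Continuous g := by fun_prop
  refine le_of_forall_pos_le_add fun ε hε => ?_
  -- Growth along the segment is controlled by the lower right Dini derivative, which the values on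
  -- a single piece suffice to bound. The slack `ε` supplies the strict inequality that the
  -- comparison principle requires.
  have key := image_norm_le_of_liminf_right_slope_norm_lt_deriv_boundary (a := 0) (b := 1) (f := g)
    (f' := fun _ => L * ‖y - x‖) hgc.continuousOn (fun t _ r hr => ?_)
    (B := fun t => (L * ‖y - x‖ + ε) * t) (B' := fun _ => L * ‖y - x‖ + ε)
    (by simp [hg, hγ]) (by fun_prop)
    (fun t _ => by simpa using ((hasDerivAt_id t).const_mul (L * ‖y - x‖ + ε)).hasDerivWithinAt)
    (fun t _ _ => by linarith) (right_mem_Icc.mpr zero_le_one)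
  · rw [dist_eq_norm, dist_eq_norm]
    simpa [hg, hγ] using key
  -- The segment may switch pieces infinitely often near `t`, but with finitely many pieces one of
  -- them is visited arbitrarily close to `t` from the right. Being closed, it also contains `γ t`.
  · obtain ⟨k, hk⟩ : ∃ k, ∃ᶠ z in nhdsWithin t (Ioi t), γ z ∈ C k := by
      by_contra! hno
      have h1 := Filter.eventually_all.mpr hno
      obtain ⟨z, hz⟩ := h1.exists
      have : γ z ∈ ⋃ k, C k := by rw [hcov]; trivial
      obtain ⟨k, hk⟩ := mem_iUnion.mp this
      exact hz k hk
    have htk : γ t ∈ C k :=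
      ((hC k).preimage hγc).closure_subset_iff.mpr subset_rfl
        (mem_closure_iff_frequently.mpr (hk.filter_mono nhdsWithin_le_nhds))
    refine (hk.and_eventually self_mem_nhdsWithin).mono fun z hz => ?_
    have hzt : 0 < z - t := sub_pos.mpr hz.2
    have h1 := (hf k).dist_le_mul _ hz.1 _ htk
    rw [hγd, abs_of_pos hzt, Real.dist_eq] at h1
    have h2 : ‖g z‖ - ‖g t‖ ≤ |f (γ z) - f (γ t)| := by
      have := norm_sub_norm_le (g z) (g t)
      simpa [hg] using this
    refine lt_of_le_of_lt ?_ hr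
    rw [slope_def_field, div_le_iff₀ hzt]
    simp only [Function.comp_apply]
    linarith

/-! ### Test functions and uniqueness of weak derivatives -/

variable {d : ℕ} {Ω : Set (Space d)}

theorem isFiniteMeasure_restrict (hΩb : Bornology.IsBounded Ω) :
    IsFiniteMeasure (volume.restrict Ω) :=
  ⟨by rw [Measure.restrict_apply_univ]; exact hΩb.measure_lt_top⟩

namespace IsTestFunction

variable {φ ψ : Space d → ℝ}

theorem differentiable (hφ : IsTestFunction Ω φ) : Differentiable ℝ φ :=
  hφ.1.differentiable (by simp)

theorem eq_zero (hφ : IsTestFunction Ω φ) {x : Space d} (hx : x ∉ Ω) : φ x = 0 :=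
  image_eq_zero_of_notMem_tsupport fun h => hx (hφ.2.2 h)

theorem continuous_classicalPartial (hφ : IsTestFunction Ω φ) (i : Fin d) :
    Continuous (classicalPartial i φ) :=
  (hφ.1.continuous_fderiv (by simp)).clm_apply continuous_const

theorem hasCompactSupport_classicalPartial (hφ : IsTestFunction Ω φ) (i : Fin d) :
    HasCompactSupport (classicalPartial i φ) :=
  hφ.2.1.fderiv_apply (𝕜 := ℝ) _

theorem tsupport_classicalPartial (hφ : IsTestFunction Ω φ) (i : Fin d) :
    tsupport (classicalPartial i φ) ⊆ Ω :=
  (tsupport_fderiv_apply_subset ℝ _).trans hφ.2.2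

theorem classicalPartial_eq_zero (hφ : IsTestFunction Ω φ) (i : Fin d) {x : Space d}
    (hx : x ∉ Ω) : classicalPartial i φ x = 0 :=
  image_eq_zero_of_notMem_tsupport fun h => hx (hφ.tsupport_classicalPartial i h)

theorem memL2 (hφ : IsTestFunction Ω φ) : MemL2 Ω φ :=
  (hφ.1.continuous.memLp_of_hasCompactSupport hφ.2.1).restrict _

theorem memL2_classicalPartial (hφ : IsTestFunction Ω φ) (i : Fin d) :
    MemL2 Ω (classicalPartial i φ) :=
  ((hφ.continuous_classicalPartial i).memLp_of_hasCompactSupport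
    (hφ.hasCompactSupport_classicalPartial i)).restrict _

theorem classicalPartial_add (hφ : IsTestFunction Ω φ) (hψ : IsTestFunction Ω ψ) (i : Fin d)
    (x : Space d) :
    classicalPartial i (φ + ψ) x = classicalPartial i φ x + classicalPartial i ψ x := by
  rw [classicalPartial, fderiv_add (hφ.differentiable x) (hψ.differentiable x)]
  rfl

theorem classicalPartial_smul (hφ : IsTestFunction Ω φ) (c : ℝ) (i : Fin d) (x : Space d) :
    classicalPartial i (c • φ) x = c * classicalPartial i φ x := by
  rw [classicalPartial, fderiv_const_smul (hφ.differentiable x)]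
  rfl

theorem add (hφ : IsTestFunction Ω φ) (hψ : IsTestFunction Ω ψ) : IsTestFunction Ω (φ + ψ) :=
  ⟨hφ.1.add hψ.1, hφ.2.1.add hψ.2.1,
    (tsupport_add φ ψ).trans (union_subset hφ.2.2 hψ.2.2)⟩

theorem smul (hφ : IsTestFunction Ω φ) (c : ℝ) : IsTestFunction Ω (c • φ) :=
  ⟨hφ.1.const_smul c, hφ.2.1.smul_left (f := fun _ => c),
    (tsupport_smul_subset_right (fun _ => c) φ).trans hφ.2.2⟩

theorem mul (hφ : IsTestFunction Ω φ) (hψ : IsTestFunction Ω ψ) :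
    IsTestFunction Ω (fun x => φ x * ψ x) :=
  ⟨hφ.1.mul hψ.1, hφ.2.1.mul_right, (tsupport_mul_subset_left (g := ψ)).trans hφ.2.2⟩

theorem lipschitz (hφ : IsTestFunction Ω φ) : ∃ K, LipschitzWith K φ :=
  (hφ.1.of_le (m := 1) (by simp)).lipschitzWith_of_hasCompactSupport hφ.2.1 (by simp)

theorem zero : IsTestFunction Ω (0 : Space d → ℝ) :=
  ⟨contDiff_const, HasCompactSupport.zero, by simp⟩

/-- Integration by parts for test functions. -/
theorem integral_mul_classicalPartial (hφ : IsTestFunction Ω φ) (hψ : IsTestFunction Ω ψ)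
    (i : Fin d) : ∫ x in Ω, φ x * classicalPartial i ψ x =
      - ∫ x in Ω, classicalPartial i φ x * ψ x := by
  rw [setIntegral_eq_integral_of_forall_compl_eq_zero
      (fun x hx => by rw [hφ.eq_zero hx, zero_mul]),
    setIntegral_eq_integral_of_forall_compl_eq_zero
      (fun x hx => by rw [hψ.eq_zero hx, mul_zero])]
  refine integral_mul_fderiv_eq_neg_fderiv_mul_of_integrable ?_ ?_ ?_
    (fun x _ => hφ.differentiable x) (fun x _ => hψ.differentiable x)
  · exact ((hφ.continuous_classicalPartial i).mul hψ.1.continuous).integrable_of_hasCompactSupport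
      hψ.2.1.mul_left
  · exact (hφ.1.continuous.mul (hψ.continuous_classicalPartial i)).integrable_of_hasCompactSupport
      hφ.2.1.mul_right
  · exact (hφ.1.continuous.mul hψ.1.continuous).integrable_of_hasCompactSupport hψ.2.1.mul_left

end IsTestFunction

theorem MemL2.integrable_mul {v w : Space d → ℝ} (hv : MemL2 Ω v) (hw : MemL2 Ω w) :
    Integrable (fun x => v x * w x) (volume.restrict Ω) :=
  MemLp.integrable_mul hv hw

/-- A square-integrable function orthogonal to all test functions vanishes. -/
theorem MemL2.ae_eq_zero (hΩo : IsOpen Ω) (hΩb : Bornology.IsBounded Ω) {w : Space d → ℝ}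
    (hw : MemL2 Ω w) (h : ∀ φ, IsTestFunction Ω φ → ∫ x in Ω, w x * φ x = 0) :
    w =ᵐ[volume.restrict Ω] 0 := by
  have := isFiniteMeasure_restrict hΩb
  have hint : IntegrableOn w Ω := MemLp.integrable (q := 2) (by norm_num) hw
  refine (ae_restrict_iff' hΩo.measurableSet).mpr
    (hΩo.ae_eq_zero_of_integral_contDiff_smul_eq_zero hint.locallyIntegrableOn
      fun g hg hgc hgs => ?_)
  have hφ : IsTestFunction Ω g := ⟨hg, hgc, hgs⟩
  rw [← h g hφ, setIntegral_eq_integral_of_forall_compl_eq_zero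
    (fun x hx => by rw [hφ.eq_zero hx, mul_zero])]
  simp [mul_comm]

/-- This makes the choice in `weakPartial` harmless: almost everywhere it may be replaced by any
explicit weak derivative. -/
theorem IsWeakPartial.ae_eq (hΩo : IsOpen Ω) (hΩb : Bornology.IsBounded Ω) {i : Fin d}
    {v v' w w' : Space d → ℝ} (hw : IsWeakPartial Ω i v w) (hw' : IsWeakPartial Ω i v' w')
    (hv : v =ᵐ[volume.restrict Ω] v') : w =ᵐ[volume.restrict Ω] w' := by
  have h := MemL2.ae_eq_zero hΩo hΩb (MemLp.sub hw.1 hw'.1) fun φ hφ => ?_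
  · filter_upwards [h] with x hx
    simpa [sub_eq_zero] using hx
  · have h1 := hw.2 φ hφ
    have h2 := hw'.2 φ hφ
    have h3 : ∫ x in Ω, v x * classicalPartial i φ x = ∫ x in Ω, v' x * classicalPartial i φ x :=
      integral_congr_ae (hv.mono fun x hx => by simp only [hx])
    simp only [Pi.sub_apply, sub_mul]
    rw [integral_sub (hw.1.integrable_mul hφ.memL2) (hw'.1.integrable_mul hφ.memL2)]
    linarith

theorem MemH1.isWeakPartial {v : Space d → ℝ} (hv : MemH1 Ω v) (i : Fin d) :
    IsWeakPartial Ω i v (weakPartial Ω i v) := by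
  rw [weakPartial, dif_pos (hv.2 i)]
  exact (hv.2 i).choose_spec

theorem IsWeakPartial.add {i : Fin d} {v v' w w' : Space d → ℝ} (hv : MemL2 Ω v)
    (hv' : MemL2 Ω v') (hw : IsWeakPartial Ω i v w) (hw' : IsWeakPartial Ω i v' w') :
    IsWeakPartial Ω i (v + v') (w + w') := by
  refine ⟨MemLp.add hw.1 hw'.1, fun φ hφ => ?_⟩
  simp only [Pi.add_apply, add_mul]
  rw [integral_add (hv.integrable_mul (hφ.memL2_classicalPartial i))
      (hv'.integrable_mul (hφ.memL2_classicalPartial i)),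
    integral_add (hw.1.integrable_mul hφ.memL2) (hw'.1.integrable_mul hφ.memL2),
    hw.2 φ hφ, hw'.2 φ hφ]
  ring

theorem IsWeakPartial.smul {i : Fin d} {v w : Space d → ℝ} (hw : IsWeakPartial Ω i v w) (c : ℝ) :
    IsWeakPartial Ω i (c • v) (c • w) := by
  refine ⟨MemLp.const_smul hw.1 c, fun φ hφ => ?_⟩
  simp only [Pi.smul_apply, smul_eq_mul, mul_assoc]
  rw [integral_const_mul, integral_const_mul, hw.2 φ hφ]
  ring

/-! ### Lipschitz functions of compact support belong to `H¹₀` -/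

/-- Difference quotients of a Lipschitz function are bounded by its constant, so integration by
parts against a test function survives the passage to the limit. -/
theorem isWeakPartial_lineDeriv (hΩb : Bornology.IsBounded Ω) {f : Space d → ℝ} {L : NNReal}
    (hf : LipschitzWith L f) (i : Fin d) :
    IsWeakPartial Ω i f (fun x => lineDeriv ℝ f x (EuclideanSpace.single i 1)) := by
  have := isFiniteMeasure_restrict hΩb
  refine ⟨MemLp.of_bound (measurable_lineDeriv hf.continuous).aestronglyMeasurable
    (L * ‖(EuclideanSpace.single i 1 : Space d)‖)
    (.of_forall fun x => norm_lineDeriv_le_of_lipschitz ℝ hf), fun φ hφ => ?_⟩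
  obtain ⟨K, hK⟩ := hφ.lipschitz
  have h := hf.integral_lineDeriv_mul_eq (μ := volume) hK hφ.2.1 (EuclideanSpace.single i 1)
  rw [setIntegral_eq_integral_of_forall_compl_eq_zero
      (fun x hx => by rw [hφ.classicalPartial_eq_zero i hx, mul_zero]),
    setIntegral_eq_integral_of_forall_compl_eq_zero
      (fun x hx => by rw [hφ.eq_zero hx, mul_zero]), h, ← integral_neg]
  refine integral_congr_ae (.of_forall fun x => ?_)
  simp only [map_neg, (hφ.differentiable x).lineDeriv_eq_fderiv, classicalPartial]
  ring

/-- The mollification of a function by a normalised bump function. -/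
def mollify (ρ : ContDiffBump (0 : Space d)) (f : Space d → ℝ) : Space d → ℝ :=
  MeasureTheory.convolution (ρ.normed volume) f (ContinuousLinearMap.lsmul ℝ ℝ) volume

theorem abs_mollify_le (ρ : ContDiffBump (0 : Space d)) {f : Space d → ℝ} {M : ℝ}
    (hM : ∀ x, |f x| ≤ M) (x : Space d) : |mollify ρ f x| ≤ M := by
  rw [mollify, MeasureTheory.convolution_def, ← Real.norm_eq_abs]
  refine (norm_integral_le_of_norm_le (ρ.integrable_normed.mul_const M)
    (.of_forall fun t => ?_)).trans_eq ?_
  · simp only [ContinuousLinearMap.lsmul_apply, smul_eq_mul, norm_mul, Real.norm_eq_abs,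
      abs_of_nonneg (ρ.nonneg_normed t)]
    exact mul_le_mul_of_nonneg_left (hM _) (ρ.nonneg_normed t)
  · rw [integral_mul_const, ρ.integral_normed, one_mul]

/-- The derivative first falls on the smooth kernel and is then moved onto `f` by the Lipschitz
integration by parts. Hence the partials of the mollification are averages of the bounded function
`∂_i f`. -/
theorem classicalPartial_mollify (ρ : ContDiffBump (0 : Space d)) {f : Space d → ℝ} {L : NNReal}
    (hf : LipschitzWith L f) (i : Fin d) (x : Space d) :
    classicalPartial i (mollify ρ f) x =
      mollify ρ (fun y => lineDeriv ℝ f y (EuclideanSpace.single i 1)) x := by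
  have hρ : ContDiff ℝ 1 (ρ.normed (volume : Measure (Space d))) := ρ.contDiff_normed
  have hd := ρ.hasCompactSupport_normed.hasFDerivAt_convolution_left
    (μ := (volume : Measure (Space d))) (ContinuousLinearMap.lsmul ℝ ℝ) hρ
    hf.continuous.locallyIntegrable x
  rw [classicalPartial, mollify, hd.fderiv, MeasureTheory.convolution_def]
  set e : Space d := EuclideanSpace.single i 1
  have hint : Integrable (fun t => (((ContinuousLinearMap.lsmul ℝ ℝ).precompL (Space d))
      (fderiv ℝ (ρ.normed volume) t)) (f (x - t))) volume :=
    HasCompactSupport.convolutionExists_left (μ := volume)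
      ((ContinuousLinearMap.lsmul ℝ ℝ : ℝ →L[ℝ] ℝ →L[ℝ] ℝ).precompL (Space d))
      (ρ.hasCompactSupport_normed.fderiv ℝ) (hρ.continuous_fderiv one_ne_zero)
      hf.continuous.locallyIntegrable x
  rw [ContinuousLinearMap.integral_apply hint, mollify, MeasureTheory.convolution_def]
  have hF : LipschitzWith L (fun t => f (x - t)) := by
    refine LipschitzWith.of_dist_le_mul fun s t => ?_
    have := hf.dist_le_mul (x - s) (x - t)
    rwa [dist_sub_left] at this
  obtain ⟨K, hK⟩ := hρ.lipschitzWith_of_hasCompactSupport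
    (ρ.hasCompactSupport_normed (μ := volume)) one_ne_zero
  -- The reflection `t ↦ x - t` reverses directions, so the direction `-e` in `t` produces the
  -- derivative of `f` along `e`.
  have h := hF.integral_lineDeriv_mul_eq (μ := volume) hK ρ.hasCompactSupport_normed (-e)
  rw [neg_neg] at h
  have h1 : ∀ t, lineDeriv ℝ (fun t => f (x - t)) t (-e) = lineDeriv ℝ f (x - t) e := by
    intro t
    rw [lineDeriv, lineDeriv]
    congr 1
    ext s
    congr 1
    simp only [smul_neg]
    abel
  have h2 : ∀ t, lineDeriv ℝ (ρ.normed volume) t e = fderiv ℝ (ρ.normed volume) t e := fun t =>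
    ((hρ.differentiable one_ne_zero) t).lineDeriv_eq_fderiv
  simp only [h1, h2] at h
  simp only [ContinuousLinearMap.precompL_apply, ContinuousLinearMap.lsmul_apply, smul_eq_mul]
  rw [← h]
  simp only [mul_comm]

theorem isTestFunction_mollify (ρ : ContDiffBump (0 : Space d)) {f : Space d → ℝ}
    (hf : Continuous f) (hfc : HasCompactSupport f)
    (hρ : Metric.cthickening ρ.rOut (tsupport f) ⊆ Ω) : IsTestFunction Ω (mollify ρ f) := by
  refine ⟨ρ.hasCompactSupport_normed.contDiff_convolution_left _ ρ.contDiff_normed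
    hf.locallyIntegrable, ρ.hasCompactSupport_normed.convolution _ hfc, ?_⟩
  refine subset_trans ?_ hρ
  refine closure_minimal ?_ Metric.isClosed_cthickening
  refine (MeasureTheory.support_convolution_subset _).trans ?_
  rintro x ⟨a, ha, b, hb, rfl⟩
  refine Metric.mem_cthickening_of_dist_le _ b _ _ (subset_tsupport f hb) ?_
  rw [ρ.support_normed_eq, Metric.mem_ball, dist_zero_right] at ha
  simpa using ha.le

theorem tendsto_integral_sq_sub (hΩb : Bornology.IsBounded Ω) {f : Space d → ℝ}
    {F : ℕ → Space d → ℝ} {M : ℝ} (hf : Measurable f) (hF : ∀ n, Continuous (F n))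
    (hM : ∀ x, |f x| ≤ M) (hFM : ∀ n x, |F n x| ≤ M)
    (hlim : ∀ᵐ x, Filter.Tendsto (fun n => F n x) Filter.atTop (nhds (f x))) :
    Filter.Tendsto (fun n => ∫ x in Ω, (f x - F n x) ^ 2) Filter.atTop (nhds 0) := by
  have := isFiniteMeasure_restrict hΩb
  have h := tendsto_integral_of_dominated_convergence (μ := volume.restrict Ω)
    (F := fun n x => (f x - F n x) ^ 2) (f := fun _ => (0 : ℝ)) (fun _ => (2 * M) ^ 2)
    (fun n => ((hf.sub (hF n).measurable).pow_const 2).aestronglyMeasurable)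
    (integrable_const _) (fun n => .of_forall fun x => ?_) ?_
  · simpa using h
  · rw [Real.norm_eq_abs, abs_pow]
    refine pow_le_pow_left₀ (abs_nonneg _) ?_ 2
    have := abs_sub (f x) (F n x)
    linarith [hM x, hFM n x]
  · refine ae_restrict_of_ae (hlim.mono fun x hx => ?_)
    have : Filter.Tendsto (fun n => (f x - F n x) ^ 2) Filter.atTop (nhds ((f x - f x) ^ 2)) :=
      (tendsto_const_nhds.sub hx).pow 2
    simpa using this

/-- Mollifications converge almost everywhere, together with their partials, by Lebesgue
differentiation. The bounds are uniform and `Ω` has finite measure, so dominated convergence gives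
convergence in `H¹`. For small radii the compact support stays in `Ω`. -/
theorem memH10_of_lipschitz (hΩo : IsOpen Ω) (hΩb : Bornology.IsBounded Ω) {f : Space d → ℝ}
    {L : NNReal} (hf : LipschitzWith L f) (hfc : HasCompactSupport f) (hfs : tsupport f ⊆ Ω) :
    MemH10 Ω f := by
  have := isFiniteMeasure_restrict hΩb
  have hw := fun i => isWeakPartial_lineDeriv (Ω := Ω) hΩb hf i
  have hH1 : MemH1 Ω f :=
    ⟨(hf.continuous.memLp_of_hasCompactSupport hfc).restrict _, fun i => ⟨_, hw i⟩⟩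
  refine ⟨hH1, fun ε hε => ?_⟩
  have hae : ∀ i, weakPartial Ω i f =ᵐ[volume.restrict Ω]
      fun x => lineDeriv ℝ f x (EuclideanSpace.single i 1) := fun i =>
    (hH1.isWeakPartial i).ae_eq hΩo hΩb (hw i) (ae_eq_refl _)
  obtain ⟨δ, hδ, hδΩ⟩ := hfc.isCompact.exists_cthickening_subset_open hΩo hfs
  -- The fixed ratio `2` of outer to inner radius is what permits convergence at Lebesgue points, as
  -- opposed to points of continuity.
  let ρ : ℕ → ContDiffBump (0 : Space d) := fun n =>
    ⟨1 / ((n : ℝ) + 1) / 2, 1 / ((n : ℝ) + 1), by positivity, half_lt_self (by positivity)⟩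
  have hρlim : Filter.Tendsto (fun n => (ρ n).rOut) Filter.atTop (nhds 0) :=
    tendsto_one_div_add_atTop_nhds_zero_nat
  have hρK : ∀ᶠ n in Filter.atTop, (ρ n).rOut ≤ 2 * (ρ n).rIn :=
    .of_forall fun n => by simp only [ρ]; linarith
  obtain ⟨M, hM⟩ := hf.continuous.bounded_above_of_compact_support hfc
  have hmol : ∀ᶠ n in Filter.atTop, IsTestFunction Ω (mollify (ρ n) f) := by
    filter_upwards [hρlim.eventually (gt_mem_nhds hδ)] with n hn
    exact isTestFunction_mollify _ hf.continuous hfc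
      ((Metric.cthickening_mono hn.le _).trans hδΩ)
  have hsmooth : ∀ n, ContDiff ℝ 1 (mollify (ρ n) f) := fun n =>
    (ρ n).hasCompactSupport_normed.contDiff_convolution_left _ (ρ n).contDiff_normed
      hf.continuous.locallyIntegrable
  have hlim₀ : Filter.Tendsto (fun n => ∫ x in Ω, (f x - mollify (ρ n) f x) ^ 2) Filter.atTop
      (nhds 0) :=
    tendsto_integral_sq_sub hΩb hf.continuous.measurable (fun n => (hsmooth n).continuous)
      hM (fun n => abs_mollify_le _ hM)
      (ContDiffBump.ae_convolution_tendsto_right_of_locallyIntegrable hρlim hρK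
        hf.continuous.locallyIntegrable)
  have hlim₁ : ∀ i, Filter.Tendsto (fun n => ∫ x in Ω, (weakPartial Ω i f x -
      classicalPartial i (mollify (ρ n) f) x) ^ 2) Filter.atTop (nhds 0) := by
    intro i
    have hbd : ∀ x, |lineDeriv ℝ f x (EuclideanSpace.single i 1)| ≤
        L * ‖(EuclideanSpace.single i 1 : Space d)‖ := fun x =>
      norm_lineDeriv_le_of_lipschitz ℝ hf
    have hmeas : Measurable fun x => lineDeriv ℝ f x (EuclideanSpace.single i 1) :=
      measurable_lineDeriv hf.continuous
    have hloc : LocallyIntegrable (fun x => lineDeriv ℝ f x (EuclideanSpace.single i 1)) volume :=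
      (memLp_top_of_bound hmeas.aestronglyMeasurable _ (.of_forall hbd)).locallyIntegrable
        le_top
    have h := tendsto_integral_sq_sub (Ω := Ω) hΩb hmeas
      (F := fun n => classicalPartial i (mollify (ρ n) f))
      (fun n => ((hsmooth n).continuous_fderiv one_ne_zero).clm_apply continuous_const)
      hbd (fun n x => by rw [classicalPartial_mollify _ hf]; exact abs_mollify_le _ hbd x) (by
        simp only [classicalPartial_mollify _ hf]
        exact ContDiffBump.ae_convolution_tendsto_right_of_locallyIntegrable hρlim hρK hloc)
    refine h.congr fun n => integral_congr_ae ?_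
    filter_upwards [hae i] with x hx
    rw [hx]
  have hsum := hlim₀.add (tendsto_finsetSum Finset.univ fun i _ => hlim₁ i)
  simp only [Finset.sum_const_zero, add_zero] at hsum
  obtain ⟨n, hn₁, hn₂⟩ := (hmol.and (hsum.eventually (gt_mem_nhds hε))).exists
  exact ⟨_, hn₁, hn₂⟩

/-! ### `H¹₀` as a closed subspace of `L² × (L²)^d` -/

theorem MemL2.memLp {v : Space d → ℝ} (hv : MemL2 Ω v) : MemLp v 2 (volume.restrict Ω) := hv

/-- Pairs of a square-integrable function and a square-integrable vector field. -/
abbrev L2Pair (Ω : Set (Space d)) :=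
  WithLp 2 (Lp ℝ 2 (volume.restrict Ω) × Lp (Space d) 2 (volume.restrict Ω))

/-- The function component of a pair. -/
abbrev funL (Ω : Set (Space d)) : L2Pair Ω →L[ℝ] Lp ℝ 2 (volume.restrict Ω) :=
  WithLp.fstL 2 ℝ _ _

/-- The vector field component of a pair. -/
abbrev gradL (Ω : Set (Space d)) : L2Pair Ω →L[ℝ] Lp (Space d) 2 (volume.restrict Ω) :=
  WithLp.sndL 2 ℝ _ _

/-- The pair formed by two square-integrable functions. -/
def mkPair {v : Space d → ℝ} {g : Space d → Space d} (hv : MemL2 Ω v)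
    (hg : MemLp g 2 (volume.restrict Ω)) : L2Pair Ω :=
  WithLp.toLp 2 (hv.memLp.toLp v, MemLp.toLp g hg)

theorem funL_mkPair_ae {v : Space d → ℝ} {g : Space d → Space d} (hv : MemL2 Ω v)
    (hg : MemLp g 2 (volume.restrict Ω)) : funL Ω (mkPair hv hg) =ᵐ[volume.restrict Ω] v :=
  MemLp.coeFn_toLp hv.memLp

theorem gradL_mkPair_ae {v : Space d → ℝ} {g : Space d → Space d} (hv : MemL2 Ω v)
    (hg : MemLp g 2 (volume.restrict Ω)) : gradL Ω (mkPair hv hg) =ᵐ[volume.restrict Ω] g :=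
  MemLp.coeFn_toLp hg

theorem inner_Lp_eq {f g : Lp ℝ 2 (volume.restrict Ω)} {v w : Space d → ℝ}
    (hf : f =ᵐ[volume.restrict Ω] v) (hg : g =ᵐ[volume.restrict Ω] w) :
    inner ℝ f g = ∫ x in Ω, v x * w x := by
  rw [L2.inner_def]
  refine integral_congr_ae ?_
  filter_upwards [hf, hg] with x h1 h2
  rw [h1, h2, RCLike.inner_apply, mul_comm]; rfl

theorem inner_Lp_vec_eq {f g : Lp (Space d) 2 (volume.restrict Ω)} {v w : Space d → Space d}
    (hf : f =ᵐ[volume.restrict Ω] v) (hg : g =ᵐ[volume.restrict Ω] w) :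
    inner ℝ f g = ∫ x in Ω, inner ℝ (v x) (w x) := by
  rw [L2.inner_def]
  refine integral_congr_ae ?_
  filter_upwards [hf, hg] with x h1 h2
  rw [h1, h2]

theorem norm_sq_Lp_eq {f : Lp ℝ 2 (volume.restrict Ω)} {v : Space d → ℝ}
    (hf : f =ᵐ[volume.restrict Ω] v) : ‖f‖ ^ 2 = ∫ x in Ω, v x ^ 2 := by
  rw [← real_inner_self_eq_norm_sq, inner_Lp_eq hf hf]
  simp only [sq]

theorem norm_sq_Lp_vec_eq {f : Lp (Space d) 2 (volume.restrict Ω)} {v : Space d → Space d}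
    (hf : f =ᵐ[volume.restrict Ω] v) : ‖f‖ ^ 2 = ∑ i, ∫ x in Ω, v x i ^ 2 := by
  have hv : MemLp v 2 (volume.restrict Ω) := (memLp_congr_ae hf).mp (Lp.memLp f)
  rw [← real_inner_self_eq_norm_sq, inner_Lp_vec_eq hf hf,
    ← integral_finsetSum _ fun i _ => (hv.eval_piLp i).integrable_sq]
  simp only [real_inner_self_eq_norm_sq, EuclideanSpace.real_norm_sq_eq]

theorem norm_sq_L2Pair (e : L2Pair Ω) : ‖e‖ ^ 2 = ‖funL Ω e‖ ^ 2 + ‖gradL Ω e‖ ^ 2 :=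
  WithLp.prod_norm_sq_eq_of_L2 e

/-- The classical gradient. -/
def classicalGrad (φ : Space d → ℝ) (x : Space d) : Space d :=
  WithLp.toLp 2 fun i => classicalPartial i φ x

theorem IsTestFunction.memLp_classicalGrad {φ : Space d → ℝ} (hφ : IsTestFunction Ω φ) :
    MemLp (classicalGrad φ) 2 (volume.restrict Ω) :=
  MemLp.of_eval_piLp fun i => hφ.memL2_classicalPartial i

theorem MemH1.memLp_weakGrad {v : Space d → ℝ} (hv : MemH1 Ω v) :
    MemLp (weakGrad Ω v) 2 (volume.restrict Ω) :=
  MemLp.of_eval_piLp fun i => (hv.isWeakPartial i).1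

/-- The pairs `(φ, ∇φ)` of test functions. -/
def testPairs (Ω : Set (Space d)) : Submodule ℝ (L2Pair Ω) where
  carrier := {e | ∃ φ, ∃ hφ : IsTestFunction Ω φ, e = mkPair hφ.memL2 hφ.memLp_classicalGrad}
  add_mem' := by
    rintro _ _ ⟨φ, hφ, rfl⟩ ⟨ψ, hψ, rfl⟩
    refine ⟨φ + ψ, hφ.add hψ, ?_⟩
    rw [mkPair, mkPair, mkPair, ← WithLp.toLp_add, Prod.mk_add_mk, ← MemLp.toLp_add,
      ← MemLp.toLp_add]
    congr 3
    ext x i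
    exact (hφ.classicalPartial_add hψ i x).symm
  zero_mem' := by
    refine ⟨0, IsTestFunction.zero, ?_⟩
    rw [mkPair]
    have h : classicalGrad (0 : Space d → ℝ) = 0 := by
      ext x i
      simp [classicalGrad, classicalPartial]
    have h1 : MemLp.toLp (0 : Space d → ℝ) (IsTestFunction.zero (Ω := Ω)).memL2.memLp = 0 :=
      MemLp.toLp_zero _
    have h2 : MemLp.toLp (classicalGrad (0 : Space d → ℝ))
        (IsTestFunction.zero (Ω := Ω)).memLp_classicalGrad = 0 := by
      simp only [h]
      exact MemLp.toLp_zero _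
    rw [h1, h2]
    rfl
  smul_mem' := by
    rintro c _ ⟨φ, hφ, rfl⟩
    refine ⟨c • φ, hφ.smul c, ?_⟩
    rw [mkPair, mkPair, ← WithLp.toLp_smul, Prod.smul_mk, ← MemLp.toLp_const_smul,
      ← MemLp.toLp_const_smul]
    congr 3
    ext x i
    exact (hφ.classicalPartial_smul c i x).symm

/-- The space `H¹₀(Ω)`, as the closure of the pairs `(φ, ∇φ)` in `L² × (L²)^d`. -/
def H10Space (Ω : Set (Space d)) : Submodule ℝ (L2Pair Ω) :=
  (testPairs Ω).topologicalClosure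

instance : CompleteSpace (H10Space Ω) :=
  (Submodule.isClosed_topologicalClosure _).completeSpace_coe

/-- A closed property of pairs holds on `H¹₀` when it holds for test functions. -/
theorem H10Space.induction {P : L2Pair Ω → Prop} (hP : IsClosed {e | P e})
    (h : ∀ φ (hφ : IsTestFunction Ω φ), P (mkPair hφ.memL2 hφ.memLp_classicalGrad))
    {e : L2Pair Ω} (he : e ∈ H10Space Ω) : P e := by
  have : closure (testPairs Ω : Set (L2Pair Ω)) ⊆ {e | P e} := by
    refine closure_minimal ?_ hP
    rintro _ ⟨φ, hφ, rfl⟩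
    exact h φ hφ
  exact this he

/-- The second component of an element of `H¹₀` is the weak gradient of the first. -/
theorem H10Space.integral_eq {e : L2Pair Ω} (he : e ∈ H10Space Ω) {ψ : Space d → ℝ}
    (hψ : IsTestFunction Ω ψ) (i : Fin d) :
    ∫ x in Ω, funL Ω e x * classicalPartial i ψ x = - ∫ x in Ω, gradL Ω e x i * ψ x := by
  -- Pairing with the field `ψ e_i` turns the identity into a statement about inner products,
  -- continuous in `e`, so that it passes to the closure of the test pairs.
  have hψi : MemLp (fun x => EuclideanSpace.single i (ψ x)) 2 (volume.restrict Ω) :=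
    MemLp.of_eval_piLp fun j => by
      by_cases hj : j = i
      · subst hj; simpa using hψ.memL2.memLp
      · simp [hj]
  have hinner : ∀ e : L2Pair Ω, inner ℝ (funL Ω e) (MemLp.toLp _ (hψ.memL2_classicalPartial i).memLp) +
      inner ℝ (gradL Ω e) (MemLp.toLp _ hψi) =
      (∫ x in Ω, funL Ω e x * classicalPartial i ψ x) + ∫ x in Ω, gradL Ω e x i * ψ x := by
    intro e
    rw [inner_Lp_eq (ae_eq_refl _) (MemLp.coeFn_toLp _),
      inner_Lp_vec_eq (ae_eq_refl _) (MemLp.coeFn_toLp _)]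
    simp [EuclideanSpace.inner_single_right, mul_comm]
  have key : inner ℝ (funL Ω e) (MemLp.toLp _ (hψ.memL2_classicalPartial i).memLp) +
      inner ℝ (gradL Ω e) (MemLp.toLp _ hψi) = 0 := by
    refine H10Space.induction (P := fun e => inner ℝ (funL Ω e)
      (MemLp.toLp _ (hψ.memL2_classicalPartial i).memLp) + inner ℝ (gradL Ω e) (MemLp.toLp _ hψi) = 0)
      (isClosed_eq (by fun_prop) continuous_const) (fun φ hφ => ?_) he
    rw [inner_Lp_eq (funL_mkPair_ae _ _) (MemLp.coeFn_toLp _),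
      inner_Lp_vec_eq (gradL_mkPair_ae _ _) (MemLp.coeFn_toLp _),
      hφ.integral_mul_classicalPartial hψ i]
    simp [EuclideanSpace.inner_single_right, classicalGrad, mul_comm]
  rw [hinner] at key
  linarith

/-- The gradient component is determined in the weak sense by the function component. It follows
that a nonzero limit derivative in `H¹₀` is visible in the `L²` norm measured by `J`. -/
theorem H10Space.funL_injective (hΩo : IsOpen Ω) (hΩb : Bornology.IsBounded Ω) {e : L2Pair Ω}
    (he : e ∈ H10Space Ω) (h0 : funL Ω e = 0) : e = 0 := by
  have hg : gradL Ω e = 0 := by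
    have hi : ∀ i, (fun x => gradL Ω e x i) =ᵐ[volume.restrict Ω] 0 := fun i => by
      refine MemL2.ae_eq_zero hΩo hΩb ((Lp.memLp (gradL Ω e)).eval_piLp i) fun φ hφ => ?_
      have h1 := H10Space.integral_eq he hφ i
      have h2 : ∫ x in Ω, funL Ω e x * classicalPartial i φ x = 0 := by
        rw [h0]
        refine integral_eq_zero_of_ae ?_
        filter_upwards [Lp.coeFn_zero ℝ 2 (volume.restrict Ω)] with x hx
        rw [hx]; simp
      linarith
    refine Lp.ext ?_
    filter_upwards [Filter.eventually_all.mpr hi, Lp.coeFn_zero (Space d) 2 (volume.restrict Ω)]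
      with x hx hx0
    rw [hx0]
    ext i
    exact hx i
  have h := norm_sq_L2Pair e
  rw [h0, hg, norm_zero, norm_zero] at h
  have h1 : ‖e‖ ^ 2 = 0 := by rw [h]; norm_num
  exact norm_eq_zero.mp (pow_eq_zero_iff (by norm_num) |>.mp h1)

/-! ### The Poincaré inequality -/

theorem inner_classicalGrad {φ : Space d → ℝ} (x c : Space d) :
    inner ℝ c (classicalGrad φ x) = fderiv ℝ φ x c := by
  have hcs : c = ∑ i, c i • (EuclideanSpace.single i (1 : ℝ) : Space d) := by
    ext j
    simp [Finset.sum_apply, Pi.single_apply]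
  conv_rhs => rw [hcs]
  simp [PiLp.inner_apply, classicalGrad, classicalPartial, mul_comm]

theorem IsTestFunction.integral_clm_mul_fderiv {ψ : Space d → ℝ} (hψ : IsTestFunction Ω ψ)
    (ℓ : Space d →L[ℝ] ℝ) (c : Space d) :
    ∫ x, ℓ x * fderiv ℝ ψ x c = -(ℓ c * ∫ x, ψ x) := by
  have hcont : Continuous fun x => fderiv ℝ ψ x c :=
    (hψ.1.continuous_fderiv (by simp)).clm_apply continuous_const
  have hsupp : HasCompactSupport fun x => fderiv ℝ ψ x c := hψ.2.1.fderiv_apply (𝕜 := ℝ) _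
  have h := integral_mul_fderiv_eq_neg_fderiv_mul_of_integrable (μ := volume) (f := ℓ) (g := ψ)
    (v := c) ?_ ?_ ?_ (fun x _ => ℓ.differentiableAt) (fun x _ => hψ.differentiable x)
  · rw [h]
    simp only [ContinuousLinearMap.fderiv, integral_const_mul]
  · simp only [ContinuousLinearMap.fderiv]
    exact (hψ.1.continuous.integrable_of_hasCompactSupport hψ.2.1).const_mul _
  · exact (ℓ.continuous.mul hcont).integrable_of_hasCompactSupport hsupp.mul_left
  · exact (ℓ.continuous.mul hψ.1.continuous).integrable_of_hasCompactSupport hψ.2.1.mul_left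

/-- Directional Poincaré inequality for test functions. -/
theorem IsTestFunction.poincare (hΩo : IsOpen Ω) {φ : Space d → ℝ} (hφ : IsTestFunction Ω φ)
    {R : ℝ} (hR : ∀ x ∈ Ω, ‖x‖ ≤ R) (c : Space d) :
    ‖c‖ ^ 2 * ∫ x in Ω, φ x ^ 2 ≤ 4 * R ^ 2 * ∫ x in Ω, (inner ℝ c (classicalGrad φ x)) ^ 2 := by
  rcases eq_or_ne c 0 with rfl | hc
  · simp
  have hcpos : 0 < ‖c‖ := norm_pos_iff.mpr hc
  have hcont : Continuous fun x => fderiv ℝ φ x c :=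
    (hφ.1.continuous_fderiv (by simp)).clm_apply continuous_const
  have hsupp : HasCompactSupport fun x => fderiv ℝ φ x c := hφ.2.1.fderiv_apply (𝕜 := ℝ) _
  have hsq : ∀ x, fderiv ℝ (fun y => φ y * φ y) x c = 2 * φ x * fderiv ℝ φ x c := by
    intro x
    rw [fderiv_fun_mul (hφ.differentiable x) (hφ.differentiable x)]
    simp only [_root_.add_apply, _root_.smul_apply, smul_eq_mul]
    ring
  -- The weight `⟨c, x⟩` has constant derivative `‖c‖²` along `c`; integrating by parts against `φ²`
  -- gives `‖c‖² ∫ φ² = -∫ ⟨c, x⟩ 2 φ ∂_c φ`.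
  have hbp := (hφ.mul hφ).integral_clm_mul_fderiv (innerSL ℝ c) c
  simp only [hsq, innerSL_apply_apply, real_inner_self_eq_norm_sq] at hbp
  rw [← setIntegral_eq_integral_of_forall_compl_eq_zero (s := Ω)
      (f := fun x => (inner ℝ c x : ℝ) * (2 * φ x * fderiv ℝ φ x c))
      (fun x hx => by rw [hφ.eq_zero hx]; ring),
    ← setIntegral_eq_integral_of_forall_compl_eq_zero (s := Ω) (f := fun x => φ x * φ x)
      (fun x hx => by rw [hφ.eq_zero hx]; ring)] at hbp
  have hi1 : Integrable (fun x => φ x * φ x) (volume.restrict Ω) :=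
    hφ.memL2.integrable_mul hφ.memL2
  have hi2 : Integrable (fun x => (fderiv ℝ φ x c) ^ 2) (volume.restrict Ω) :=
    ((hcont.memLp_of_hasCompactSupport hsupp).restrict Ω).integrable_sq
  have hi3 : Integrable (fun x => (inner ℝ c x : ℝ) * (2 * φ x * fderiv ℝ φ x c))
      (volume.restrict Ω) :=
    (Continuous.integrable_of_hasCompactSupport
      ((innerSL ℝ c).continuous.mul ((continuous_const.mul hφ.1.continuous).mul hcont))
      (hsupp.mul_left (f := fun x => 2 * φ x)).mul_left).restrict
  have hle : ∫ x in Ω, -((inner ℝ c x : ℝ) * (2 * φ x * fderiv ℝ φ x c)) ≤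
      ∫ x in Ω, (‖c‖ ^ 2 / 2 * (φ x * φ x) + 2 * R ^ 2 * (fderiv ℝ φ x c) ^ 2) := by
    have hi4 : IntegrableOn (fun x => -((inner ℝ c x : ℝ) * (2 * φ x * fderiv ℝ φ x c))) Ω :=
      hi3.neg
    have hi5 : IntegrableOn
        (fun x => ‖c‖ ^ 2 / 2 * (φ x * φ x) + 2 * R ^ 2 * (fderiv ℝ φ x c) ^ 2) Ω :=
      (hi1.const_mul _).add (hi2.const_mul _)
    refine setIntegral_mono_on hi4 hi5 hΩo.measurableSet fun x hx => ?_
    have h1 : (inner ℝ c x : ℝ) ^ 2 ≤ ‖c‖ ^ 2 * R ^ 2 := by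
      rw [← mul_pow, sq_le_sq]
      refine (abs_real_inner_le_norm c x).trans ((mul_le_mul_of_nonneg_left (hR x hx)
        hcpos.le).trans (le_abs_self _))
    set s : ℝ := inner ℝ c x
    set D : ℝ := fderiv ℝ φ x c
    -- Young's inequality, balanced so that exactly half of `‖c‖² ∫ φ²` is absorbed on the left. It
    -- is multiplied through by `‖c‖²` to avoid division.
    have h2 : 0 ≤ (‖c‖ ^ 2 * φ x + 2 * s * D) ^ 2 := sq_nonneg _
    have h3 : s ^ 2 * D ^ 2 ≤ ‖c‖ ^ 2 * R ^ 2 * D ^ 2 := by gcongr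
    have h4 : 0 ≤ ‖c‖ ^ 2 * (‖c‖ ^ 2 / 2 * (φ x * φ x) + 2 * R ^ 2 * D ^ 2 + s * (2 * φ x * D)) := by
      nlinarith
    have h5 := nonneg_of_mul_nonneg_right h4 (by positivity)
    linarith
  rw [integral_neg, integral_add (hi1.const_mul _) (hi2.const_mul _), integral_const_mul,
    integral_const_mul, hbp] at hle
  simp only [inner_classicalGrad, sq (φ _)]
  linarith

/-! ### The bilinear forms on pairs -/

/-- The map `g ↦ a · g` on square-integrable vector fields. -/
def advL {a : Space d → Space d} (ha : MemLp a ⊤ (volume.restrict Ω)) :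
    Lp (Space d) 2 (volume.restrict Ω) →L[ℝ] Lp ℝ 2 (volume.restrict Ω) :=
  (innerSL ℝ).holderL (volume.restrict Ω) ⊤ 2 2 (ha.toLp a)

theorem advL_ae {a : Space d → Space d} (ha : MemLp a ⊤ (volume.restrict Ω))
    {e : Lp (Space d) 2 (volume.restrict Ω)} {g : Space d → Space d}
    (he : e =ᵐ[volume.restrict Ω] g) :
    advL ha e =ᵐ[volume.restrict Ω] fun x => inner ℝ (a x) (g x) := by
  filter_upwards [(innerSL ℝ).coeFn_holder (r := 2) (ha.toLp a) e, ha.coeFn_toLp, he]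
    with x h1 h2 h3
  rw [h2, h3] at h1
  exact h1

/-- Multiplication of square-integrable vector fields by `μ`. -/
def diffL {μ : Space d → ℝ} (hμ : MemLp μ ⊤ (volume.restrict Ω)) :
    Lp (Space d) 2 (volume.restrict Ω) →L[ℝ] Lp (Space d) 2 (volume.restrict Ω) :=
  (ContinuousLinearMap.lsmul ℝ ℝ).holderL (volume.restrict Ω) ⊤ 2 2 (hμ.toLp μ)

theorem diffL_ae {μ : Space d → ℝ} (hμ : MemLp μ ⊤ (volume.restrict Ω))
    {e : Lp (Space d) 2 (volume.restrict Ω)} {g : Space d → Space d}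
    (he : e =ᵐ[volume.restrict Ω] g) :
    diffL hμ e =ᵐ[volume.restrict Ω] fun x => μ x • g x := by
  filter_upwards [(ContinuousLinearMap.lsmul ℝ ℝ).coeFn_holder (r := 2) (hμ.toLp μ) e,
    hμ.coeFn_toLp, he] with x h1 h2 h3
  rw [h2, h3] at h1
  exact h1

/-- The form `(a · ∇u, v) + (μ ∇u, ∇v)` on pairs. -/
def formB {a : Space d → Space d} (ha : MemLp a ⊤ (volume.restrict Ω)) {μ : Space d → ℝ}
    (hμ : MemLp μ ⊤ (volume.restrict Ω)) : L2Pair Ω →L[ℝ] L2Pair Ω →L[ℝ] ℝ :=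
  (innerSL ℝ).bilinearComp ((advL ha).comp (gradL Ω)) (funL Ω) +
    (innerSL ℝ).bilinearComp ((diffL hμ).comp (gradL Ω)) (gradL Ω)

/-- The form `(a · ∇u, a · ∇v)` on pairs. -/
def formS {a : Space d → Space d} (ha : MemLp a ⊤ (volume.restrict Ω)) :
    L2Pair Ω →L[ℝ] L2Pair Ω →L[ℝ] ℝ :=
  (innerSL ℝ).bilinearComp ((advL ha).comp (gradL Ω)) ((advL ha).comp (gradL Ω))

theorem formB_apply {a : Space d → Space d} (ha : MemLp a ⊤ (volume.restrict Ω)) {μ : Space d → ℝ}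
    (hμ : MemLp μ ⊤ (volume.restrict Ω)) (e e' : L2Pair Ω) :
    formB ha hμ e e' = inner ℝ (advL ha (gradL Ω e)) (funL Ω e') +
      inner ℝ (diffL hμ (gradL Ω e)) (gradL Ω e') := rfl

theorem formS_apply {a : Space d → Space d} (ha : MemLp a ⊤ (volume.restrict Ω))
    (e e' : L2Pair Ω) :
    formS ha e e' = inner ℝ (advL ha (gradL Ω e)) (advL ha (gradL Ω e')) := rfl

/-- Skew-symmetry of the advection form on `H¹₀`. -/
theorem inner_advL_self {a : Space d → Space d} (ha : MemLp a ⊤ (volume.restrict Ω))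
    (hdiv : IsDivFree Ω a) {e : L2Pair Ω} (he : e ∈ H10Space Ω) :
    inner ℝ (advL ha (gradL Ω e)) (funL Ω e) = 0 := by
  refine H10Space.induction (P := fun e => inner ℝ (advL ha (gradL Ω e)) (funL Ω e) = 0)
    (isClosed_eq (by fun_prop) continuous_const) (fun φ hφ => ?_) he
  rw [inner_Lp_eq (advL_ae ha (gradL_mkPair_ae _ _)) (funL_mkPair_ae _ _)]
  -- The divergence condition is tested with `φ²`, since `∇(φ²) = 2 φ ∇φ`.
  have h := hdiv _ (hφ.mul hφ)
  have h1 : ∀ x, ∑ i, a x i * classicalPartial i (fun x => φ x * φ x) x =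
      2 * (inner ℝ (a x) (classicalGrad φ x) * φ x) := by
    intro x
    have h2 : ∀ i, classicalPartial i (fun x => φ x * φ x) x =
        2 * φ x * classicalPartial i φ x := by
      intro i
      rw [classicalPartial, fderiv_fun_mul (hφ.differentiable x) (hφ.differentiable x)]
      simp only [_root_.add_apply, _root_.smul_apply, smul_eq_mul, classicalPartial]
      ring
    simp only [h2, PiLp.inner_apply, classicalGrad, RCLike.inner_apply, conj_trivial]
    rw [Finset.sum_mul, Finset.mul_sum]
    exact Finset.sum_congr rfl fun i _ => by ring
  simp only [h1] at h
  rw [integral_const_mul] at h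
  linarith

theorem inner_diffL_self_ge {μ : Space d → ℝ} (hμ : MemLp μ ⊤ (volume.restrict Ω)) {μ₀ : ℝ}
    (hμ_ge : ∀ᵐ x ∂(volume.restrict Ω), μ₀ ≤ μ x) (g : Lp (Space d) 2 (volume.restrict Ω)) :
    μ₀ * ‖g‖ ^ 2 ≤ inner ℝ (diffL hμ g) g := by
  have h1 := L2.integrable_inner (𝕜 := ℝ) (diffL hμ g) g
  have h2 := L2.integrable_inner (𝕜 := ℝ) g g
  rw [← real_inner_self_eq_norm_sq, L2.inner_def, L2.inner_def, ← integral_const_mul]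
  refine integral_mono_ae (h2.const_mul _) h1 ?_
  filter_upwards [diffL_ae hμ (ae_eq_refl g), hμ_ge] with x hx hx'
  simp only [hx, inner_smul_left, conj_trivial]
  exact mul_le_mul_of_nonneg_right hx' real_inner_self_nonneg

theorem formS_self_nonneg {a : Space d → Space d} (ha : MemLp a ⊤ (volume.restrict Ω))
    (e : L2Pair Ω) : 0 ≤ formS ha e e := by
  rw [formS_apply]
  exact real_inner_self_nonneg

/-- Directional Poincaré inequality on `H¹₀`. -/
theorem H10Space.poincare (hΩo : IsOpen Ω) {R : ℝ} (hR : ∀ x ∈ Ω, ‖x‖ ≤ R) (c : Space d)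
    {a : Space d → Space d} (ha : MemLp a ⊤ (volume.restrict Ω))
    (hac : ∀ᵐ x ∂(volume.restrict Ω), a x = c) {e : L2Pair Ω} (he : e ∈ H10Space Ω) :
    ‖c‖ ^ 2 * ‖funL Ω e‖ ^ 2 ≤ 4 * R ^ 2 * ‖advL ha (gradL Ω e)‖ ^ 2 := by
  refine H10Space.induction (P := fun e => ‖c‖ ^ 2 * ‖funL Ω e‖ ^ 2 ≤
    4 * R ^ 2 * ‖advL ha (gradL Ω e)‖ ^ 2)
    (isClosed_le (by fun_prop) (by fun_prop)) (fun φ hφ => ?_) he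
  rw [norm_sq_Lp_eq (funL_mkPair_ae _ _), norm_sq_Lp_eq (v := fun x => inner ℝ c
    (classicalGrad φ x)) ?_]
  · exact hφ.poincare hΩo hR c
  · filter_upwards [advL_ae ha (gradL_mkPair_ae hφ.memL2 hφ.memLp_classicalGrad), hac] with x h1 h2
    rw [h1, h2]

/-- Coercivity of the form on `H¹₀`. -/
theorem exists_formB_coercive (hd : 1 ≤ d) (hΩo : IsOpen Ω) (hΩb : Bornology.IsBounded Ω)
    {a : Space d → Space d} (ha : MemLp a ⊤ (volume.restrict Ω)) (hdiv : IsDivFree Ω a)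
    {μ : Space d → ℝ} (hμ : MemLp μ ⊤ (volume.restrict Ω)) {μ₀ : ℝ} (hμ₀ : 0 < μ₀)
    (hμ_ge : ∀ᵐ x ∂(volume.restrict Ω), μ₀ ≤ μ x) :
    ∃ c > 0, ∀ e ∈ H10Space Ω, c * ‖e‖ * ‖e‖ ≤ formB ha hμ e e := by
  have := isFiniteMeasure_restrict hΩb
  obtain ⟨R, hR⟩ := hΩb.exists_norm_le
  -- A unit coordinate vector, available since `d ≥ 1`. Used as an artificial constant advection
  -- field, it turns the directional inequality into the usual Poincaré inequality.
  set b : Space d := EuclideanSpace.single ⟨0, hd⟩ 1 with hb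
  have hbn : ‖b‖ = 1 := by simp [hb]
  have hbm : MemLp (fun _ => b) ⊤ (volume.restrict Ω) := memLp_const b
  -- `‖e‖²` is the sum of the squared norms of function and gradient, hence at most `(4 R² + 1)`
  -- times that of the gradient.
  refine ⟨μ₀ / (4 * R ^ 2 + 1), by positivity, fun e he => ?_⟩
  have hp := H10Space.poincare hΩo hR b hbm (.of_forall fun _ => rfl) he
  have hadv : ‖advL hbm (gradL Ω e)‖ ^ 2 ≤ ‖gradL Ω e‖ ^ 2 := by
    rw [norm_sq_Lp_eq (advL_ae hbm (ae_eq_refl _)), ← real_inner_self_eq_norm_sq, L2.inner_def]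
    refine integral_mono_ae ?_ (L2.integrable_inner (𝕜 := ℝ) _ _) (.of_forall fun x => ?_)
    · exact ((memLp_congr_ae (advL_ae hbm (ae_eq_refl (gradL Ω e)))).mp
        (Lp.memLp _)).integrable_sq
    · simp only [real_inner_self_eq_norm_sq]
      rw [sq_le_sq, abs_norm]
      refine (abs_real_inner_le_norm _ _).trans ?_
      rw [hbn, one_mul]
  have hdiff := inner_diffL_self_ge hμ hμ_ge (gradL Ω e)
  rw [formB_apply, inner_advL_self ha hdiv he, zero_add]
  refine le_trans ?_ hdiff
  rw [mul_assoc, ← sq, norm_sq_L2Pair, div_mul_eq_mul_div, div_le_iff₀ (by positivity), mul_assoc]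
  refine mul_le_mul_of_nonneg_left ?_ hμ₀.le
  rw [hbn, one_pow, one_mul] at hp
  have : 4 * R ^ 2 * ‖advL hbm (gradL Ω e)‖ ^ 2 ≤ 4 * R ^ 2 * ‖gradL Ω e‖ ^ 2 := by gcongr
  linarith

/-! ### The embedding of `H¹` into pairs -/

/-- The pair `(v, ∇v)`. -/
def MemH1.pair {v : Space d → ℝ} (hv : MemH1 Ω v) : L2Pair Ω :=
  mkPair hv.1 hv.memLp_weakGrad

theorem MemH1.funL_pair_ae {v : Space d → ℝ} (hv : MemH1 Ω v) :
    funL Ω hv.pair =ᵐ[volume.restrict Ω] v :=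
  funL_mkPair_ae _ _

theorem MemH1.gradL_pair_ae {v : Space d → ℝ} (hv : MemH1 Ω v) :
    gradL Ω hv.pair =ᵐ[volume.restrict Ω] weakGrad Ω v :=
  gradL_mkPair_ae _ _

theorem L2Pair.ext_ae {e e' : L2Pair Ω} (h₁ : funL Ω e =ᵐ[volume.restrict Ω] funL Ω e')
    (h₂ : gradL Ω e =ᵐ[volume.restrict Ω] gradL Ω e') : e = e' := by
  have h1 : funL Ω e = funL Ω e' := Lp.ext h₁
  have h2 : gradL Ω e = gradL Ω e' := Lp.ext h₂
  have h := norm_sq_L2Pair (e - e')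
  rw [map_sub, map_sub, h1, h2, sub_self, sub_self, norm_zero, norm_zero] at h
  have h0 : ‖e - e'‖ ^ 2 = 0 := by rw [h]; norm_num
  exact sub_eq_zero.mp (norm_eq_zero.mp ((pow_eq_zero_iff (by norm_num)).mp h0))

theorem weakGrad_ae_eq {v : Space d → ℝ} {g : Space d → Space d}
    (hg : ∀ i, weakPartial Ω i v =ᵐ[volume.restrict Ω] fun x => g x i) :
    weakGrad Ω v =ᵐ[volume.restrict Ω] g := by
  filter_upwards [Filter.eventually_all.mpr hg] with x hx
  ext i
  exact hx i

theorem MemH1.add {v w : Space d → ℝ} (hv : MemH1 Ω v) (hw : MemH1 Ω w) : MemH1 Ω (v + w) :=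
  ⟨MemLp.add hv.1 hw.1, fun i => ⟨_, (hv.isWeakPartial i).add hv.1 hw.1 (hw.isWeakPartial i)⟩⟩

theorem MemH1.smul {v : Space d → ℝ} (hv : MemH1 Ω v) (c : ℝ) : MemH1 Ω (c • v) :=
  ⟨MemLp.const_smul hv.1 c, fun i => ⟨_, (hv.isWeakPartial i).smul c⟩⟩

/-- Pointwise `weakPartial` need not be additive, being a choice; uniqueness almost everywhere makes
the class in `L²` additive. -/
theorem MemH1.pair_add (hΩo : IsOpen Ω) (hΩb : Bornology.IsBounded Ω) {v w : Space d → ℝ}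
    (hv : MemH1 Ω v) (hw : MemH1 Ω w) : (hv.add hw).pair = hv.pair + hw.pair := by
  refine L2Pair.ext_ae ?_ ?_
  · rw [map_add]
    filter_upwards [(hv.add hw).funL_pair_ae, hv.funL_pair_ae, hw.funL_pair_ae,
      Lp.coeFn_add (funL Ω hv.pair) (funL Ω hw.pair)] with x h1 h2 h3 h4
    rw [h1, h4, Pi.add_apply, Pi.add_apply, h2, h3]
  · rw [map_add]
    have h : weakGrad Ω (v + w) =ᵐ[volume.restrict Ω] weakGrad Ω v + weakGrad Ω w :=
      weakGrad_ae_eq fun i => ((hv.add hw).isWeakPartial i).ae_eq hΩo hΩb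
        ((hv.isWeakPartial i).add hv.1 hw.1 (hw.isWeakPartial i)) (ae_eq_refl _)
    filter_upwards [(hv.add hw).gradL_pair_ae, hv.gradL_pair_ae, hw.gradL_pair_ae,
      Lp.coeFn_add (gradL Ω hv.pair) (gradL Ω hw.pair), h] with x h1 h2 h3 h4 h5
    rw [h1, h4, h5, Pi.add_apply, Pi.add_apply, h2, h3]

theorem MemH1.pair_smul (hΩo : IsOpen Ω) (hΩb : Bornology.IsBounded Ω) {v : Space d → ℝ}
    (hv : MemH1 Ω v) (c : ℝ) : (hv.smul c).pair = c • hv.pair := by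
  refine L2Pair.ext_ae ?_ ?_
  · rw [map_smul]
    filter_upwards [(hv.smul c).funL_pair_ae, hv.funL_pair_ae,
      Lp.coeFn_smul c (funL Ω hv.pair)] with x h1 h2 h4
    rw [h1, h4, Pi.smul_apply, Pi.smul_apply, h2]
  · rw [map_smul]
    have h : weakGrad Ω (c • v) =ᵐ[volume.restrict Ω] c • weakGrad Ω v :=
      weakGrad_ae_eq fun i => ((hv.smul c).isWeakPartial i).ae_eq hΩo hΩb
        ((hv.isWeakPartial i).smul c) (ae_eq_refl _)
    filter_upwards [(hv.smul c).gradL_pair_ae, hv.gradL_pair_ae,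
      Lp.coeFn_smul c (gradL Ω hv.pair), h] with x h1 h2 h4 h5
    rw [h1, h4, h5, Pi.smul_apply, Pi.smul_apply, h2]

theorem MemH1.norm_sq_pair_sub {v φ : Space d → ℝ} (hv : MemH1 Ω v) (hφ : IsTestFunction Ω φ) :
    ‖hv.pair - mkPair hφ.memL2 hφ.memLp_classicalGrad‖ ^ 2 = (∫ x in Ω, (v x - φ x) ^ 2) +
      ∑ i, ∫ x in Ω, (weakPartial Ω i v x - classicalPartial i φ x) ^ 2 := by
  rw [norm_sq_L2Pair, map_sub, map_sub, norm_sq_Lp_eq (v := fun x => v x - φ x),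
    norm_sq_Lp_vec_eq (v := fun x => weakGrad Ω v x - classicalGrad φ x)]
  · rfl
  · filter_upwards [Lp.coeFn_sub (gradL Ω hv.pair)
      (gradL Ω (mkPair hφ.memL2 hφ.memLp_classicalGrad)), hv.gradL_pair_ae,
      gradL_mkPair_ae hφ.memL2 hφ.memLp_classicalGrad] with x h1 h2 h3
    rw [h1, Pi.sub_apply, h2, h3]
  · filter_upwards [Lp.coeFn_sub (funL Ω hv.pair)
      (funL Ω (mkPair hφ.memL2 hφ.memLp_classicalGrad)), hv.funL_pair_ae,
      funL_mkPair_ae hφ.memL2 hφ.memLp_classicalGrad] with x h1 h2 h3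
    rw [h1, Pi.sub_apply, h2, h3]

/-- The quantity made small in `MemH10` is the squared distance of pairs, so both sides express
approximability by test pairs, up to replacing `ε` by its square or square root. -/
theorem MemH1.memH10_iff {v : Space d → ℝ} (hv : MemH1 Ω v) :
    MemH10 Ω v ↔ hv.pair ∈ H10Space Ω := by
  constructor
  · rintro ⟨-, h⟩
    refine Metric.mem_closure_iff.mpr fun ε hε => ?_
    obtain ⟨φ, hφ, hlt⟩ := h (ε ^ 2) (by positivity)
    refine ⟨_, ⟨φ, hφ, rfl⟩, ?_⟩
    rw [← hv.norm_sq_pair_sub hφ] at hlt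
    rw [dist_eq_norm]
    exact lt_of_pow_lt_pow_left₀ 2 hε.le hlt
  · intro h
    refine ⟨hv, fun ε hε => ?_⟩
    obtain ⟨_, ⟨φ, hφ, rfl⟩, hlt⟩ := Metric.mem_closure_iff.mp h (√ε) (Real.sqrt_pos.mpr hε)
    refine ⟨φ, hφ, ?_⟩
    rw [← hv.norm_sq_pair_sub hφ, ← dist_eq_norm]
    calc _ < √ε ^ 2 := by gcongr
      _ = ε := Real.sq_sqrt hε.le

theorem MemH10.pair_mem {v : Space d → ℝ} (hv : MemH10 Ω v) : hv.1.pair ∈ H10Space Ω :=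
  hv.1.memH10_iff.mp hv

/-- The pair `(v, ∇v)` as an element of `H¹₀`. -/
def MemH10.toH10 {v : Space d → ℝ} (hv : MemH10 Ω v) : H10Space Ω :=
  ⟨hv.1.pair, hv.pair_mem⟩

theorem MemH10.add (hΩo : IsOpen Ω) (hΩb : Bornology.IsBounded Ω) {v w : Space d → ℝ}
    (hv : MemH10 Ω v) (hw : MemH10 Ω w) : MemH10 Ω (v + w) := by
  rw [(hv.1.add hw.1).memH10_iff, MemH1.pair_add hΩo hΩb hv.1 hw.1]
  exact (H10Space Ω).add_mem hv.pair_mem hw.pair_mem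

theorem MemH10.smul (hΩo : IsOpen Ω) (hΩb : Bornology.IsBounded Ω) {v : Space d → ℝ}
    (hv : MemH10 Ω v) (c : ℝ) : MemH10 Ω (c • v) := by
  rw [(hv.1.smul c).memH10_iff, MemH1.pair_smul hΩo hΩb hv.1]
  exact (H10Space Ω).smul_mem c hv.pair_mem

/-- `H¹₀(Ω)` as a space of functions. -/
def H10Fun (hΩo : IsOpen Ω) (hΩb : Bornology.IsBounded Ω) : Submodule ℝ (Space d → ℝ) where
  carrier := {v | MemH10 Ω v}
  add_mem' hv hw := MemH10.add hΩo hΩb hv hw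
  zero_mem' := memH10_of_lipschitz hΩo hΩb (f := 0) (L := 0) (LipschitzWith.const 0)
    HasCompactSupport.zero (by simp)
  smul_mem' c _ hv := MemH10.smul hΩo hΩb hv c

theorem H10Fun.memH10 {hΩo : IsOpen Ω} {hΩb : Bornology.IsBounded Ω} (v : H10Fun hΩo hΩb) :
    MemH10 Ω v := v.2

/-- The embedding `v ↦ (v, ∇v)` of `H¹₀(Ω)`. -/
def H10Fun.toPair (hΩo : IsOpen Ω) (hΩb : Bornology.IsBounded Ω) :
    H10Fun hΩo hΩb →ₗ[ℝ] H10Space Ω where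
  toFun v := (H10Fun.memH10 v).toH10
  map_add' v w := Subtype.ext (MemH1.pair_add hΩo hΩb (H10Fun.memH10 v).1 (H10Fun.memH10 w).1)
  map_smul' c v := Subtype.ext (MemH1.pair_smul hΩo hΩb (H10Fun.memH10 v).1 c)

theorem formB_pair {a : Space d → Space d} (ha : MemLp a ⊤ (volume.restrict Ω)) {μ : Space d → ℝ}
    (hμ : MemLp μ ⊤ (volume.restrict Ω)) {v w : Space d → ℝ} (hv : MemH1 Ω v) (hw : MemH1 Ω w) :
    formB ha hμ hv.pair hw.pair = bilin Ω a μ v w := by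
  rw [formB_apply, inner_Lp_eq (advL_ae ha hv.gradL_pair_ae) hw.funL_pair_ae,
    inner_Lp_vec_eq (diffL_ae hμ hv.gradL_pair_ae) hw.gradL_pair_ae]
  simp only [inner_smul_left, conj_trivial]
  rfl

theorem formS_pair {a : Space d → Space d} (ha : MemLp a ⊤ (volume.restrict Ω))
    {v w : Space d → ℝ} (hv : MemH1 Ω v) (hw : MemH1 Ω w) :
    formS ha hv.pair hw.pair = ∫ x in Ω, advect Ω a v x * advect Ω a w x := by
  rw [formS_apply, inner_Lp_eq (advL_ae ha hv.gradL_pair_ae) (advL_ae ha hw.gradL_pair_ae)]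
  rfl

/-! ### Geometry and measure of triangulations -/

theorem isCompact_simplex (K : Finset (Space d)) : IsCompact (simplex K) :=
  K.finite_toSet.isCompact_convexHull (𝕜 := ℝ)

theorem convex_simplex (K : Finset (Space d)) : Convex ℝ (simplex K) :=
  convex_convexHull ℝ _

theorem subset_simplex (K : Finset (Space d)) : (K : Set (Space d)) ⊆ simplex K :=
  subset_convexHull ℝ _

/-- The affine basis formed by the vertices of a nondegenerate simplex. -/
def cellBasis {K : Finset (Space d)} (hc : K.card = d + 1)
    (hi : AffineIndependent ℝ ((↑) : K → Space d)) : AffineBasis K ℝ (Space d) :=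
  ⟨(↑), hi, hi.affineSpan_eq_top_iff_card_eq_finrank_add_one.mpr (by simp [hc])⟩

theorem cellBasis_apply {K : Finset (Space d)} (hc : K.card = d + 1)
    (hi : AffineIndependent ℝ ((↑) : K → Space d)) (v : K) : cellBasis hc hi v = v := rfl

theorem mem_simplex_iff {K : Finset (Space d)} (hc : K.card = d + 1)
    (hi : AffineIndependent ℝ ((↑) : K → Space d)) {x : Space d} :
    x ∈ simplex K ↔ ∀ v, 0 ≤ (cellBasis hc hi).coord v x := by
  have h := (cellBasis hc hi).convexHull_eq_nonneg_coord
  have hr : range (cellBasis hc hi) = (K : Set (Space d)) := by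
    ext y
    simp [cellBasis_apply]
  rw [hr] at h
  change x ∈ convexHull ℝ (K : Set (Space d)) ↔ _
  rw [h]
  rfl

namespace Triangulation

variable (T : Triangulation Ω)

theorem diam_le_meshSize {K : Finset (Space d)} (hK : K ∈ T.cells) :
    Metric.diam (simplex K) ≤ T.meshSize :=
  le_ciSup (f := fun K : T.cells => Metric.diam (simplex (K : Finset (Space d))))
    (Set.finite_range _).bddAbove ⟨K, hK⟩

theorem meshSize_nonneg : 0 ≤ T.meshSize :=
  Real.iSup_nonneg fun _ => Metric.diam_nonneg

theorem dist_le_meshSize {K : Finset (Space d)} (hK : K ∈ T.cells) {x y : Space d}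
    (hx : x ∈ simplex K) (hy : y ∈ simplex K) : dist x y ≤ T.meshSize :=
  (Metric.dist_le_diam_of_mem (isCompact_simplex K).isBounded hx hy).trans (T.diam_le_meshSize hK)

theorem simplex_subset {K : Finset (Space d)} (hK : K ∈ T.cells) : simplex K ⊆ closure Ω := by
  rw [← T.cover]
  exact subset_biUnion_of_mem (u := fun K => simplex K) hK

theorem exists_mem_simplex {x : Space d} (hx : x ∈ closure Ω) : ∃ K ∈ T.cells, x ∈ simplex K := by
  rw [← T.cover] at hx
  simpa using hx

/-- Distinct cells have equally many vertices, so some vertex `v` of `K` is missing from `L`. By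
conformity the intersection lies in the affine span of the remaining vertices of `K`, a proper
subspace and hence null. -/
theorem aedisjoint {K L : Finset (Space d)} (hK : K ∈ T.cells) (hL : L ∈ T.cells) (hne : K ≠ L) :
    AEDisjoint volume (simplex K) (simplex L) := by
  obtain ⟨v, hvK, hvL⟩ : ∃ v ∈ K, v ∉ L := by
    by_contra! h
    exact hne (Finset.eq_of_subset_of_card_le h
      (by rw [T.card_cell K hK, T.card_cell L hL]))
  rw [AEDisjoint, T.conforming K hK L hL]
  set A : AffineSubspace ℝ (Space d) := affineSpan ℝ ((↑) '' (univ \ {(⟨v, hvK⟩ : K)} : Set K))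
  have hv : v ∉ A := (T.indep K hK).notMem_affineSpan_sdiff ⟨v, hvK⟩ univ
  refine measure_mono_null ?_ (Measure.addHaar_affineSubspace volume A fun htop => hv ?_)
  · refine (convexHull_subset_affineSpan _).trans (affineSpan_mono ℝ ?_)
    rintro w ⟨hwK, hwL⟩
    exact ⟨⟨w, hwK⟩, ⟨trivial, fun h => hvL (by
      have : w = v := congrArg Subtype.val h
      exact this ▸ hwL)⟩, rfl⟩
  · rw [htop]; trivial

/-- Almost every point of `closure Ω` is interior to a cell. -/
theorem ae_mem_interior : ∀ᵐ x ∂(volume.restrict (closure Ω)),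
    ∃ K ∈ T.cells, x ∈ interior (simplex K) := by
  -- The frontier of a convex set is null, and there are finitely many cells.
  have hnull : volume (⋃ K ∈ T.cells, frontier (simplex K)) = 0 :=
    (measure_biUnion_null_iff T.cells.countable_toSet).mpr fun K _ =>
      (convex_simplex K).addHaar_frontier volume
  rw [ae_restrict_iff' isClosed_closure.measurableSet]
  filter_upwards [compl_mem_ae_iff.mpr hnull] with x hx hxc
  obtain ⟨K, hK, hxK⟩ := T.exists_mem_simplex hxc
  refine ⟨K, hK, by_contra fun hxi => hx ?_⟩
  exact mem_biUnion hK ⟨subset_closure hxK, hxi⟩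

/-- A point interior to a cell is interior to `closure Ω`, hence in `Ω`. The existence of a
triangulation thus forces the boundary of `Ω` to be null. -/
theorem closure_ae_eq (T : Triangulation Ω) (hΩr : interior (closure Ω) = Ω) : closure Ω =ᵐ[volume] Ω := by
  refine Filter.EventuallyLE.antisymm ?_ (Filter.Eventually.of_forall fun x hx => subset_closure hx)
  have h := T.ae_mem_interior
  rw [ae_restrict_iff' isClosed_closure.measurableSet] at h
  filter_upwards [h] with x hx hxc
  obtain ⟨K, hK, hxK⟩ := hx hxc
  have := interior_mono (T.simplex_subset hK) hxK
  rwa [hΩr] at this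

/-- The stabilisation form with a constant parameter is an integral over `Ω`. -/
theorem stab_const (hΩr : interior (closure Ω) = Ω) (τ : ℝ) {α β : Space d → ℝ}
    (hα : MemL2 Ω α) (hβ : MemL2 Ω β) :
    T.stab (fun _ => τ) α β = τ * ∫ x in Ω, α x * β x := by
  have hint : IntegrableOn (fun x => α x * β x) (⋃ K : T.cells, simplex (K : Finset (Space d))) := by
    have : ⋃ K : T.cells, simplex (K : Finset (Space d)) = closure Ω := by
      rw [← T.cover, iUnion_subtype]
    rw [this, IntegrableOn, Measure.restrict_congr_set (T.closure_ae_eq hΩr)]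
    exact hα.integrable_mul hβ
  have h := integral_iUnion_ae (μ := volume)
    (fun K : T.cells => (isCompact_simplex (K : Finset (Space d))).measurableSet.nullMeasurableSet)
    (fun K L hne => T.aedisjoint K.2 L.2 fun h => hne (Subtype.ext h)) hint
  rw [tsum_fintype, iUnion_subtype, T.cover,
    Measure.restrict_congr_set (T.closure_ae_eq hΩr)] at h
  rw [stab, ← Finset.mul_sum, h, ← Finset.sum_coe_sort T.cells]

/-! ### The finite element spaces -/

/-- Glue functions given on the cells. -/
def glue (g : Finset (Space d) → Space d → ℝ) (x : Space d) : ℝ :=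
  open Classical in if h : ∃ K ∈ T.cells, x ∈ simplex K then g h.choose x else 0

theorem glue_eq {g : Finset (Space d) → Space d → ℝ}
    (hg : ∀ K ∈ T.cells, ∀ L ∈ T.cells, ∀ x ∈ simplex K, x ∈ simplex L → g K x = g L x)
    {K : Finset (Space d)} (hK : K ∈ T.cells) {x : Space d} (hx : x ∈ simplex K) :
    T.glue g x = g K x := by
  have h : ∃ K ∈ T.cells, x ∈ simplex K := ⟨K, hK, hx⟩
  rw [glue, dif_pos h]
  exact hg _ h.choose_spec.1 K hK x h.choose_spec.2 hx

theorem glue_eq_zero (g : Finset (Space d) → Space d → ℝ) {x : Space d} (hx : x ∉ closure Ω) :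
    T.glue g x = 0 := by
  rw [glue, dif_neg]
  rintro ⟨K, hK, hxK⟩
  exact hx (T.simplex_subset hK hxK)

theorem continuousOn_of_isPolyOn {v : Space d → ℝ} {l : ℕ}
    (hv : ∀ K ∈ T.cells, IsPolyOn l (simplex K) v) : ContinuousOn v (closure Ω) := by
  have hcov : closure Ω = ⋃ K : T.cells, simplex (K : Finset (Space d)) := by
    rw [← T.cover, iUnion_subtype]
  rw [hcov]
  refine (locallyFinite_of_finite _).continuousOn_iUnion
    (fun K => (isCompact_simplex (K : Finset (Space d))).isClosed) fun K => ?_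
  obtain ⟨p, -, hp⟩ := hv K K.2
  refine ContinuousOn.congr (f := fun x : Space d => MvPolynomial.eval (fun i => x i) p) ?_ hp
  have : Continuous fun x : Space d => MvPolynomial.eval (fun i => x i) p :=
    (MvPolynomial.continuous_eval p).comp (by fun_prop)
  exact this.continuousOn

theorem glue_mem_lagrangeSpace {g : Finset (Space d) → Space d → ℝ}
    (hg : ∀ K ∈ T.cells, ∀ L ∈ T.cells, ∀ x ∈ simplex K, x ∈ simplex L → g K x = g L x) {l : ℕ}
    (hp : ∀ K ∈ T.cells, IsPolyOn l (simplex K) (g K)) : T.glue g ∈ T.lagrangeSpace l := by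
  have hpoly : ∀ K ∈ T.cells, IsPolyOn l (simplex K) (T.glue g) := by
    intro K hK
    obtain ⟨p, hpd, hpe⟩ := hp K hK
    exact ⟨p, hpd, fun x hx => by rw [T.glue_eq hg hK hx, hpe x hx]⟩
  exact ⟨T.continuousOn_of_isPolyOn hpoly, hpoly, fun x hx => T.glue_eq_zero g hx⟩

/-- The Lagrange space as a submodule. -/
def lagrangeSubmodule (l : ℕ) : Submodule ℝ (Space d → ℝ) where
  carrier := T.lagrangeSpace l
  add_mem' := by
    rintro v w ⟨hv₁, hv₂, hv₃⟩ ⟨hw₁, hw₂, hw₃⟩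
    refine ⟨hv₁.add hw₁, fun K hK => ?_, fun x hx => by simp [hv₃ x hx, hw₃ x hx]⟩
    obtain ⟨p, hp, hpe⟩ := hv₂ K hK
    obtain ⟨q, hq, hqe⟩ := hw₂ K hK
    exact ⟨p + q, (MvPolynomial.totalDegree_add p q).trans (max_le hp hq),
      fun x hx => by simp [hpe x hx, hqe x hx]⟩
  zero_mem' := ⟨continuousOn_const, fun K _ => ⟨0, by simp, by simp⟩, by simp⟩
  smul_mem' := by
    rintro c v ⟨hv₁, hv₂, hv₃⟩
    refine ⟨hv₁.const_smul c, fun K hK => ?_, fun x hx => by simp [hv₃ x hx]⟩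
    obtain ⟨p, hp, hpe⟩ := hv₂ K hK
    exact ⟨c • p, (MvPolynomial.totalDegree_smul_le c p).trans hp,
      fun x hx => by simp [hpe x hx, MvPolynomial.smul_eval]⟩

/-- The space lies in the range of a linear map from families of polynomials, one per cell. The cell
used at a point does not depend on the family, which keeps the map linear. Finite dimension supplies
the completeness needed for Lax–Milgram. -/
instance finiteDimensional_lagrangeSubmodule (l : ℕ) :
    FiniteDimensional ℝ (T.lagrangeSubmodule l) := by
  classical
  let Φ : (T.cells → MvPolynomial.restrictTotalDegree (Fin d) ℝ l) →ₗ[ℝ] (Space d → ℝ) :=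
    { toFun := fun p x => if h : ∃ K : T.cells, x ∈ simplex (K : Finset (Space d)) then
        MvPolynomial.eval (fun i => x i) (p h.choose : MvPolynomial (Fin d) ℝ) else 0
      map_add' := fun p q => by
        ext x
        simp only [Pi.add_apply]
        split_ifs <;> simp
      map_smul' := fun c p => by
        ext x
        simp only [Pi.smul_apply, RingHom.id_apply]
        split_ifs <;> simp [MvPolynomial.smul_eval] }
  refine Submodule.finiteDimensional_of_le (S₂ := LinearMap.range Φ) ?_
  rintro v ⟨-, hv₂, hv₃⟩
  choose p hp hpe using fun K : T.cells => hv₂ K K.2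
  refine ⟨fun K => ⟨p K, (MvPolynomial.mem_restrictTotalDegree _ _ _).mpr (hp K)⟩, ?_⟩
  ext x
  simp only [Φ, LinearMap.coe_mk, AddHom.coe_mk]
  split_ifs with h
  · exact (hpe _ x h.choose_spec).symm
  · refine (hv₃ x fun hx => h ?_).symm
    obtain ⟨K, hK, hxK⟩ := T.exists_mem_simplex hx
    exact ⟨⟨K, hK⟩, hxK⟩

/-- The image of the discrete space in `H¹₀`. -/
def discretePairs (hΩo : IsOpen Ω) (hΩb : Bornology.IsBounded Ω) (l : ℕ) :
    Submodule ℝ (H10Space Ω) :=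
  LinearMap.range ((H10Fun.toPair hΩo hΩb).comp
    (Submodule.inclusion (inf_le_right : T.lagrangeSubmodule l ⊓ H10Fun hΩo hΩb ≤ H10Fun hΩo hΩb)))

instance (hΩo : IsOpen Ω) (hΩb : Bornology.IsBounded Ω) (l : ℕ) :
    FiniteDimensional ℝ (T.discretePairs hΩo hΩb l) :=
  LinearMap.finiteDimensional_range _

theorem mem_discretePairs (hΩo : IsOpen Ω) (hΩb : Bornology.IsBounded Ω) {l : ℕ}
    {e : H10Space Ω} : e ∈ T.discretePairs hΩo hΩb l ↔
      ∃ v, ∃ hv : v ∈ T.discreteSpace l, e = hv.2.toH10 := by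
  constructor
  · rintro ⟨⟨v, hv⟩, rfl⟩
    exact ⟨v, hv, rfl⟩
  · rintro ⟨v, hv, rfl⟩
    exact ⟨⟨v, hv⟩, rfl⟩

end Triangulation

/-! ### Polynomial functions -/

theorem IsPolyOn.const {l : ℕ} {S : Set (Space d)} (c : ℝ) : IsPolyOn l S (fun _ => c) :=
  ⟨MvPolynomial.C c, by simp, by simp⟩

theorem IsPolyOn.mono {k l : ℕ} {S S' : Set (Space d)} {f : Space d → ℝ} (hf : IsPolyOn k S f)
    (hkl : k ≤ l) (hS : S' ⊆ S) : IsPolyOn l S' f := by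
  obtain ⟨p, hp, hpe⟩ := hf
  exact ⟨p, hp.trans hkl, fun x hx => hpe x (hS hx)⟩

theorem IsPolyOn.mul {k l : ℕ} {S : Set (Space d)} {f g : Space d → ℝ} (hf : IsPolyOn k S f)
    (hg : IsPolyOn l S g) : IsPolyOn (k + l) S (fun x => f x * g x) := by
  obtain ⟨p, hp, hpe⟩ := hf
  obtain ⟨q, hq, hqe⟩ := hg
  exact ⟨p * q, (MvPolynomial.totalDegree_mul p q).trans (add_le_add hp hq),
    fun x hx => by simp only [hpe x hx, hqe x hx, map_mul]⟩

theorem IsPolyOn.add {l : ℕ} {S : Set (Space d)} {f g : Space d → ℝ} (hf : IsPolyOn l S f)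
    (hg : IsPolyOn l S g) : IsPolyOn l S (fun x => f x + g x) := by
  obtain ⟨p, hp, hpe⟩ := hf
  obtain ⟨q, hq, hqe⟩ := hg
  exact ⟨p + q, (MvPolynomial.totalDegree_add p q).trans (max_le hp hq),
    fun x hx => by simp only [hpe x hx, hqe x hx, map_add]⟩

theorem IsPolyOn.const_mul {l : ℕ} {S : Set (Space d)} {f : Space d → ℝ} (hf : IsPolyOn l S f)
    (c : ℝ) : IsPolyOn l S (fun x => c * f x) := by
  simpa using (IsPolyOn.const (l := 0) c).mul hf

theorem IsPolyOn.sum {κ : Type*} (s : Finset κ) {l : ℕ} {S : Set (Space d)}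
    {f : κ → Space d → ℝ} (hf : ∀ k ∈ s, IsPolyOn l S (f k)) :
    IsPolyOn l S (fun x => ∑ k ∈ s, f k x) := by
  classical
  induction s using Finset.induction_on with
  | empty => simpa using IsPolyOn.const 0
  | insert k s hk ih =>
    simp only [Finset.sum_insert hk]
    exact (hf k (Finset.mem_insert_self k s)).add
      (ih fun j hj => hf j (Finset.mem_insert_of_mem hj))

theorem IsPolyOn.prod {κ : Type*} (s : Finset κ) {n : κ → ℕ} {S : Set (Space d)}
    {f : κ → Space d → ℝ} (hf : ∀ k ∈ s, IsPolyOn (n k) S (f k)) :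
    IsPolyOn (∑ k ∈ s, n k) S (fun x => ∏ k ∈ s, f k x) := by
  classical
  induction s using Finset.induction_on with
  | empty => simpa using IsPolyOn.const 1
  | insert k s hk ih =>
    simp only [Finset.sum_insert hk, Finset.prod_insert hk]
    exact (hf k (Finset.mem_insert_self k s)).mul
      (ih fun j hj => hf j (Finset.mem_insert_of_mem hj))

theorem isPolyOn_affineMap (A : Space d →ᵃ[ℝ] ℝ) (S : Set (Space d)) : IsPolyOn 1 S A := by
  have hA : ∀ x, A x = A 0 + ∑ i, A.linear (EuclideanSpace.single i 1) * x i := by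
    intro x
    have hx : x = ∑ i, x i • (EuclideanSpace.single i (1 : ℝ) : Space d) := by
      ext j
      simp [Finset.sum_apply, Pi.single_apply]
    have h1 : A x = A.linear x + A 0 := by
      have := A.map_vadd 0 x
      simpa using this
    rw [h1, add_comm]
    conv_lhs => rw [hx]
    simp [mul_comm]
  have hX : ∀ i, IsPolyOn 1 S (fun x : Space d => x i) := fun i =>
    ⟨MvPolynomial.X i, by simp, by simp⟩
  have : IsPolyOn 1 S fun x => A 0 + ∑ i, A.linear (EuclideanSpace.single i 1) * x i :=
    (IsPolyOn.const _).add (IsPolyOn.sum _ fun i _ => (hX i).const_mul _)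
  simpa only [← hA] using this

/-! ### Barycentric coordinates -/

/-- `K` is the vertex set of a nondegenerate `d`-simplex. -/
structure IsCell (K : Finset (Space d)) : Prop where
  card : K.card = d + 1
  indep : AffineIndependent ℝ ((↑) : K → Space d)

theorem Triangulation.isCell (T : Triangulation Ω) {K : Finset (Space d)} (hK : K ∈ T.cells) :
    IsCell K :=
  ⟨T.card_cell K hK, T.indep K hK⟩

open Classical in
/-- The barycentric coordinate of the vertex `v` of `K`. -/
def bary (K : Finset (Space d)) (v : Space d) : Space d →ᵃ[ℝ] ℝ :=
  if h : IsCell K ∧ v ∈ K then (cellBasis h.1.card h.1.indep).coord ⟨v, h.2⟩ else 0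

variable {K : Finset (Space d)}

theorem IsCell.bary_eq (hK : IsCell K) (v : K) :
    bary K v = (cellBasis hK.card hK.indep).coord v := by
  rw [bary, dif_pos ⟨hK, v.2⟩]

theorem IsCell.bary_combination (hK : IsCell K) {w : Space d → ℝ} (hw : ∑ v ∈ K, w v = 1)
    {v : Space d} (hv : v ∈ K) : bary K v (∑ y ∈ K, w y • y) = w v := by
  have hw' : ∑ y : K, w y = 1 := by rw [← hw, Finset.sum_coe_sort K w]
  have h := (cellBasis hK.card hK.indep).coord_apply_combination_of_mem
    (Finset.mem_univ (⟨v, hv⟩ : K)) (w := fun y : K => w y) hw'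
  rw [Finset.affineCombination_eq_linear_combination _ _ _ hw'] at h
  simp only [cellBasis_apply] at h
  rw [Finset.sum_coe_sort K (fun y => w y • y), ← hK.bary_eq ⟨v, hv⟩] at h
  exact h

theorem IsCell.sum_bary (hK : IsCell K) (x : Space d) : ∑ v ∈ K, bary K v x = 1 := by
  rw [← Finset.sum_coe_sort K (fun v => bary K v x)]
  simp only [hK.bary_eq]
  exact (cellBasis hK.card hK.indep).sum_coord_apply_eq_one x

theorem IsCell.sum_bary_smul (hK : IsCell K) (x : Space d) : ∑ v ∈ K, bary K v x • v = x := by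
  rw [← Finset.sum_coe_sort K (fun v => bary K v x • v)]
  simp only [hK.bary_eq]
  exact (cellBasis hK.card hK.indep).linear_combination_coord_eq_self x

theorem IsCell.bary_nonneg (hK : IsCell K) {x : Space d} (hx : x ∈ simplex K) {v : Space d}
    (hv : v ∈ K) : 0 ≤ bary K v x := by
  rw [hK.bary_eq ⟨v, hv⟩]
  exact (mem_simplex_iff hK.card hK.indep).mp hx ⟨v, hv⟩

theorem IsCell.bary_le_one (hK : IsCell K) {x : Space d} (hx : x ∈ simplex K) {v : Space d}
    (hv : v ∈ K) : bary K v x ≤ 1 := by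
  rw [← hK.sum_bary x]
  exact Finset.single_le_sum (f := fun v => bary K v x) (fun y hy => hK.bary_nonneg hx hy) hv

/-- The barycentric coordinates of a point of a face. -/
theorem IsCell.bary_face (hK : IsCell K) {F : Finset (Space d)} (hF : F ⊆ K) {w : Space d → ℝ}
    (hw : ∑ v ∈ F, w v = 1) (hw0 : ∀ v, v ∉ F → w v = 0) {v : Space d} (hv : v ∈ K) :
    bary K v (∑ y ∈ F, w y • y) = w v := by
  have h1 : ∑ y ∈ F, w y = ∑ y ∈ K, w y :=
    Finset.sum_subset hF fun y _ hy => hw0 y hy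
  have h2 : ∑ y ∈ F, w y • y = ∑ y ∈ K, w y • y :=
    Finset.sum_subset hF fun y _ hy => by rw [hw0 y hy, zero_smul]
  rw [h2]
  exact hK.bary_combination (h1 ▸ hw) hv

/-- Extended by zero, the same weights serve as barycentric coordinates in every cell containing the
face `F`. -/
theorem exists_face_weights {F : Finset (Space d)} {x : Space d}
    (hx : x ∈ convexHull ℝ (F : Set (Space d))) :
    ∃ w : Space d → ℝ, ∑ v ∈ F, w v = 1 ∧ (∀ v, v ∉ F → w v = 0) ∧ ∑ y ∈ F, w y • y = x := by
  classical
  obtain ⟨w, -, hw1, hwx⟩ := Finset.mem_convexHull'.mp hx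
  refine ⟨fun v => if v ∈ F then w v else 0, ?_, fun v hv => by simp [hv], ?_⟩
  · rw [← hw1]
    exact Finset.sum_congr rfl fun v hv => by simp [hv]
  · rw [← hwx]
    exact Finset.sum_congr rfl fun v hv => by simp [hv]

/-! ### The Lagrange basis on a simplex -/

/-- The one-variable factor `∏_{j<n} (l t - j) / (j + 1)`. -/
def shape (l n : ℕ) (t : ℝ) : ℝ := ∏ j ∈ Finset.range n, (((j : ℝ) + 1)⁻¹ * (l * t + -j))

theorem shape_zero_left (l : ℕ) (t : ℝ) : shape l 0 t = 1 := by simp [shape]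

theorem shape_zero_right (l : ℕ) {n : ℕ} (hn : n ≠ 0) : shape l n 0 = 0 :=
  Finset.prod_eq_zero (Finset.mem_range.mpr (Nat.pos_of_ne_zero hn)) (by simp)

theorem shape_node_of_lt {l n k : ℕ} (hl : l ≠ 0) (hk : k < n) : shape l n ((k : ℝ) / l) = 0 := by
  have hl' : (l : ℝ) ≠ 0 := Nat.cast_ne_zero.mpr hl
  refine Finset.prod_eq_zero (Finset.mem_range.mpr hk) ?_
  rw [mul_div_cancel₀ _ hl']
  simp

theorem shape_node_self {l n : ℕ} (hl : l ≠ 0) : shape l n ((n : ℝ) / l) = 1 := by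
  have hl' : (l : ℝ) ≠ 0 := Nat.cast_ne_zero.mpr hl
  -- Reversing the order of the numerators `n - j` gives `j + 1`, matching the denominators one by
  -- one.
  rw [shape, mul_div_cancel₀ _ hl', Finset.prod_mul_distrib, ← Finset.prod_range_reflect
    (fun j : ℕ => (n : ℝ) + -(j : ℝ)), ← Finset.prod_mul_distrib]
  refine Finset.prod_eq_one fun j hj => ?_
  have hj' := Finset.mem_range.mp hj
  have : (n : ℝ) + -((n - 1 - j : ℕ) : ℝ) = j + 1 := by
    rw [Nat.sub_sub, Nat.cast_sub (by omega)]
    push_cast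
    ring
  rw [this]
  have h0 : (j : ℝ) + 1 ≠ 0 := by positivity
  field_simp

theorem abs_shape_le {l n : ℕ} (hn : n ≤ l) {t : ℝ} (ht0 : 0 ≤ t) (ht1 : t ≤ 1) :
    |shape l n t| ≤ (l : ℝ) ^ n := by
  rw [shape, Finset.abs_prod]
  calc _ ≤ ∏ j ∈ Finset.range n, (l : ℝ) := by
        refine Finset.prod_le_prod (fun j _ => abs_nonneg _) fun j hj => ?_
        have hj' : (j : ℝ) ≤ l := by
          exact_mod_cast (Finset.mem_range.mp hj).le.trans hn
        have h0 : (0 : ℝ) ≤ j := Nat.cast_nonneg j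
        have h1 : |(l : ℝ) * t + -j| ≤ l := by
          rw [abs_le]
          constructor <;> nlinarith
        rw [abs_mul, abs_of_nonneg (by positivity)]
        calc _ ≤ 1 * (l : ℝ) := by
              gcongr
              exact inv_le_one_of_one_le₀ (by linarith)
          _ = l := one_mul _
    _ = _ := by simp

/-- The Lagrange basis function of multi-index `m`. -/
def lagrangeBasis (l : ℕ) (K : Finset (Space d)) (m : Space d → ℕ) (x : Space d) : ℝ :=
  ∏ v ∈ K, shape l (m v) (bary K v x)

/-- The node of multi-index `m`. -/
def node (l : ℕ) (K : Finset (Space d)) (m : Space d → ℕ) : Space d :=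
  ∑ v ∈ K, ((m v : ℝ) / (l : ℝ)) • v

open Classical in
/-- The polynomial on `K` taking the value `c m` at the node of multi-index `m`. -/
def localInterp (l : ℕ) (K : Finset (Space d)) (c : (Space d → ℕ) → ℝ) (x : Space d) : ℝ :=
  ∑ m ∈ Finset.piAntidiag K l, c m * lagrangeBasis l K m x

theorem isPolyOn_shape (A : Space d →ᵃ[ℝ] ℝ) (l n : ℕ) (S : Set (Space d)) :
    IsPolyOn n S (fun x => shape l n (A x)) := by
  have h : ∀ j : ℕ, IsPolyOn 1 S (fun x => ((j : ℝ) + 1)⁻¹ * (l * A x + -j)) := fun j =>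
    (((isPolyOn_affineMap A S).const_mul l).add (IsPolyOn.const (-j))).const_mul _
  simpa [shape] using IsPolyOn.prod (Finset.range n) (n := fun _ => 1) fun j _ => h j

/-- Each basis function has one factor of degree `m v` per vertex, and these degrees sum to `l`. -/
theorem isPolyOn_localInterp (l : ℕ) (K : Finset (Space d)) (c : (Space d → ℕ) → ℝ)
    (S : Set (Space d)) : IsPolyOn l S (localInterp l K c) := by
  refine IsPolyOn.sum _ fun m hm => ?_
  have h := IsPolyOn.prod K (n := m) (S := S) fun v _ => isPolyOn_shape (bary K v) l (m v) S
  rw [(Finset.mem_piAntidiag.mp hm).1] at h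
  exact h.const_mul (c m)

theorem sum_div_eq_one {l : ℕ} (hl : l ≠ 0) {m : Space d → ℕ} (hm : ∑ v ∈ K, m v = l) :
    ∑ v ∈ K, (m v : ℝ) / (l : ℝ) = 1 := by
  rw [← Finset.sum_div, ← Nat.cast_sum, hm, div_self (Nat.cast_ne_zero.mpr hl)]

theorem IsCell.bary_node (hK : IsCell K) {l : ℕ} (hl : l ≠ 0) {m : Space d → ℕ}
    (hm : ∑ v ∈ K, m v = l) {v : Space d} (hv : v ∈ K) :
    bary K v (node l K m) = (m v : ℝ) / l :=
  hK.bary_combination (w := fun v => (m v : ℝ) / l) (sum_div_eq_one hl hm) hv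

theorem node_mem_simplex {l : ℕ} (hl : l ≠ 0) {m : Space d → ℕ} (hm : ∑ v ∈ K, m v = l) :
    node l K m ∈ simplex K :=
  (convex_simplex K).sum_mem (fun _ _ => by positivity) (sum_div_eq_one hl hm)
    fun _ hv => subset_simplex K hv

-- Two distinct multi-indices of equal sum satisfy `k v < m v` at some vertex, and there the factor
-- of `m` vanishes at the node of `k`.
open Classical in
theorem IsCell.lagrangeBasis_node (hK : IsCell K) {l : ℕ} (hl : l ≠ 0) {m k : Space d → ℕ}
    (hm : m ∈ Finset.piAntidiag K l) (hk : k ∈ Finset.piAntidiag K l) :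
    lagrangeBasis l K m (node l K k) = if m = k then 1 else 0 := by
  obtain ⟨hm1, hm2⟩ := Finset.mem_piAntidiag.mp hm
  obtain ⟨hk1, hk2⟩ := Finset.mem_piAntidiag.mp hk
  rw [lagrangeBasis]
  split_ifs with h
  · subst h
    exact Finset.prod_eq_one fun v hv => by rw [hK.bary_node hl hm1 hv, shape_node_self hl]
  · obtain ⟨v, hv, hlt⟩ : ∃ v ∈ K, k v < m v := by
      by_contra! hle
      have heq := (Finset.sum_eq_sum_iff_of_le hle).mp (hm1.trans hk1.symm)
      refine h (funext fun v => ?_)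
      by_cases hv : v ∈ K
      · exact heq v hv
      · rw [not_imp_comm.mp (hm2 v) hv, not_imp_comm.mp (hk2 v) hv]
    exact Finset.prod_eq_zero hv (by rw [hK.bary_node hl hk1 hv, shape_node_of_lt hl hlt])

open Classical in
theorem IsCell.localInterp_node (hK : IsCell K) {l : ℕ} (hl : l ≠ 0) (c : (Space d → ℕ) → ℝ)
    {k : Space d → ℕ} (hk : k ∈ Finset.piAntidiag K l) : localInterp l K c (node l K k) = c k := by
  rw [localInterp, Finset.sum_congr rfl fun m hm => by rw [hK.lagrangeBasis_node hl hm hk]]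
  simp [hk]

/-- On a face the interpolant depends only on the face. -/
theorem IsCell.localInterp_face (hK : IsCell K) (l : ℕ) (u : Space d → ℝ)
    {F : Finset (Space d)} (hF : F ⊆ K) {w : Space d → ℝ} (hw : ∑ v ∈ F, w v = 1)
    (hw0 : ∀ v, v ∉ F → w v = 0) :
    localInterp l K (fun m => u (node l K m)) (∑ y ∈ F, w y • y) =
      open Classical in ∑ m ∈ Finset.piAntidiag F l,
        u (node l F m) * ∏ v ∈ F, shape l (m v) (w v) := by
  classical
  have hb : ∀ m, lagrangeBasis l K m (∑ y ∈ F, w y • y) = ∏ v ∈ K, shape l (m v) (w v) := fun m =>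
    Finset.prod_congr rfl fun v hv => by rw [hK.bary_face hF hw hw0 hv]
  have hsub : Finset.piAntidiag F l ⊆ Finset.piAntidiag K l := by
    intro m hm
    obtain ⟨hm1, hm2⟩ := Finset.mem_piAntidiag.mp hm
    refine Finset.mem_piAntidiag.mpr ⟨?_, fun v hv => hF (hm2 v hv)⟩
    rw [← hm1]
    exact (Finset.sum_subset hF fun v _ hv => not_imp_comm.mp (hm2 v) hv).symm
  rw [localInterp]
  refine Eq.trans (Eq.symm (Finset.sum_subset hsub fun m hmK hmF => ?_))
    (Finset.sum_congr rfl fun m hm => ?_)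
  -- A multi-index charging a vertex off the face has a factor `shape l (m v) 0` with `m v ≠ 0`, so
  -- its basis function vanishes on the face.
  · obtain ⟨hm1, hm2⟩ := Finset.mem_piAntidiag.mp hmK
    have : ∃ v ∈ K, v ∉ F ∧ m v ≠ 0 := by
      by_contra! hno
      refine hmF (Finset.mem_piAntidiag.mpr ⟨?_, fun v hv => ?_⟩)
      · rw [← hm1]
        exact Finset.sum_subset hF hno
      · by_contra hvF
        exact hv (hno v (hm2 v hv) hvF)
    obtain ⟨v, hvK, hvF, hmv⟩ := this
    rw [hb, Finset.prod_eq_zero hvK (by rw [hw0 v hvF, shape_zero_right l hmv]), mul_zero]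
  · obtain ⟨hm1, hm2⟩ := Finset.mem_piAntidiag.mp hm
    have hm0 : ∀ v, v ∉ F → m v = 0 := fun v hv => not_imp_comm.mp (hm2 v) hv
    rw [hb, node, node, Finset.sum_subset hF fun v _ hv => by rw [hm0 v hv]; simp,
      Finset.prod_subset hF fun v _ hv => by rw [hm0 v hv, shape_zero_left]]

/-! ### Unisolvence and stability of Lagrange interpolation -/

-- An exponent of total degree at most `l` in `d` variables becomes a multi-index of sum exactly `l`
-- on `d + 1` vertices once the slack `l - |s|` is recorded at an extra vertex.
open Classical in
theorem IsCell.card_le_card_piAntidiag (hK : IsCell K) (l : ℕ) :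
    Module.finrank ℝ (MvPolynomial.restrictTotalDegree (Fin d) ℝ l) ≤
      (Finset.piAntidiag K l).card := by
  let e : K ≃ Fin (d + 1) := K.equivFinOfCardEq hK.card
  let S : Set (Fin d →₀ ℕ) := {s | (s.sum fun _ k => k) ≤ l}
  let F : S → Finset.piAntidiag K l := fun s =>
    ⟨fun v => if h : v ∈ K then
        Fin.cases (motive := fun _ => ℕ) (l - (s : Fin d →₀ ℕ).sum fun _ k => k)
          (fun i => (s : Fin d →₀ ℕ) i) (e ⟨v, h⟩)
      else 0, by
      refine Finset.mem_piAntidiag.mpr ⟨?_, fun v hv => by by_contra h; simp [h] at hv⟩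
      rw [← Finset.sum_coe_sort K]
      simp only [Finset.coe_mem, dite_true, Subtype.coe_eta]
      rw [Equiv.sum_comp e (fun j => Fin.cases (motive := fun _ => ℕ)
        (l - (s : Fin d →₀ ℕ).sum fun _ k => k) (fun i => (s : Fin d →₀ ℕ) i) j),
        Fin.sum_univ_succ]
      simp only [Fin.cases_zero, Fin.cases_succ]
      have h1 : ((s : Fin d →₀ ℕ).sum fun _ k => k) = ∑ i, (s : Fin d →₀ ℕ) i :=
        Finsupp.sum_fintype _ _ (fun _ => rfl)
      have h2 : ((s : Fin d →₀ ℕ).sum fun _ k => k) ≤ l := s.2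
      rw [← h1]
      omega⟩
  have hF : Function.Injective F := by
    intro s t hst
    refine Subtype.ext (Finsupp.ext fun i => ?_)
    have h := congrFun (congrArg Subtype.val hst) (e.symm i.succ : Space d)
    simpa [F] using h
  have hfin : Finite S := Finite.of_injective F hF
  have hcard := Nat.card_le_card_of_injective F hF
  rw [Nat.card_eq_fintype_card (α := Finset.piAntidiag K l), Fintype.card_coe] at hcard
  have hb := Module.finrank_eq_nat_card_basis (MvPolynomial.basisRestrictSupport ℝ S)
  exact hb.trans_le hcard

open Classical in
/-- A polynomial of degree at most `l` is the interpolant of its nodal values. -/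
theorem IsCell.eval_eq_localInterp (hK : IsCell K) {l : ℕ} (hl : l ≠ 0)
    {p : MvPolynomial (Fin d) ℝ} (hp : p.totalDegree ≤ l) (x : Space d) :
    MvPolynomial.eval (fun i => x i) p = localInterp l K
      (fun m => MvPolynomial.eval (fun i => node l K m i) p) x := by
  let ev : MvPolynomial.restrictTotalDegree (Fin d) ℝ l →ₗ[ℝ] (Finset.piAntidiag K l → ℝ) :=
    { toFun := fun q m => MvPolynomial.eval (fun i => node l K m i) (q : MvPolynomial (Fin d) ℝ)
      map_add' := fun q r => by ext m; simp
      map_smul' := fun c q => by ext m; simp [MvPolynomial.smul_eval] }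
  -- The Lagrange basis realises all nodal values; since the dimension is at most the number of
  -- nodes, evaluation at the nodes is also injective.
  have hsurj : Function.Surjective ev := by
    intro y
    obtain ⟨q, hq, hqe⟩ := isPolyOn_localInterp l K
      (fun m => if h : m ∈ Finset.piAntidiag K l then y ⟨m, h⟩ else 0) univ
    refine ⟨⟨q, (MvPolynomial.mem_restrictTotalDegree _ _ _).mpr hq⟩, ?_⟩
    ext m
    change MvPolynomial.eval (fun i => node l K m i) q = y m
    rw [← hqe _ trivial, hK.localInterp_node hl _ m.2]
    simp
  have hinj : Function.Injective ev := by
    refine (LinearMap.injective_iff_surjective_of_finrank_eq_finrank (le_antisymm ?_ ?_)).mpr hsurj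
    · rw [Module.finrank_fintype_fun_eq_card, Fintype.card_coe]
      exact hK.card_le_card_piAntidiag l
    · exact LinearMap.finrank_le_finrank_of_surjective hsurj
  obtain ⟨q, hq, hqe⟩ := isPolyOn_localInterp l K
    (fun m => MvPolynomial.eval (fun i => node l K m i) p) univ
  have hpq : (⟨p, (MvPolynomial.mem_restrictTotalDegree _ _ _).mpr hp⟩ :
      MvPolynomial.restrictTotalDegree (Fin d) ℝ l) =
      ⟨q, (MvPolynomial.mem_restrictTotalDegree _ _ _).mpr hq⟩ := by
    apply hinj
    ext m
    change MvPolynomial.eval (fun i => node l K m i) p = MvPolynomial.eval (fun i => node l K m i) q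
    rw [← hqe _ trivial, hK.localInterp_node hl _ m.2]
  rw [hqe x trivial, show p = q from congrArg Subtype.val hpq]

theorem IsCell.abs_lagrangeBasis_le (hK : IsCell K) {l : ℕ} {m : Space d → ℕ}
    (hm : ∑ v ∈ K, m v = l) {x : Space d} (hx : x ∈ simplex K) :
    |lagrangeBasis l K m x| ≤ (l : ℝ) ^ l := by
  rw [lagrangeBasis, Finset.abs_prod]
  calc _ ≤ ∏ v ∈ K, (l : ℝ) ^ m v := by
        refine Finset.prod_le_prod (fun v _ => abs_nonneg _) fun v hv => ?_
        refine abs_shape_le ?_ (hK.bary_nonneg hx hv) (hK.bary_le_one hx hv)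
        rw [← hm]
        exact Finset.single_le_sum (fun _ _ => Nat.zero_le _) hv
    _ = (l : ℝ) ^ l := by rw [Finset.prod_pow_eq_pow_sum, hm]

open Classical in
theorem IsCell.card_piAntidiag (hK : IsCell K) (l : ℕ) :
    (Finset.piAntidiag K l).card = Nat.multichoose (d + 1) l := by
  rw [← hK.card, ← Finset.card_finsuppAntidiag_nat_eq_multichoose, Finset.finsuppAntidiag,
    Finset.card_map, Finset.card_attach]

/-- Stability of Lagrange interpolation: a polynomial that is close to a constant at the nodes is
close to it on the simplex. -/
theorem IsCell.abs_sub_le (hK : IsCell K) {l : ℕ} (hl : l ≠ 0) {f : Space d → ℝ}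
    (hf : IsPolyOn l (simplex K) f) {c ε : ℝ}
    (hc : ∀ x ∈ lagrangeNodes l K, |f x - c| ≤ ε) {x : Space d} (hx : x ∈ simplex K) :
    |f x - c| ≤ (Nat.multichoose (d + 1) l * (l : ℝ) ^ l) * ε := by
  classical
  obtain ⟨p, hp, hpe⟩ := hf
  -- `f - c` is still of degree at most `l`, so it is the sum of its nodal values times basis
  -- functions. There are `multichoose (d + 1) l` of these, each bounded by `l ^ l`.
  have hq : (p + MvPolynomial.C (-c)).totalDegree ≤ l :=
    (MvPolynomial.totalDegree_add _ _).trans (max_le hp (by simp))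
  have h := hK.eval_eq_localInterp hl hq x
  have hfx : f x - c = MvPolynomial.eval (fun i => x i) (p + MvPolynomial.C (-c)) := by
    rw [hpe x hx]; simp [sub_eq_add_neg]
  rw [hfx, h, localInterp]
  refine (Finset.abs_sum_le_sum_abs _ _).trans ?_
  calc _ ≤ ∑ m ∈ Finset.piAntidiag K l, (l : ℝ) ^ l * ε := by
        refine Finset.sum_le_sum fun m hm => ?_
        obtain ⟨hm1, -⟩ := Finset.mem_piAntidiag.mp hm
        have hmn : node l K m ∈ lagrangeNodes l K := ⟨m, hm1, rfl⟩
        have h1 := hc _ hmn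
        rw [hpe _ (node_mem_simplex hl hm1)] at h1
        rw [abs_mul, mul_comm]
        refine mul_le_mul (hK.abs_lagrangeBasis_le hm1 hx) ?_ (abs_nonneg _) (by positivity)
        simpa [sub_eq_add_neg] using h1
    _ = _ := by rw [Finset.sum_const, hK.card_piAntidiag, nsmul_eq_mul]; ring

namespace Triangulation

variable (T : Triangulation Ω)

/-- Conformity places `x` in the hull of the common vertices, where the interpolant depends only on
the data of that common face. -/
theorem localInterp_compatible (l : ℕ) (u : Space d → ℝ) {K L : Finset (Space d)}
    (hK : K ∈ T.cells) (hL : L ∈ T.cells) {x : Space d} (hxK : x ∈ simplex K)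
    (hxL : x ∈ simplex L) : localInterp l K (fun m => u (node l K m)) x =
      localInterp l L (fun m => u (node l L m)) x := by
  classical
  have hx : x ∈ convexHull ℝ ((K ∩ L : Finset (Space d)) : Set (Space d)) := by
    rw [Finset.coe_inter, ← T.conforming K hK L hL]
    exact ⟨hxK, hxL⟩
  obtain ⟨w, hw1, hw0, rfl⟩ := exists_face_weights hx
  rw [(T.isCell hK).localInterp_face l u Finset.inter_subset_left hw1 hw0,
    (T.isCell hL).localInterp_face l u Finset.inter_subset_right hw1 hw0]

theorem exists_isInterpolant {l : ℕ} (hl : l ≠ 0) (u : Space d → ℝ) :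
    ∃ p, T.IsInterpolant l u p := by
  classical
  have hg : ∀ K ∈ T.cells, ∀ L ∈ T.cells, ∀ x ∈ simplex K, x ∈ simplex L →
      localInterp l K (fun m => u (node l K m)) x = localInterp l L (fun m => u (node l L m)) x :=
    fun K hK L hL x hxK hxL => T.localInterp_compatible l u hK hL hxK hxL
  refine ⟨T.glue fun K => localInterp l K (fun m => u (node l K m)),
    T.glue_mem_lagrangeSpace hg fun K _ => isPolyOn_localInterp _ _ _ _, ?_⟩
  rintro K hK x ⟨m, hm, rfl⟩
  change T.glue _ (node l K m) = u (node l K m)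
  rw [T.glue_eq hg hK (node_mem_simplex hl hm)]
  -- The multi-index in `lagrangeNodes` is arbitrary off `K`; truncating it there leaves the node
  -- unchanged and makes it an index of the basis.
  have hnode : node l K m = node l K (fun v => if v ∈ K then m v else 0) :=
    Finset.sum_congr rfl fun v hv => by simp [hv]
  rw [hnode]
  refine (T.isCell hK).localInterp_node hl _ (Finset.mem_piAntidiag.mpr ⟨?_, fun v hv => ?_⟩)
  · rw [← hm]
    exact Finset.sum_congr rfl fun v hv => by simp [hv]
  · by_contra h
    simp [h] at hv

theorem isInterpolant_interpolate {l : ℕ} (hl : l ≠ 0) (u : Space d → ℝ) :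
    T.IsInterpolant l u (T.interpolate l u) := by
  have h := T.exists_isInterpolant hl u
  rw [interpolate, dif_pos h]
  exact h.choose_spec

/-- On the cell of `x`, the interpolate is compared with the constant `u x`: all nodes are within
the mesh size of `x`, so the oscillation of `u` controls the error. -/
theorem abs_interpolate_sub_le {l : ℕ} (hl : l ≠ 0) {u : Space d → ℝ} {ε : ℝ}
    (hu : ∀ x ∈ closure Ω, ∀ y ∈ closure Ω, dist x y ≤ T.meshSize → |u x - u y| ≤ ε)
    {x : Space d} (hx : x ∈ closure Ω) :
    |T.interpolate l u x - u x| ≤ (Nat.multichoose (d + 1) l * (l : ℝ) ^ l) * ε := by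
  obtain ⟨K, hK, hxK⟩ := T.exists_mem_simplex hx
  have hI := T.isInterpolant_interpolate hl u
  refine (T.isCell hK).abs_sub_le hl (hI.1.2.1 K hK) (fun y hy => ?_) hxK
  rw [hI.2 K hK y hy]
  obtain ⟨m, hm, rfl⟩ := hy
  have hyK := node_mem_simplex (K := K) hl hm
  exact hu _ (T.simplex_subset hK hyK) _ hx (T.dist_le_meshSize hK hyK hxK)

/-- Uniform convergence of the Lagrange interpolates of a continuous function. -/
theorem exists_abs_interpolate_sub_le (hΩb : Bornology.IsBounded Ω) {l : ℕ} (hl : l ≠ 0)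
    {u : Space d → ℝ} (hu : ContinuousOn u (closure Ω)) {ε : ℝ} (hε : 0 < ε) :
    ∃ δ > 0, ∀ T : Triangulation Ω, T.meshSize < δ → ∀ x ∈ closure Ω,
      |T.interpolate l u x - u x| ≤ ε := by
  set C : ℝ := Nat.multichoose (d + 1) l * (l : ℝ) ^ l with hC
  have hC0 : 0 ≤ C := by positivity
  obtain ⟨δ, hδ, h⟩ := Metric.uniformContinuousOn_iff.mp
    (hΩb.isCompact_closure.uniformContinuousOn_of_continuous hu) (ε / (C + 1)) (by positivity)
  refine ⟨δ, hδ, fun T hT x hx => ?_⟩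
  refine (T.abs_interpolate_sub_le hl (ε := ε / (C + 1)) (fun y hy z hz hyz => ?_) hx).trans ?_
  · exact (h y hy z hz (hyz.trans_lt hT)).le
  · rw [← hC, mul_div_assoc', div_le_iff₀ (by positivity)]
    nlinarith

end Triangulation

/-! ### Piecewise affine interpolation of test functions -/

/-- The affine function on a cell with the nodal values of `φ`. -/
def affineInterp (φ : Space d → ℝ) (K : Finset (Space d)) : Space d →ᵃ[ℝ] ℝ :=
  ∑ v ∈ K, φ v • bary K v

theorem affineInterp_apply (φ : Space d → ℝ) (K : Finset (Space d)) (x : Space d) :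
    affineInterp φ K x = ∑ v ∈ K, φ v * bary K v x := by
  have h : ∀ s : Finset (Space d), (∑ v ∈ s, φ v • bary K v) x = ∑ v ∈ s, φ v * bary K v x := by
    intro s
    induction s using Finset.cons_induction with
    | empty => rfl
    | cons v s hv ih => rw [Finset.sum_cons, Finset.sum_cons, ← ih]; rfl
  exact h K

theorem Triangulation.affineInterp_compatible (T : Triangulation Ω) (φ : Space d → ℝ)
    {K L : Finset (Space d)} (hK : K ∈ T.cells) (hL : L ∈ T.cells) {x : Space d}
    (hxK : x ∈ simplex K) (hxL : x ∈ simplex L) : affineInterp φ K x = affineInterp φ L x := by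
  classical
  have hx : x ∈ convexHull ℝ ((K ∩ L : Finset (Space d)) : Set (Space d)) := by
    rw [Finset.coe_inter, ← T.conforming K hK L hL]
    exact ⟨hxK, hxL⟩
  obtain ⟨w, hw1, hw0, rfl⟩ := exists_face_weights hx
  have key : ∀ {M : Finset (Space d)}, M ∈ T.cells → K ∩ L ⊆ M →
      affineInterp φ M (∑ y ∈ K ∩ L, w y • y) = ∑ v ∈ K ∩ L, φ v * w v := by
    intro M hM hsub
    rw [affineInterp_apply]
    refine (Finset.sum_congr rfl fun v hv => by
      rw [(T.isCell hM).bary_face hsub hw1 hw0 hv]).trans ?_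
    exact (Finset.sum_subset hsub fun v _ hv => by rw [hw0 v hv, mul_zero]).symm
  rw [key hK Finset.inter_subset_left, key hL Finset.inter_subset_right]

/-- Second-order Taylor estimate for a test function. -/
theorem IsTestFunction.exists_taylor {φ : Space d → ℝ} (hφ : IsTestFunction Ω φ) :
    ∃ M ≥ 0, ∀ x y, |φ y - φ x - fderiv ℝ φ x (y - x)| ≤ M * ‖y - x‖ ^ 2 := by
  have h1 : ContDiff ℝ 1 (fderiv ℝ φ) := hφ.1.fderiv_right (m := 1) (by norm_cast)
  obtain ⟨M, hM⟩ := h1.lipschitzWith_of_hasCompactSupport (hφ.2.1.fderiv ℝ) one_ne_zero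
  refine ⟨M, M.2, fun x y => ?_⟩
  have h := (convex_closedBall x ‖y - x‖).norm_image_sub_le_of_norm_fderiv_le' (𝕜 := ℝ) (f := φ)
    (φ := fderiv ℝ φ x) (C := M * ‖y - x‖) (fun z _ => hφ.differentiable z) (fun z hz => ?_)
    (Metric.mem_closedBall_self (norm_nonneg _)) (y := y) (by simp [dist_eq_norm])
  · rw [← Real.norm_eq_abs, sq, ← mul_assoc]
    exact h
  · have := hM.dist_le_mul z x
    rw [dist_eq_norm] at this
    exact this.trans (by gcongr; exact hz)

/-- Error of affine interpolation on a cell. -/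
theorem IsCell.affineInterp_error (hK : IsCell K) {φ : Space d → ℝ}
    {M : ℝ} (hM : 0 ≤ M) (hφ : ∀ x y, |φ y - φ x - fderiv ℝ φ x (y - x)| ≤ M * ‖y - x‖ ^ 2)
    {x : Space d} (hx : x ∈ simplex K) {z : Space d} (hz : z ∈ simplex K) :
    |affineInterp φ K z - (φ x + fderiv ℝ φ x (z - x))| ≤ M * Metric.diam (simplex K) ^ 2 := by
  -- Barycentric coordinates sum to `1` and reproduce positions, so affine functions are
  -- interpolated exactly and only the Taylor remainders at the vertices survive.
  have h1 : affineInterp φ K z - (φ x + fderiv ℝ φ x (z - x)) =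
      ∑ v ∈ K, bary K v z * (φ v - φ x - fderiv ℝ φ x (v - x)) := by
    have hz' : fderiv ℝ φ x (z - x) = ∑ v ∈ K, bary K v z * fderiv ℝ φ x (v - x) := by
      have : z - x = ∑ v ∈ K, bary K v z • (v - x) := by
        simp only [smul_sub, Finset.sum_sub_distrib, ← Finset.sum_smul, hK.sum_bary_smul,
          hK.sum_bary, one_smul]
      rw [this]
      simp only [map_sum, map_smul, smul_eq_mul]
    rw [affineInterp_apply, hz']
    simp only [mul_sub, Finset.sum_sub_distrib, ← Finset.sum_mul, hK.sum_bary, one_mul]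
    rw [Finset.sum_congr rfl fun v _ => mul_comm (φ v) (bary K v z)]
    ring
  rw [h1]
  refine (Finset.abs_sum_le_sum_abs _ _).trans ?_
  calc _ ≤ ∑ v ∈ K, bary K v z * (M * Metric.diam (simplex K) ^ 2) := by
        refine Finset.sum_le_sum fun v hv => ?_
        rw [abs_mul, abs_of_nonneg (hK.bary_nonneg hz hv)]
        refine mul_le_mul_of_nonneg_left ((hφ x v).trans ?_) (hK.bary_nonneg hz hv)
        gcongr
        rw [← dist_eq_norm]
        exact Metric.dist_le_diam_of_mem (isCompact_simplex K).isBounded (subset_simplex K hv) hx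
    _ = _ := by rw [← Finset.sum_mul, hK.sum_bary, one_mul]

/-- Gradient error of affine interpolation on a shape-regular cell. -/
theorem IsCell.affineInterp_gradient_error (hK : IsCell K) {φ : Space d → ℝ}
    {M : ℝ} (hM : 0 ≤ M) (hφ : ∀ x y, |φ y - φ x - fderiv ℝ φ x (y - x)| ≤ M * ‖y - x‖ ^ 2)
    {c : Space d} {r σ : ℝ} (hr : 0 < r) (hball : Metric.closedBall c r ⊆ simplex K)
    (hσ : Metric.diam (simplex K) ≤ σ * (2 * r)) {x : Space d} (hx : x ∈ simplex K)
    {e : Space d} (he : ‖e‖ = 1) :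
    |(affineInterp φ K).linear e - fderiv ℝ φ x e| ≤ 4 * σ * M * Metric.diam (simplex K) := by
  set D := Metric.diam (simplex K)
  have hD : 0 ≤ D := Metric.diam_nonneg
  have h1 := hK.affineInterp_error hM hφ hx (hball (Metric.mem_closedBall_self hr.le))
  -- The affine error is evaluated at the centre of the inscribed ball and at distance `r` along
  -- `e`. The two values differ by `r` times the gradient error, and `D ≤ 2 σ r` absorbs one factor
  -- of the diameter.
  have h2 := hK.affineInterp_error hM hφ hx (z := c + r • e) (hball (by
    simp [norm_smul, he, abs_of_pos hr]))
  have h3 : affineInterp φ K (c + r • e) =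
      affineInterp φ K c + r * (affineInterp φ K).linear e := by
    have := (affineInterp φ K).map_vadd c (r • e)
    rw [vadd_eq_add, vadd_eq_add, add_comm] at this
    rw [this, map_smul, smul_eq_mul, add_comm]
  have h4 : fderiv ℝ φ x (c + r • e - x) = fderiv ℝ φ x (c - x) + r * fderiv ℝ φ x e := by
    rw [show c + r • e - x = (c - x) + r • e by abel, map_add, map_smul, smul_eq_mul]
  rw [h3, h4] at h2
  have h5 : r * |(affineInterp φ K).linear e - fderiv ℝ φ x e| ≤ 2 * (M * D ^ 2) := by
    change _ ≤ M * D ^ 2 at h1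
    change _ ≤ M * D ^ 2 at h2
    have h6 : r * |(affineInterp φ K).linear e - fderiv ℝ φ x e| =
        |r * ((affineInterp φ K).linear e - fderiv ℝ φ x e)| := by rw [abs_mul, abs_of_pos hr]
    rw [h6]
    rw [abs_le] at h1 h2 ⊢
    constructor <;> linarith [h1.1, h1.2, h2.1, h2.2]
  refine le_of_mul_le_mul_left (h5.trans ?_) hr
  have h6 : M * D * D ≤ M * D * (σ * (2 * r)) := by gcongr
  nlinarith

namespace Triangulation

variable (T : Triangulation Ω)

/-- The continuous piecewise affine interpolate. -/
def affineInterpolate (φ : Space d → ℝ) : Space d → ℝ :=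
  T.glue fun K => affineInterp φ K

theorem affineInterpolate_eq (φ : Space d → ℝ) {K : Finset (Space d)} (hK : K ∈ T.cells)
    {x : Space d} (hx : x ∈ simplex K) : T.affineInterpolate φ x = affineInterp φ K x :=
  T.glue_eq (g := fun K => affineInterp φ K)
    (fun _ hK _ hL _ hxK hxL => T.affineInterp_compatible φ hK hL hxK hxL) hK hx

theorem affineInterpolate_mem_lagrangeSpace (φ : Space d → ℝ) {l : ℕ} (hl : 1 ≤ l) :
    T.affineInterpolate φ ∈ T.lagrangeSpace l :=
  T.glue_mem_lagrangeSpace (g := fun K => affineInterp φ K)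
    (fun _ hK _ hL _ hxK hxL => T.affineInterp_compatible φ hK hL hxK hxL)
    fun K _ => (isPolyOn_affineMap (affineInterp φ K) univ).mono hl (subset_univ _)

/-- A nonzero value at `x` requires `φ ≠ 0` at some vertex of a cell containing `x`, hence within
the mesh size. -/
theorem tsupport_affineInterpolate_subset (φ : Space d → ℝ) :
    tsupport (T.affineInterpolate φ) ⊆ Metric.cthickening T.meshSize (tsupport φ) := by
  refine closure_minimal (fun x hx => ?_) Metric.isClosed_cthickening
  by_cases hxc : x ∈ closure Ω
  · obtain ⟨K, hK, hxK⟩ := T.exists_mem_simplex hxc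
    rw [Function.mem_support, T.affineInterpolate_eq φ hK hxK, affineInterp_apply] at hx
    obtain ⟨v, hv, hne⟩ := Finset.exists_ne_zero_of_sum_ne_zero hx
    exact Metric.mem_cthickening_of_dist_le x v _ _ (subset_tsupport φ (left_ne_zero_of_mul hne))
      (T.dist_le_meshSize hK hxK (subset_simplex K hv))
  · exact absurd (T.glue_eq_zero _ hxc) hx

/-- The cells and the complement of `Ω`, where the function vanishes, form a finite closed cover of
the space. The sum of the slopes is a common constant on the pieces; its dependence on the mesh is
harmless, as it only serves membership in `H¹₀`. -/
theorem exists_lipschitzWith_affineInterpolate (hΩo : IsOpen Ω) (φ : Space d → ℝ)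
    (hs : tsupport (T.affineInterpolate φ) ⊆ Ω) :
    ∃ L, LipschitzWith L (T.affineInterpolate φ) := by
  let N : Finset (Space d) → NNReal := fun K =>
    ‖LinearMap.toContinuousLinearMap (affineInterp φ K).linear‖₊
  refine ⟨∑ K ∈ T.cells, N K, lipschitzWith_of_finite_closed_cover
    (C := fun k : Option T.cells => k.elim Ωᶜ fun K => simplex (K : Finset (Space d))) ?_ ?_ ?_⟩
  · rintro (_ | K)
    · exact hΩo.isClosed_compl
    · exact (isCompact_simplex (K : Finset (Space d))).isClosed
  · refine eq_univ_of_forall fun x => mem_iUnion.mpr ?_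
    by_cases hx : x ∈ Ω
    · obtain ⟨K, hK, hxK⟩ := T.exists_mem_simplex (subset_closure hx)
      exact ⟨some ⟨K, hK⟩, hxK⟩
    · exact ⟨none, hx⟩
  · rintro (_ | K)
    · refine LipschitzOnWith.of_dist_le_mul fun x hx y hy => ?_
      rw [image_eq_zero_of_notMem_tsupport fun h => hx (hs h),
        image_eq_zero_of_notMem_tsupport fun h => hy (hs h), dist_self]
      positivity
    · refine LipschitzOnWith.of_dist_le_mul fun x hx y hy => ?_
      rw [T.affineInterpolate_eq φ K.2 hx, T.affineInterpolate_eq φ K.2 hy, dist_eq_norm,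
        dist_eq_norm, ← vsub_eq_sub, ← AffineMap.linearMap_vsub, vsub_eq_sub]
      refine ((LinearMap.toContinuousLinearMap
        (affineInterp φ (K : Finset (Space d))).linear).le_opNorm (x - y)).trans ?_
      gcongr
      exact NNReal.coe_le_coe.mpr (Finset.single_le_sum (f := N) (fun _ _ => zero_le) K.2)

theorem lineDeriv_affineInterpolate (φ : Space d → ℝ) {K : Finset (Space d)} (hK : K ∈ T.cells)
    {x : Space d} (hx : x ∈ interior (simplex K)) (e : Space d) :
    lineDeriv ℝ (T.affineInterpolate φ) x e = (affineInterp φ K).linear e := by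
  have hev : T.affineInterpolate φ =ᶠ[nhds x] affineInterp φ K := by
    filter_upwards [isOpen_interior.mem_nhds hx] with y hy
    exact T.affineInterpolate_eq φ hK (interior_subset hy)
  rw [hev.lineDeriv_eq, lineDeriv]
  have h : (fun t : ℝ => affineInterp φ K (x + t • e)) =
      fun t : ℝ => t * (affineInterp φ K).linear e + affineInterp φ K x := by
    ext t
    have := (affineInterp φ K).map_vadd x (t • e)
    rw [vadd_eq_add, vadd_eq_add, add_comm] at this
    rw [this, map_smul, smul_eq_mul]
  rw [h]
  simp

end Triangulation

/-- Test functions are approximated in `H¹` by the discrete spaces of a regular family. -/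
theorem IsTestFunction.exists_discrete_approx (hΩo : IsOpen Ω) (hΩb : Bornology.IsBounded Ω)
    (hΩr : interior (closure Ω) = Ω) {φ : Space d → ℝ} (hφ : IsTestFunction Ω φ) {l : ℕ}
    (hl : 1 ≤ l) (σ : ℝ) {ε : ℝ} (hε : 0 < ε) :
    ∃ δ > 0, ∀ T : Triangulation Ω, T.IsShapeRegular σ → T.meshSize < δ →
      ∃ v, ∃ hv : v ∈ T.discreteSpace l,
        ‖hv.2.1.pair - mkPair hφ.memL2 hφ.memLp_classicalGrad‖ < ε := by
  have := isFiniteMeasure_restrict hΩb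
  obtain ⟨M, hM, htay⟩ := hφ.exists_taylor
  obtain ⟨δ₀, hδ₀, hδΩ⟩ := hφ.2.1.isCompact.exists_cthickening_subset_open hΩo hφ.2.2
  set V : ℝ := volume.real Ω with hV
  have hV0 : 0 ≤ V := measureReal_nonneg
  set C : ℝ := M ^ 2 * V + d * ((4 * |σ| * M) ^ 2 * V) with hC
  have hC0 : 0 ≤ C := by positivity
  -- `δ₀` keeps the support inside `Ω`, `1` gives `h² ≤ h`, and the last entry makes the squared
  -- error, at most `C h²`, smaller than `ε²`.
  refine ⟨min δ₀ (min 1 (ε ^ 2 / (C + 1))), by positivity, fun T hσ hT => ?_⟩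
  set h := T.meshSize with hh
  have hh0 : 0 ≤ h := T.meshSize_nonneg
  have hh1 : h ≤ 1 := (hT.trans_le ((min_le_right _ _).trans (min_le_left _ _))).le
  have hhε : h < ε ^ 2 / (C + 1) := hT.trans_le ((min_le_right _ _).trans (min_le_right _ _))
  have hsub := T.tsupport_affineInterpolate_subset φ
  have hts : tsupport (T.affineInterpolate φ) ⊆ Ω :=
    hsub.trans ((Metric.cthickening_mono (hT.trans_le (min_le_left _ _)).le _).trans hδΩ)
  have hcs : HasCompactSupport (T.affineInterpolate φ) :=
    hφ.2.1.isCompact.cthickening.of_isClosed_subset (isClosed_tsupport _) hsub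
  obtain ⟨L, hL⟩ := T.exists_lipschitzWith_affineInterpolate hΩo φ hts
  have hH10 : MemH10 Ω (T.affineInterpolate φ) := memH10_of_lipschitz hΩo hΩb hL hcs hts
  refine ⟨_, ⟨T.affineInterpolate_mem_lagrangeSpace φ hl, hH10⟩, ?_⟩
  have hcell : ∀ᵐ x ∂(volume.restrict Ω), ∃ K ∈ T.cells, x ∈ interior (simplex K) := by
    have := T.ae_mem_interior
    rwa [Measure.restrict_congr_set (T.closure_ae_eq hΩr)] at this
  have hb₀ : ∀ᵐ x ∂(volume.restrict Ω),
      ‖(T.affineInterpolate φ x - φ x) ^ 2‖ ≤ M ^ 2 * h ^ 2 := by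
    filter_upwards [hcell] with x hx
    obtain ⟨K, hK, hxK⟩ := hx
    have hxK' := interior_subset hxK
    have h1 := (T.isCell hK).affineInterp_error hM htay hxK' hxK'
    have h2 : Metric.diam (simplex K) ≤ h := T.diam_le_meshSize hK
    have h3 : M * Metric.diam (simplex K) ^ 2 ≤ M * h := by
      have : Metric.diam (simplex K) ^ 2 ≤ h := by nlinarith [Metric.diam_nonneg (s := simplex K)]
      gcongr
    rw [sub_self, map_zero, add_zero] at h1
    rw [T.affineInterpolate_eq φ hK hxK', norm_pow, Real.norm_eq_abs, ← mul_pow]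
    gcongr
    exact h1.trans h3
  have hb₁ : ∀ i, ∀ᵐ x ∂(volume.restrict Ω), ‖(weakPartial Ω i (T.affineInterpolate φ) x -
      classicalPartial i φ x) ^ 2‖ ≤ (4 * |σ| * M) ^ 2 * h ^ 2 := by
    intro i
    filter_upwards [hcell, (hH10.1.isWeakPartial i).ae_eq hΩo hΩb
      (isWeakPartial_lineDeriv hΩb hL i) (ae_eq_refl _)] with x hx hx'
    obtain ⟨K, hK, hxK⟩ := hx
    obtain ⟨c, r, hr, hball, hreg⟩ := hσ K hK
    have h1 := (T.isCell hK).affineInterp_gradient_error hM htay hr hball hreg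
      (interior_subset hxK) (e := EuclideanSpace.single i 1) (by simp)
    rw [hx', T.lineDeriv_affineInterpolate φ hK hxK, norm_pow, Real.norm_eq_abs, ← mul_pow]
    have h2 : Metric.diam (simplex K) ≤ h := T.diam_le_meshSize hK
    refine pow_le_pow_left₀ (abs_nonneg _) (h1.trans ?_) 2
    have := Metric.diam_nonneg (s := simplex K)
    gcongr
    exact le_abs_self σ
  have hΩf : volume Ω < ⊤ := hΩb.measure_lt_top
  have hI₀ : ∫ x in Ω, (T.affineInterpolate φ x - φ x) ^ 2 ≤ M ^ 2 * h ^ 2 * V :=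
    (le_abs_self _).trans (norm_setIntegral_le_of_norm_le_const_ae hΩf hb₀)
  have hI₁ : ∀ i, ∫ x in Ω, (weakPartial Ω i (T.affineInterpolate φ) x -
      classicalPartial i φ x) ^ 2 ≤ (4 * |σ| * M) ^ 2 * h ^ 2 * V := fun i =>
    (le_abs_self _).trans (norm_setIntegral_le_of_norm_le_const_ae hΩf (hb₁ i))
  have hsum := (MemH1.norm_sq_pair_sub hH10.1 hφ).trans_le
    (add_le_add hI₀ (Finset.sum_le_sum fun i _ => hI₁ i))
  rw [Finset.sum_const, Finset.card_univ, Fintype.card_fin, nsmul_eq_mul] at hsum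
  refine lt_of_pow_lt_pow_left₀ 2 hε.le (hsum.trans_lt ?_)
  rw [lt_div_iff₀ (by positivity)] at hhε
  calc _ = C * h ^ 2 := by rw [hC]; ring
    _ ≤ C * h := by
        gcongr
        nlinarith
    _ ≤ h * (C + 1) := by linarith
    _ < ε ^ 2 := hhε

/-- The discrete spaces of a regular family approximate every element of `H¹₀`. -/
theorem exists_discretePairs_approx (hΩo : IsOpen Ω) (hΩb : Bornology.IsBounded Ω)
    (hΩr : interior (closure Ω) = Ω) {l : ℕ} (hl : 1 ≤ l) (σ : ℝ) (e : H10Space Ω) {ε : ℝ}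
    (hε : 0 < ε) :
    ∃ δ > 0, ∀ T : Triangulation Ω, T.IsShapeRegular σ → T.meshSize < δ →
      ∃ w ∈ T.discretePairs hΩo hΩb l, ‖w - e‖ < ε := by
  obtain ⟨_, ⟨φ, hφ, rfl⟩, hlt⟩ := Metric.mem_closure_iff.mp e.2 (ε / 2) (half_pos hε)
  obtain ⟨δ, hδ, H⟩ := hφ.exists_discrete_approx hΩo hΩb hΩr hl σ (half_pos hε)
  refine ⟨δ, hδ, fun T hσ hT => ?_⟩
  obtain ⟨v, hv, hve⟩ := H T hσ hT
  refine ⟨hv.2.toH10, (T.mem_discretePairs hΩo hΩb).mpr ⟨v, hv, rfl⟩, ?_⟩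
  rw [Submodule.coe_norm, Submodule.coe_sub]
  change ‖hv.2.1.pair - (e : L2Pair Ω)‖ < ε
  rw [dist_eq_norm, norm_sub_rev] at hlt
  calc _ ≤ ‖hv.2.1.pair - mkPair hφ.memL2 hφ.memLp_classicalGrad‖ +
        ‖mkPair hφ.memL2 hφ.memLp_classicalGrad - (e : L2Pair Ω)‖ :=
        norm_sub_le_norm_sub_add_norm_sub _ _ _
    _ < ε / 2 + ε / 2 := add_lt_add hve hlt
    _ = ε := add_halves ε

/-! ### The discrete problems as Galerkin problems -/

theorem memL2_advect {a : Space d → Space d} (ha : MemLp a ⊤ (volume.restrict Ω))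
    {v : Space d → ℝ} (hv : MemH1 Ω v) : MemL2 Ω (advect Ω a v) :=
  (memLp_congr_ae (advL_ae ha hv.gradL_pair_ae)).mp (Lp.memLp _)

/-- The form `B` on `H¹₀`. -/
def formB₀ {a : Space d → Space d} (ha : MemLp a ⊤ (volume.restrict Ω)) {μ : Space d → ℝ}
    (hμ : MemLp μ ⊤ (volume.restrict Ω)) : H10Space Ω →L[ℝ] H10Space Ω →L[ℝ] ℝ :=
  (formB ha hμ).bilinearComp (H10Space Ω).subtypeL (H10Space Ω).subtypeL

/-- The form `S` on `H¹₀`. -/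
def formS₀ {a : Space d → Space d} (ha : MemLp a ⊤ (volume.restrict Ω)) :
    H10Space Ω →L[ℝ] H10Space Ω →L[ℝ] ℝ :=
  (formS ha).bilinearComp (H10Space Ω).subtypeL (H10Space Ω).subtypeL

theorem formB₀_toH10 {a : Space d → Space d} (ha : MemLp a ⊤ (volume.restrict Ω))
    {μ : Space d → ℝ} (hμ : MemLp μ ⊤ (volume.restrict Ω)) {v w : Space d → ℝ}
    (hv : MemH10 Ω v) (hw : MemH10 Ω w) : formB₀ ha hμ hv.toH10 hw.toH10 = bilin Ω a μ v w :=
  formB_pair ha hμ hv.1 hw.1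

theorem formS₀_toH10 {a : Space d → Space d} (ha : MemLp a ⊤ (volume.restrict Ω))
    {v w : Space d → ℝ} (hv : MemH10 Ω v) (hw : MemH10 Ω w) :
    formS₀ ha hv.toH10 hw.toH10 = ∫ x in Ω, advect Ω a v x * advect Ω a w x :=
  formS_pair ha hv.1 hw.1

/-- The exact solution converts `(f, v)` into `B(u, v)`, so `f` disappears, and with constant `τ`
the sum over cells collapses to one integral over `Ω`. -/
theorem Triangulation.isDiscreteSolution_iff (hΩo : IsOpen Ω) (hΩb : Bornology.IsBounded Ω)
    (hΩr : interior (closure Ω) = Ω) (T : Triangulation Ω) {l : ℕ} {a : Space d → Space d}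
    (ha : MemLp a ⊤ (volume.restrict Ω)) {μ : Space d → ℝ} (hμ : MemLp μ ⊤ (volume.restrict Ω))
    {f u : Space d → ℝ} (hu : IsWeakSolution Ω a μ f u) (τ : ℝ) {w : Space d → ℝ}
    (hw : w ∈ T.discreteSpace l) : T.IsDiscreteSolution l a μ f (fun _ => τ) w ↔
      IsGalerkin (formB₀ ha hμ) (formS₀ ha) (T.discretePairs hΩo hΩb l) τ
        (formB₀ ha hμ hu.1.toH10) hw.2.toH10 := by
  have key : ∀ v (hv : v ∈ T.discreteSpace l),
      (bilin Ω a μ w v + T.stab (fun _ => τ) (advect Ω a w) (advect Ω a v) = ∫ x in Ω, f x * v x) ↔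
      formB₀ ha hμ hw.2.toH10 hv.2.toH10 + τ * formS₀ ha hw.2.toH10 hv.2.toH10 =
        formB₀ ha hμ hu.1.toH10 hv.2.toH10 := by
    intro v hv
    rw [formB₀_toH10, formB₀_toH10, formS₀_toH10, hu.2 v hv.2,
      T.stab_const hΩr τ (memL2_advect ha hw.2.1) (memL2_advect ha hv.2.1)]
  constructor
  · rintro ⟨-, h⟩
    refine ⟨(T.mem_discretePairs hΩo hΩb).mpr ⟨w, hw, rfl⟩, fun e he => ?_⟩
    have hmem := (T.mem_discretePairs hΩo hΩb).mp he
    obtain ⟨v, hv, hev⟩ := hmem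
    rw [hev]
    exact (key v hv).mp (h v hv)
  · rintro ⟨-, h⟩
    exact ⟨hw, fun v hv => (key v hv).mpr
      (h _ ((T.mem_discretePairs hΩo hΩb).mpr ⟨v, hv, rfl⟩))⟩

theorem memL2_of_continuousOn (hΩb : Bornology.IsBounded Ω) {v : Space d → ℝ}
    (hv : ContinuousOn v (closure Ω)) : MemL2 Ω v := by
  have := isFiniteMeasure_restrict hΩb.closure
  obtain ⟨C, hC⟩ := hΩb.isCompact_closure.exists_bound_of_continuousOn hv
  have h : MemLp v 2 (volume.restrict (closure Ω)) :=
    MemLp.of_bound (hv.aestronglyMeasurable isClosed_closure.measurableSet) C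
      ((ae_restrict_iff' isClosed_closure.measurableSet).mpr (.of_forall hC))
  exact h.mono_measure (Measure.restrict_mono subset_closure le_rfl)

/-- The advective derivative of the exact solution does not vanish. -/
theorem not_ae_advect_eq_zero (hΩo : IsOpen Ω) (hΩb : Bornology.IsBounded Ω)
    {a : Space d → Space d} (ha : MemLp a ⊤ (volume.restrict Ω)) {u : Space d → ℝ}
    (hu : MemH10 Ω u) (huH2 : MemH2 Ω u)
    (hΔ : ¬ ∀ᵐ x ∂(volume.restrict Ω), weakLaplacian Ω u x = 0)
    (hadv : (∃ c : Space d, c ≠ 0 ∧ ∀ᵐ x ∂(volume.restrict Ω), a x = c) ∨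
      ¬ ∀ᵐ x ∂(volume.restrict Ω), advect Ω a u x = 0) :
    ¬ ∀ᵐ x ∂(volume.restrict Ω), advect Ω a u x = 0 := by
  rcases hadv with ⟨c, hc, hac⟩ | hadv
  swap
  · exact hadv
  intro h0
  apply hΔ
  obtain ⟨R, hR⟩ := hΩb.exists_norm_le
  have hadv0 : advL ha (gradL Ω hu.1.pair) = 0 := by
    refine Lp.ext ?_
    filter_upwards [advL_ae ha hu.1.gradL_pair_ae, h0, Lp.coeFn_zero ℝ 2 (volume.restrict Ω)]
      with x h1 h2 h3
    rw [h1, h3]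
    exact h2
  -- With constant advection `c ≠ 0`, the directional inequality forces `u = 0` almost everywhere,
  -- hence a vanishing Laplacian.
  have hp := H10Space.poincare hΩo hR c ha hac hu.pair_mem
  rw [hadv0, norm_zero] at hp
  have hcpos : 0 < ‖c‖ := norm_pos_iff.mpr hc
  have hfun : funL Ω hu.1.pair = 0 := by
    have h1 : ‖c‖ ^ 2 * ‖funL Ω hu.1.pair‖ ^ 2 ≤ 0 := by simpa using hp
    have h2 : ‖funL Ω hu.1.pair‖ ^ 2 ≤ 0 := nonpos_of_mul_nonpos_right h1 (by positivity)
    exact norm_eq_zero.mp ((pow_eq_zero_iff two_ne_zero).mp (le_antisymm h2 (by positivity)))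
  have hu0 : u =ᵐ[volume.restrict Ω] 0 := by
    filter_upwards [hu.1.funL_pair_ae, Lp.coeFn_zero ℝ 2 (volume.restrict Ω)] with x h1 h2
    rw [← h1, hfun, h2]
  have hzero : ∀ i, IsWeakPartial Ω i (0 : Space d → ℝ) 0 := fun i =>
    ⟨MemLp.zero, fun φ _ => by simp⟩
  have hsecond : ∀ i, weakPartial Ω i (weakPartial Ω i u) =ᵐ[volume.restrict Ω] 0 := fun i =>
    ((huH2.2 i).isWeakPartial i).ae_eq hΩo hΩb (hzero i)
      ((hu.1.isWeakPartial i).ae_eq hΩo hΩb (hzero i) hu0)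
  filter_upwards [Filter.eventually_all.mpr hsecond] with x hx
  exact Finset.sum_eq_zero fun i _ => hx i

/-- Tested against `u` itself, the functional gives `‖a·∇u‖²`. -/
theorem formS₀_ne_zero {a : Space d → Space d} (ha : MemLp a ⊤ (volume.restrict Ω))
    {u : Space d → ℝ} (hu : MemH10 Ω u)
    (hadv : ¬ ∀ᵐ x ∂(volume.restrict Ω), advect Ω a u x = 0) : formS₀ ha hu.toH10 ≠ 0 := by
  intro h0
  apply hadv
  have h1 : formS₀ ha hu.toH10 hu.toH10 = 0 := by rw [h0]; rfl
  rw [formS₀_toH10] at h1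
  have h2 := (integral_eq_zero_iff_of_nonneg (fun x => mul_self_nonneg (advect Ω a u x))
    ((memL2_advect ha hu.1).integrable_mul (memL2_advect ha hu.1))).mp h1
  filter_upwards [h2] with x hx
  exact mul_self_eq_zero.mp hx

/-- `L²` convergence of the Lagrange interpolates of a continuous function. -/
theorem exists_norm_sub_interpolate_le (hΩb : Bornology.IsBounded Ω) {l : ℕ} (hl : l ≠ 0)
    {u : Space d → ℝ} (huc : ContinuousOn u (closure Ω)) {δ : ℝ} (hδ : 0 < δ) :
    ∃ δ' > 0, ∀ T : Triangulation Ω, T.meshSize < δ' → ∀ hp : MemL2 Ω (T.interpolate l u),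
      ‖(memL2_of_continuousOn hΩb huc).memLp.toLp u - hp.memLp.toLp _‖ ≤ δ := by
  have hV0 : 0 ≤ volume.real Ω := measureReal_nonneg
  set V : ℝ := volume.real Ω
  -- A uniform error `δ / (V + 1)` suffices in `L²` because `V ≤ (V + 1)²`.
  obtain ⟨δ', hδ', H⟩ := Triangulation.exists_abs_interpolate_sub_le hΩb hl huc
    (ε := δ / (V + 1)) (by positivity)
  refine ⟨δ', hδ', fun T hT hp => ?_⟩
  have hae : ((memL2_of_continuousOn hΩb huc).memLp.toLp u - hp.memLp.toLp _ :
      Lp ℝ 2 (volume.restrict Ω)) =ᵐ[volume.restrict Ω] fun x => u x - T.interpolate l u x := by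
    filter_upwards [Lp.coeFn_sub ((memL2_of_continuousOn hΩb huc).memLp.toLp u)
      (hp.memLp.toLp (T.interpolate l u)), (memL2_of_continuousOn hΩb huc).memLp.coeFn_toLp,
      hp.memLp.coeFn_toLp] with x h1 h2 h3
    rw [h1, Pi.sub_apply, h2, h3]
  refine le_of_sq_le_sq ?_ hδ.le
  rw [norm_sq_Lp_eq hae]
  have hb := norm_setIntegral_le_of_norm_le_const (f := fun x => (u x - T.interpolate l u x) ^ 2)
    (C := (δ / (V + 1)) ^ 2) (hΩb.measure_lt_top (μ := volume)) (fun x hx => by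
      rw [norm_pow, Real.norm_eq_abs, abs_sub_comm]
      exact pow_le_pow_left₀ (abs_nonneg _) (H T hT x (subset_closure hx)) 2)
  refine ((le_abs_self _).trans hb).trans ?_
  change (δ / (V + 1)) ^ 2 * V ≤ δ ^ 2
  rw [div_pow, div_mul_eq_mul_div, div_le_iff₀ (by positivity)]
  exact mul_le_mul_of_nonneg_left (by nlinarith) (by positivity)

/-- The stabilised method is solvable. -/
theorem Triangulation.isDiscreteSolution_discreteSolution (hΩo : IsOpen Ω)
    (hΩb : Bornology.IsBounded Ω) (hΩr : interior (closure Ω) = Ω) (T : Triangulation Ω) {l : ℕ}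
    {a : Space d → Space d} (ha : MemLp a ⊤ (volume.restrict Ω)) {μ : Space d → ℝ}
    (hμ : MemLp μ ⊤ (volume.restrict Ω)) {c : ℝ} (hc : 0 < c)
    (hB : ∀ e ∈ H10Space Ω, c * ‖e‖ * ‖e‖ ≤ formB ha hμ e e) {f u : Space d → ℝ}
    (hu : IsWeakSolution Ω a μ f u) {τ : ℝ} (hτ : 0 ≤ τ) :
    T.IsDiscreteSolution l a μ f (fun _ => τ) (T.discreteSolution l a μ f τ) := by
  have hcomplete : CompleteSpace (T.discretePairs hΩo hΩb l) := FiniteDimensional.complete ℝ _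
  obtain ⟨e, he⟩ := exists_isGalerkin (B := formB₀ ha hμ) (S := formS₀ ha)
    (X := T.discretePairs hΩo hΩb l) hc (fun v => hB v v.2) (fun v => formS_self_nonneg ha v) hτ
    (formB₀ ha hμ hu.1.toH10)
  obtain ⟨w, hw, hew⟩ := (T.mem_discretePairs hΩo hΩb).mp he.1
  rw [hew] at he
  have h : ∃ w, T.IsDiscreteSolution l a μ f (fun _ => τ) w :=
    ⟨w, (T.isDiscreteSolution_iff hΩo hΩb hΩr ha hμ hu τ hw).mpr he⟩
  rw [Triangulation.discreteSolution, dif_pos h]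
  exact h.choose_spec

/-- The least-squares functional is strictly convex near `0`, uniformly over fine meshes. -/
theorem exists_strictConvexOn_lsFunctional (hΩo : IsOpen Ω)
    (hΩb : Bornology.IsBounded Ω) (hΩr : interior (closure Ω) = Ω)
    {a : Space d → Space d} (ha : MemLp a ⊤ (volume.restrict Ω)) {μ : Space d → ℝ}
    (hμ : MemLp μ ⊤ (volume.restrict Ω)) {c : ℝ} (hc : 0 < c)
    (hB : ∀ e ∈ H10Space Ω, c * ‖e‖ * ‖e‖ ≤ formB ha hμ e e) {f u : Space d → ℝ}
    (hu : IsWeakSolution Ω a μ f u) (huc : ContinuousOn u (closure Ω))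
    (hadv : ¬ ∀ᵐ x ∂(volume.restrict Ω), advect Ω a u x = 0)
    {ι : Type*} (T : ι → Triangulation Ω) {σ : ℝ} (hT : ∀ i, (T i).IsShapeRegular σ)
    {l : ℕ} (hl : l ≠ 0) :
    ∃ δ > 0, ∀ i, (T i).meshSize < δ →
      ContinuousOn ((T i).lsFunctional l a μ f u) (Icc 0 δ) ∧
        StrictConvexOn ℝ (Icc 0 δ) ((T i).lsFunctional l a μ f u) := by
  have hcomplete : ∀ i, CompleteSpace ((T i).discretePairs hΩo hΩb l) := fun i =>
    FiniteDimensional.complete ℝ _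
  have hinj : Function.Injective ((funL Ω).comp (H10Space Ω).subtypeL) := by
    refine (injective_iff_map_eq_zero _).mpr fun e he => ?_
    exact Subtype.ext (H10Space.funL_injective hΩo hΩb e.2 he)
  -- The map `j` is the projection to the `L²` component, as `J` measures only that norm, whereas
  -- convergence takes place in `H¹₀`.
  obtain ⟨δ, hδ, H⟩ := exists_strictConvexOn_of_isGalerkin (B := formB₀ ha hμ) (S := formS₀ ha)
    hc (fun v => hB v v.2) (fun v => formS_self_nonneg ha v)
    ((funL Ω).comp (H10Space Ω).subtypeL) hinj hu.1.toH10 (formS₀_ne_zero ha hu.1 hadv)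
    (fun i => (T i).discretePairs hΩo hΩb l) (fun i => (T i).meshSize) (fun e ε hε => by
      obtain ⟨δ, hδ, H⟩ := exists_discretePairs_approx hΩo hΩb hΩr (Nat.one_le_iff_ne_zero.mpr hl) σ e hε
      exact ⟨δ, hδ, fun i hi => H (T i) (hT i) hi⟩)
  obtain ⟨δ', hδ', H'⟩ := exists_norm_sub_interpolate_le hΩb hl huc hδ
  refine ⟨min δ δ', lt_min hδ hδ', fun i hi => ?_⟩
  have hp : MemL2 Ω ((T i).interpolate l u) :=
    memL2_of_continuousOn hΩb ((T i).isInterpolant_interpolate hl u).1.1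
  have hsol : ∀ τ, 0 ≤ τ →
      (T i).IsDiscreteSolution l a μ f (fun _ => τ) ((T i).discreteSolution l a μ f τ) :=
    fun τ hτ => (T i).isDiscreteSolution_discreteSolution hΩo hΩb hΩr ha hμ hc hB hu hτ
  classical
  -- The value `0` for negative `τ`, where coercivity may fail, is never seen on `Icc 0 δ`.
  let w : ℝ → H10Space Ω := fun τ => if hτ : 0 ≤ τ then (hsol τ hτ).1.2.toH10 else 0
  have hw : ∀ τ (hτ : 0 ≤ τ), w τ = (hsol τ hτ).1.2.toH10 := fun τ hτ => dif_pos hτ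
  have hfu : (funL Ω).comp (H10Space Ω).subtypeL hu.1.toH10 =
      (memL2_of_continuousOn hΩb huc).memLp.toLp u := by
    refine Lp.ext ?_
    filter_upwards [hu.1.1.funL_pair_ae, (memL2_of_continuousOn hΩb huc).memLp.coeFn_toLp]
      with x h1 h2
    rw [h2]
    exact h1
  obtain ⟨hcont, hconv⟩ := H i (hi.trans_le (min_le_left _ _)) (hp.memLp.toLp _)
    (by rw [hfu]; exact H' (T i) (hi.trans_le (min_le_right _ _)) hp) w (fun τ hτ => by
      rw [hw τ hτ.1]
      exact ((T i).isDiscreteSolution_iff hΩo hΩb hΩr ha hμ hu τ (hsol τ hτ.1).1).mp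
        (hsol τ hτ.1))
  have heq : EqOn (fun τ => (1 / 2 : ℝ) *
      ‖(funL Ω).comp (H10Space Ω).subtypeL (w τ) - hp.memLp.toLp _‖ ^ 2)
      ((T i).lsFunctional l a μ f u) (Icc 0 δ) := fun τ hτ => by
    have hae : ((funL Ω).comp (H10Space Ω).subtypeL (w τ) - hp.memLp.toLp _ :
        Lp ℝ 2 (volume.restrict Ω)) =ᵐ[volume.restrict Ω]
        fun x => (T i).discreteSolution l a μ f τ x - (T i).interpolate l u x := by
      rw [hw τ hτ.1]
      filter_upwards [Lp.coeFn_sub (funL Ω (hsol τ hτ.1).1.2.1.pair)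
        (hp.memLp.toLp ((T i).interpolate l u)), (hsol τ hτ.1).1.2.1.funL_pair_ae,
        hp.memLp.coeFn_toLp] with x h1 h2 h3
      refine h1.trans ?_
      rw [Pi.sub_apply, h2, h3]
    change (1 / 2 : ℝ) * _ = (1 / 2 : ℝ) * _
    rw [norm_sq_Lp_eq hae]
  have hsub : Icc 0 (min δ δ') ⊆ Icc 0 δ := Icc_subset_Icc_right (min_le_left _ _)
  exact ⟨(hcont.congr heq.symm).mono hsub, (hconv.congr heq).subset hsub (convex_Icc _ _)⟩

end AdvDiff

end

/-! ### Passage to the interval `[αmin h², αmax h²]` -/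

theorem mainTheorem1
    (d : ℕ) (hd₁ : 1 ≤ d) (hd₃ : d ≤ 3)
    -- the polytopal domain
    (Ω : Set (AdvDiff.Space d)) (hΩo : IsOpen Ω) (hΩc : IsConnected Ω)
    (hΩb : Bornology.IsBounded Ω) (hΩr : interior (closure Ω) = Ω)
    -- the data
    (a : AdvDiff.Space d → AdvDiff.Space d) (ha : MemLp a ⊤ (volume.restrict Ω))
    (hdiv : AdvDiff.IsDivFree Ω a)
    (μ : AdvDiff.Space d → ℝ) (hμ : MemLp μ ⊤ (volume.restrict Ω))
    (μ₀ : ℝ) (hμ₀ : 0 < μ₀) (hμ_ge : ∀ᵐ x ∂(volume.restrict Ω), μ₀ ≤ μ x)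
    (f : AdvDiff.Space d → ℝ) (hf : AdvDiff.MemL2 Ω f)
    -- the exact solution, in its continuous representative, so that it has values at the nodes
    (u : AdvDiff.Space d → ℝ) (hu : AdvDiff.IsWeakSolution Ω a μ f u)
    (huc : ContinuousOn u (closure Ω))
    (huH2 : AdvDiff.MemH2 Ω u)
    (hΔ : ¬ ∀ᵐ x ∂(volume.restrict Ω), AdvDiff.weakLaplacian Ω u x = 0)
    -- the advection is active: a nonzero constant, or not tangent to the level sets of `u`
    (hadv : (∃ c : AdvDiff.Space d, c ≠ 0 ∧ ∀ᵐ x ∂(volume.restrict Ω), a x = c) ∨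
      ¬ ∀ᵐ x ∂(volume.restrict Ω), AdvDiff.advect Ω a u x = 0)
    (hadj : AdvDiff.AdjointH2Regularising Ω a μ)
    -- the regular family of triangulations and the polynomial degree
    {ι : Type*} (T : ι → AdvDiff.Triangulation Ω)
    (σ : ℝ) (hT : ∀ i, (T i).IsShapeRegular σ)
    (l : ℕ) (hl : 1 ≤ l) :
    ∃ α₀ : ℝ, 0 < α₀ ∧ ∀ αmax : ℝ, α₀ < αmax → ∃ h₀ : ℝ, 0 < h₀ ∧
      ∀ αmin : ℝ, α₀ ≤ αmin → αmin < αmax → ∀ i, (T i).meshSize < h₀ →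
        StrictConvexOn ℝ
          (Icc (αmin * (T i).meshSize ^ 2) (αmax * (T i).meshSize ^ 2))
          ((T i).lsFunctional l a μ f u) ∧
        ∃! τ : ℝ, τ ∈ Icc (αmin * (T i).meshSize ^ 2) (αmax * (T i).meshSize ^ 2) ∧
          IsMinOn ((T i).lsFunctional l a μ f u)
            (Icc (αmin * (T i).meshSize ^ 2) (αmax * (T i).meshSize ^ 2)) τ := by
  obtain ⟨c, hc, hB⟩ := AdvDiff.exists_formB_coercive hd₁ hΩo hΩb ha hdiv hμ hμ₀ hμ_ge
  obtain ⟨δ, hδ, H⟩ := AdvDiff.exists_strictConvexOn_lsFunctional hΩo hΩb hΩr ha hμ hc hB hu huc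
    (AdvDiff.not_ae_advect_eq_zero hΩo hΩb ha hu.1 huH2 hΔ hadv) T hT
    (Nat.one_le_iff_ne_zero.mp hl)
  -- Convexity holds on all of `[0, δ]`, so any positive number serves as `α₀`.
  refine ⟨1, one_pos, fun αmax hαmax => ?_⟩
  have hpos : 0 < αmax := one_pos.trans hαmax
  -- `h < δ` makes the mesh fine enough for convexity on `[0, δ]`; `h < 1` together with `αmax h <
  -- δ` gives `αmax h² ≤ δ`, a bound independent of `αmin`.
  refine ⟨min δ (min 1 (δ / αmax)), by positivity, fun αmin hαmin _ i hi => ?_⟩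
  have h0 := (T i).meshSize_nonneg
  have hi₁ : (T i).meshSize < δ := hi.trans_le (min_le_left _ _)
  have hi₂ : (T i).meshSize < 1 := hi.trans_le ((min_le_right _ _).trans (min_le_left _ _))
  have hi₃ : αmax * (T i).meshSize ≤ δ := by
    have := hi.trans_le ((min_le_right _ _).trans (min_le_right _ _))
    rw [lt_div_iff₀ hpos] at this
    linarith
  obtain ⟨hcont, hconv⟩ := H i hi₁
  have hsub : Icc (αmin * (T i).meshSize ^ 2) (αmax * (T i).meshSize ^ 2) ⊆ Icc 0 δ := by
    refine Icc_subset_Icc (by positivity) ?_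
    have : αmax * (T i).meshSize * (T i).meshSize ≤ δ * 1 :=
      mul_le_mul hi₃ hi₂.le h0 hδ.le
    nlinarith
  have hstrict := hconv.subset hsub (convex_Icc _ _)
  -- Existence comes from continuity on a compact interval, uniqueness from strict convexity.
  obtain ⟨τ, hτ, hmin⟩ := isCompact_Icc.exists_isMinOn
    (nonempty_Icc.mpr (mul_le_mul_of_nonneg_right (le_of_lt ‹_›) (sq_nonneg (T i).meshSize)))
    (hcont.mono hsub)
  exact ⟨hstrict, τ, ⟨hτ, hmin⟩, fun τ' h => hstrict.eq_of_isMinOn h.2 hmin h.1 hτ⟩
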